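/- Setting. Let $(\mathscr T,\mathfrak h,\mathscr T')$ be a Gel'fand triple: $\mathfrak h$ is a complex Hilbert space, $\mathscr T$ is a topological vector space continuously and densely embedded in $\mathfrak h$, and $\mathscr T'$ is its continuous anti-dual, into which $\mathfrak h$ embeds by $x\mapsto\langle\,\cdot\,,x\rangle_{\mathfrak h}$; write $\langle g,f\rangle=\overline{g(f)}$ for $g\in\mathscr T'$, $f\in\mathscr T$. Let $\mathcal F_{\mathrm{fin}}(\mathscr T)$ be the space of finite linear combinations of the vacuum and of symmetric tensors $f_1\otimes_s\cdots\otimes_s f_n$ with $f_j\in\mathscr T$, inside the symmetric Fock space $\mathcal F(\mathfrak h)$, and let $a(g)$, $g\in\mathscr T'$, be the annihilation operator on $\mathcal F_{\mathrm{fin}}(\mathscr T)$, i.e. $\sqrt{n+1}$ times the contraction of the first tensor factor with $\langle g,\cdot\rangle$ on the $(n+1)$-particle sector. Let $\omega:\mathscr T\to\mathscr T$ be a linear homeomorphism that is a positive operator in $\mathfrak h$, and for $v\in\mathscr T'$ let $-v/\omega\in\mathscr T'$ be $f\mapsto -v(\omega^{-1}f)$. Fix $v\in\mathscr T'$ and put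 $g=-v/\omega$. Let $\mathcal S$ be a complex Hilbert space, $A$ a bounded self-adjoint and $B$ a bounded normal operator on $\mathcal S$, and $E_B$ the spectral measure of $B$. Assume that $A$ is $(E_B,E_B)$-decomposable: for all $\psi,\varphi\in\mathcal S$ there is a complex Borel measure $\mu_{\psi,\varphi}$ on $\mathbb C\times\mathbb C$, written $\langle dE_B(\lambda)\psi,A\,dE_B(\mu)\varphi\rangle$, with $\mu_{\psi,\varphi}(M\times N)=\langle E_B(M)\psi,A\,E_B(N)\varphi\rangle$ for all Borel sets $M,N$, and the total variations of $\mu_{\psi,\varphi}$ are bounded uniformly for $\|\psi\|,\|\varphi\|\le 1$. Let $\mathcal B_{B,g}$ be the completion of the algebraic tensor product $\mathcal S\hat\otimes\mathcal F_{\mathrm{fin}}(\mathscr T)$ under the inner product $$\langle\Psi,\Phi\rangle_{B,g}=\langle e^{B^*\otimes a(g)}\Psi,\,e^{B^*\otimes a(g)}\Phi\rangle_{\mathcal S\otimes\mathcal F(\mathfrak h)} .$$ Put $\chi_g(\lambda,\mu)=e^{(\bar\lambda\mu-\frac12(|\lambda|^2+|\mu|^2))\|g\|_{\mathfrak h}^2}$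 if $g\in\mathfrak h$, and $\chi_g(\lambda,\mu)=\mathbf 1_{\{\lambda=\mu\}}$ if $g\in\mathscr T'\setminus\mathfrak h$. Claim. For all $\psi,\varphi\in\mathcal S$ and $\Xi,\Theta\in\mathcal F_{\mathrm{fin}}(\mathscr T)$ the double operator integral $$\mathfrak a(\psi\otimes\Xi,\varphi\otimes\Theta)=\iint_{\mathbb C^2}\chi_g(\lambda,\mu)\,\bigl\langle e^{\bar\mu\, a(g)}\Xi,\,e^{\bar\lambda\, a(g)}\Theta\bigr\rangle_{\mathcal F}\,\langle dE_B(\lambda)\psi,A\,dE_B(\mu)\varphi\rangle_{\mathcal S}\qquad(*)$$ is absolutely convergent, and there is a unique bounded sesquilinear form $\mathfrak a$ on $\mathcal B_{B,g}$ satisfying $(*)$. Moreover: 1. $\mathfrak a$ is symmetric, $\mathfrak a(\Psi,\Phi)=\overline{\mathfrak a(\Phi,\Psi)}$, and $|\mathfrak a(\Psi,\Phi)|\le\|A\|\,\|\Psi\|_{B,g}\,\|\Phi\|_{B,g}$ for all $\Psi,\Phi\in\mathcal B_{B,g}$. 2. Let $(v_\alpha)$ be a net in $\mathscr T'$ with $g_\alpha:=-v_\alpha/\omega\in\mathfrak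 h$ for all $\alpha$ and $v_\alpha\to v$ in $\sigma(\mathscr T',\mathscr T)$; if $g\in\mathfrak h$, assume in addition that $g_\alpha\to g$ in the norm of $\mathfrak h$. Then for all $\Psi,\Phi\in\mathcal S\hat\otimes\mathcal F_{\mathrm{fin}}(\mathscr T)$ the regularized renormalized free-spin forms converge to $\mathfrak a$: $$\bigl\langle e^{-\frac12B^*B\|g_\alpha\|_{\mathfrak h}^2}e^{B\otimes a^\dagger(g_\alpha)}\Psi,\ (A\otimes 1)\,e^{-\frac12B^*B\|g_\alpha\|_{\mathfrak h}^2}e^{B\otimes a^\dagger(g_\alpha)}\Phi\bigr\rangle_{\mathcal S\otimes\mathcal F(\mathfrak h)}\ \longrightarrow\ \mathfrak a(\Psi,\Phi).$$ 3. There is a unique bounded self-adjoint operator $A(B,v)_g$ on $\mathcal B_{B,g}$ with $\langle\Psi,A(B,v)_g\Phi\rangle_{B,g}=\mathfrak a(\Psi,\Phi)$ for all $\Psi,\Phi\in\mathcal B_{B,g}$. -/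

import Mathlib

open scoped TensorProduct InnerProductSpace ComplexConjugate Topology
open MeasureTheory Filter

set_option linter.unusedSectionVars false

noncomputable section

namespace SpinBoson

universe u

/-- A complex inner product space, not necessarily complete. -/
structure PreHilbert : Type (u + 1) where
  carrier : Type u
  [group : NormedAddCommGroup carrier]
  [innerSpace : InnerProductSpace ℂ carrier]

attribute [instance] PreHilbert.group PreHilbert.innerSpace

section Tensor

variable (V : Type u) [NormedAddCommGroup V] [InnerProductSpace ℂ V]

/-- The algebraic tensor powers `V ⊗ (V ⊗ (⋯ ⊗ ℂ))` with their inner products. -/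
def tensorPow : ℕ → PreHilbert.{u}
  | 0 => ⟨EuclideanSpace ℂ PUnit.{u + 1}⟩
  | n + 1 => ⟨V ⊗[ℂ] (tensorPow n).carrier⟩

/-- The `n`-fold algebraic tensor power of `V`. -/
abbrev TP (n : ℕ) : Type u := (tensorPow V n).carrier

def zeroEquiv : TP V 0 ≃ₗᵢ[ℂ] EuclideanSpace ℂ PUnit.{u + 1} := LinearIsometryEquiv.refl ℂ _

def succEquiv (n : ℕ) : TP V (n + 1) ≃ₗᵢ[ℂ] V ⊗[ℂ] TP V n := LinearIsometryEquiv.refl ℂ _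

variable {V}

/-- `slot n v x = v ⊗ x`. -/
def slot (n : ℕ) : V →ₗ[ℂ] TP V n →ₗ[ℂ] TP V (n + 1) :=
  (TensorProduct.mk ℂ V (TP V n)).compr₂ (succEquiv V n).symm.toLinearEquiv.toLinearMap

variable (V) in
/-- The unit vector of the `0`-fold tensor power. -/
def vac : TP V 0 := (zeroEquiv V).symm (EuclideanSpace.single PUnit.unit 1)

/-- The pure tensor `f 0 ⊗ ⋯ ⊗ f (n - 1)`. -/
def tprod : (n : ℕ) → (Fin n → V) → TP V n
  | 0, _ => vac V
  | n + 1, f => slot n (f 0) (tprod n (Fin.tail f))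

/-- The symmetric tensor product `f 0 ⊗_s ⋯ ⊗_s f (n - 1) = (1 / n!) ∑_σ f (σ 0) ⊗ ⋯ ⊗ f (σ (n - 1))`. -/
def symProd (n : ℕ) (f : Fin n → V) : TP V n :=
  ((n.factorial : ℂ))⁻¹ • ∑ σ : Equiv.Perm (Fin n), tprod n (f ∘ σ)

/-- Contraction of the first factor, `v ⊗ x ↦ ℓ(v) x`. -/
def contract (ℓ : V →ₗ[ℂ] ℂ) (n : ℕ) : TP V (n + 1) →ₗ[ℂ] TP V n :=
  (TensorProduct.lid ℂ (TP V n)).toLinearMap ∘ₗ LinearMap.rTensor (TP V n) ℓ ∘ₗ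
    (succEquiv V n).toLinearEquiv.toLinearMap

/-- The sum of the insertions of `f` at the `n + 1` possible positions; on symmetric tensors it is
`n + 1` times the symmetric product with `f`. -/
def insertion (f : V) : (n : ℕ) → TP V n →ₗ[ℂ] TP V (n + 1)
  | 0 => slot 0 f
  | n + 1 => slot (n + 1) f + (succEquiv V (n + 1)).symm.toLinearEquiv.toLinearMap ∘ₗ
      LinearMap.lTensor V (insertion f n) ∘ₗ (succEquiv V n).toLinearEquiv.toLinearMap

/-- The tensor power `L ⊗ ⋯ ⊗ L`. -/
def tensorMap {W : Type*} [NormedAddCommGroup W] [InnerProductSpace ℂ W] (L : V →ₗ[ℂ] W) :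
    (n : ℕ) → TP V n →ₗ[ℂ] TP W n
  | 0 => (LinearMap.toSpanSingleton ℂ (TP W 0) (vac W)) ∘ₗ
      (EuclideanSpace.proj PUnit.unit : EuclideanSpace ℂ PUnit →L[ℂ] ℂ).toLinearMap ∘ₗ
      (zeroEquiv V).toLinearEquiv.toLinearMap
  | n + 1 => (succEquiv W n).symm.toLinearEquiv.toLinearMap ∘ₗ
      TensorProduct.map L (tensorMap L n) ∘ₗ (succEquiv V n).toLinearEquiv.toLinearMap

theorem contract_slot (ℓ : V →ₗ[ℂ] ℂ) (n : ℕ) (v : V) (x : TP V n) :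
    contract ℓ n (slot n v x) = ℓ v • x := by
  simp [contract, slot]

theorem insertion_slot (f : V) (n : ℕ) (v : V) (x : TP V n) :
    insertion f (n + 1) (slot n v x) =
      slot (n + 1) f (slot n v x) + slot (n + 1) v (insertion f n x) := by
  simp [insertion, slot]

theorem tensorMap_vac {W : Type*} [NormedAddCommGroup W] [InnerProductSpace ℂ W]
    (L : V →ₗ[ℂ] W) : tensorMap L 0 (vac V) = vac W := by
  simp [tensorMap, vac]

theorem tensorMap_slot {W : Type*} [NormedAddCommGroup W] [InnerProductSpace ℂ W]
    (L : V →ₗ[ℂ] W) (n : ℕ) (v : V) (x : TP V n) :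
    tensorMap L (n + 1) (slot n v x) = slot n (L v) (tensorMap L n x) := by
  simp [tensorMap, slot]

theorem sum_tprod_succ (n : ℕ) (f : Fin (n + 1) → V) :
    (∑ σ : Equiv.Perm (Fin (n + 1)), tprod (n + 1) (f ∘ σ)) =
      ∑ p : Fin (n + 1), slot n (f p) (∑ σ : Equiv.Perm (Fin n),
        tprod n (Fin.tail (f ∘ Equiv.swap 0 p) ∘ σ)) := by
  rw [← Equiv.sum_comp Equiv.Perm.decomposeFin.symm, Fintype.sum_prod_type]
  refine Finset.sum_congr rfl fun p _ => ?_
  rw [map_sum]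
  refine Finset.sum_congr rfl fun σ _ => ?_
  have h1 : (f ∘ Equiv.Perm.decomposeFin.symm (p, σ)) 0 = f p := by simp
  have h2 : Fin.tail (f ∘ Equiv.Perm.decomposeFin.symm (p, σ)) =
      Fin.tail (f ∘ Equiv.swap 0 p) ∘ σ := by
    ext x
    simp [Fin.tail]
  rw [tprod, h1, h2]

theorem sum_tprod_perm (n : ℕ) (f : Fin n → V) (τ : Equiv.Perm (Fin n)) :
    (∑ σ : Equiv.Perm (Fin n), tprod n ((f ∘ τ) ∘ σ)) =
      ∑ σ : Equiv.Perm (Fin n), tprod n (f ∘ σ) :=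
  Equiv.sum_comp (Equiv.mulLeft τ) fun σ : Equiv.Perm (Fin n) => tprod n (f ∘ σ)

theorem contract_symProd (ℓ : V →ₗ[ℂ] ℂ) (n : ℕ) (f : Fin (n + 1) → V) :
    contract ℓ n (symProd (n + 1) f) = ((n + 1 : ℂ))⁻¹ •
      ∑ p : Fin (n + 1), ℓ (f p) • symProd n (Fin.tail (f ∘ Equiv.swap 0 p)) := by
  simp only [symProd]
  rw [map_smul, sum_tprod_succ, map_sum, Finset.smul_sum, Finset.smul_sum]
  refine Finset.sum_congr rfl fun p _ => ?_
  rw [contract_slot, smul_smul, smul_smul, smul_smul]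
  congr 1
  rw [Nat.factorial_succ]
  push_cast
  rw [mul_inv]
  ring

theorem insertion_sum_tprod (v : V) (n : ℕ) (f : Fin n → V) :
    insertion v n (∑ σ : Equiv.Perm (Fin n), tprod n (f ∘ σ)) =
      ∑ σ : Equiv.Perm (Fin (n + 1)),
        tprod (n + 1) ((Fin.cons v f : Fin (n + 1) → V) ∘ σ) := by
  induction n with
  | zero => 
    rw [sum_tprod_succ]
    simp [insertion, tprod]
  | succ n ih =>
    rw [sum_tprod_succ (n + 1), Fin.sum_univ_succ (n := n + 1)]
    conv_lhs => rw [sum_tprod_succ n f, map_sum]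
    simp only [insertion_slot]
    rw [Finset.sum_add_distrib, ← map_sum, ← sum_tprod_succ n f]
    refine congrArg₂ (· + ·) ?_ (Finset.sum_congr rfl fun p _ => ?_)
    · simp
    · rw [ih, Fin.cons_succ, ← sum_tprod_perm _ _ (Equiv.swap 0 p)]
      refine congrArg _ (Finset.sum_congr rfl fun σ _ => ?_)
      refine congrArg (fun w : Fin (n + 1) → V => tprod (n + 1) (w ∘ σ)) ?_
      ext x
      simp only [Function.comp, Fin.tail]
      have key : ∀ z : Fin (n + 1), (Fin.cons v f : Fin (n + 2) → V)
          (Equiv.swap 0 p.succ z.succ) = if z = p then v else f z := by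
        intro z
        by_cases hz : z = p
        · simp [hz]
        · rw [if_neg hz, Equiv.swap_apply_of_ne_of_ne (Fin.succ_ne_zero z)
            (fun h => hz (Fin.succ_injective _ h)), Fin.cons_succ]
      rw [key]
      by_cases hx : x = p
      · subst hx
        simp
      rw [if_neg hx]
      rcases Fin.eq_zero_or_eq_succ x with rfl | ⟨y, rfl⟩
      · obtain ⟨y, rfl⟩ := Fin.exists_succ_eq.2 (Ne.symm hx)
        simp [Fin.tail]
      · rw [Equiv.swap_apply_of_ne_of_ne (Fin.succ_ne_zero y) hx, Fin.cons_succ]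
        simp only [Fin.tail, Function.comp]
        rw [Equiv.swap_apply_of_ne_of_ne (Fin.succ_ne_zero y) hx]

theorem insertion_symProd (v : V) (n : ℕ) (f : Fin n → V) :
    insertion v n (symProd n f) = (n + 1 : ℂ) • symProd (n + 1) (Fin.cons v f) := by
  simp only [symProd]
  rw [map_smul, insertion_sum_tprod, smul_smul]
  congr 1
  rw [Nat.factorial_succ]
  push_cast
  have h1 : ((n : ℂ) + 1) ≠ 0 := by exact_mod_cast n.succ_ne_zero
  have h2 : (n.factorial : ℂ) ≠ 0 := by exact_mod_cast n.factorial_ne_zero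
  field_simp

theorem tensorMap_tprod {W : Type*} [NormedAddCommGroup W] [InnerProductSpace ℂ W]
    (L : V →ₗ[ℂ] W) (n : ℕ) (f : Fin n → V) : tensorMap L n (tprod n f) = tprod n (L ∘ f) := by
  induction n with
  | zero => exact tensorMap_vac L
  | succ n ih =>
    rw [tprod, tprod, tensorMap_slot, ih]
    rfl

theorem tensorMap_symProd {W : Type*} [NormedAddCommGroup W] [InnerProductSpace ℂ W]
    (L : V →ₗ[ℂ] W) (n : ℕ) (f : Fin n → V) :
    tensorMap L n (symProd n f) = symProd n (L ∘ f) := by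
  simp only [symProd, map_smul, map_sum, tensorMap_tprod]
  rfl

variable (V) in
/-- The algebraic direct sum of all tensor powers of `V`; its inner product is the one inherited from
the Hilbert direct sum. -/
def FullFin : Type u := Π₀ n, TP V n

instance : AddCommGroup (FullFin V) := inferInstanceAs (AddCommGroup (Π₀ n, TP V n))
instance : Module ℂ (FullFin V) := inferInstanceAs (Module ℂ (Π₀ n, TP V n))

/-- The inclusion of the `n`-particle sector. -/
def sector (n : ℕ) : TP V n →ₗ[ℂ] FullFin V := DFinsupp.lsingle n

/-- The linear map with prescribed restrictions to the sectors. -/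
def ofSectors {M : Type*} [AddCommGroup M] [Module ℂ M] (L : ∀ n, TP V n →ₗ[ℂ] M) :
    FullFin V →ₗ[ℂ] M := DFinsupp.lsum ℕ L

@[simp] theorem ofSectors_sector {M : Type*} [AddCommGroup M] [Module ℂ M]
    (L : ∀ n, TP V n →ₗ[ℂ] M) (n : ℕ) (x : TP V n) : ofSectors L (sector n x) = L n x := by
  exact DFinsupp.lsum_single ..

def toHilbertSum : FullFin V →ₗ[ℂ] lp (fun n => TP V n) 2 where
  toFun x := ⟨fun n => (show Π₀ n, TP V n from x) n, by
    classical
    refine (memℓp_zero ?_).of_exponent_ge (by simp)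
    exact (DFinsupp.finite_support x)⟩
  map_add' x y := by ext n; rfl
  map_smul' c x := by ext n; rfl

theorem toHilbertSum_injective : Function.Injective (toHilbertSum (V := V)) := by
  intro x y hxy
  refine DFinsupp.ext fun n => ?_
  exact congrArg (fun z : lp (fun n => TP V n) 2 => z n) hxy

end Tensor

section Induced
variable {E F : Type*} [AddCommGroup E] [Module ℂ E] [SeminormedAddCommGroup F]
  [InnerProductSpace ℂ F]

/-- The (semidefinite) inner product `⟨x, y⟩ = ⟨L x, L y⟩` pulled back along a linear map. -/
abbrev inducedInner (L : E →ₗ[ℂ] F) :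
    @InnerProductSpace ℂ E _ (SeminormedAddCommGroup.induced E F L) :=
  letI : SeminormedAddCommGroup E := SeminormedAddCommGroup.induced E F L
  { (inferInstance : Module ℂ E) with
    inner := fun x y => ⟪L x, L y⟫_ℂ
    norm_smul_le := fun c x => by
      change ‖L (c • x)‖ ≤ ‖c‖ * ‖L x‖
      rw [map_smul, norm_smul]
    norm_sq_eq_re_inner := fun x => norm_sq_eq_re_inner (𝕜 := ℂ) (L x)
    conj_inner_symm := fun x y => inner_conj_symm (L x) (L y)
    add_left := fun x y z => by
      change ⟪L (x + y), L z⟫_ℂ = _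
      rw [map_add, inner_add_left]
    smul_left := fun x y c => by
      change ⟪L (c • x), L y⟫_ℂ = _
      rw [map_smul, inner_smul_left] }

end Induced

section Fock
variable {V : Type u} [NormedAddCommGroup V] [InnerProductSpace ℂ V]

instance : NormedAddCommGroup (FullFin V) :=
  NormedAddCommGroup.induced (FullFin V) (lp (fun n => TP V n) 2) toHilbertSum
    toHilbertSum_injective

instance : InnerProductSpace ℂ (FullFin V) := inducedInner toHilbertSum

variable (V) in
/-- The span of the vacuum and of all symmetric products `f 0 ⊗_s ⋯ ⊗_s f (n - 1)`. -/
def symTensors : Submodule ℂ (FullFin V) :=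
  Submodule.span ℂ {x | ∃ (n : ℕ) (f : Fin n → V), x = sector n (symProd n f)}

theorem sector_mem (n : ℕ) (f : Fin n → V) : sector n (symProd n f) ∈ symTensors V :=
  Submodule.subset_span ⟨n, f, rfl⟩

theorem mem_of_generators {W : Type*} [NormedAddCommGroup W] [InnerProductSpace ℂ W]
    (L : FullFin V →ₗ[ℂ] FullFin W)
    (h : ∀ n (f : Fin n → V), L (sector n (symProd n f)) ∈ symTensors W) :
    ∀ x ∈ symTensors V, L x ∈ symTensors W := by
  intro x hx
  have : symTensors V ≤ (symTensors W).comap L := by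
    refine Submodule.span_le.2 ?_
    rintro _ ⟨n, f, rfl⟩
    exact h n f
  exact this hx

variable (V) in
/-- The finite-particle vectors over `V`, i.e. finite sums of symmetric algebraic tensors. If `V` is
dense in the Hilbert space `h`, the completion of this space is the symmetric Fock space of `h`. -/
def FockFin : Type u := symTensors V

instance : NormedAddCommGroup (FockFin V) := inferInstanceAs (NormedAddCommGroup (symTensors V))
instance : InnerProductSpace ℂ (FockFin V) := inferInstanceAs (InnerProductSpace ℂ (symTensors V))

/-- On the `(n + 1)`-particle sector: `√(n + 1)` times the contraction of the first factor. -/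
def annihilateFull (ℓ : V →ₗ[ℂ] ℂ) : FullFin V →ₗ[ℂ] FullFin V :=
  ofSectors fun
    | 0 => 0
    | n + 1 => (Real.sqrt (n + 1) : ℂ) • (sector n ∘ₗ contract ℓ n)

/-- On the `n`-particle sector of symmetric tensors: `√(n + 1)` times the symmetric product with
`f`. -/
def createFull (f : V) : FullFin V →ₗ[ℂ] FullFin V :=
  ofSectors fun n => (Real.sqrt (n + 1) : ℂ)⁻¹ • (sector (n + 1) ∘ₗ insertion f n)

/-- The second quantization `⊕ L ⊗ ⋯ ⊗ L`. -/
def mapFull {W : Type*} [NormedAddCommGroup W] [InnerProductSpace ℂ W] (L : V →ₗ[ℂ] W) :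
    FullFin V →ₗ[ℂ] FullFin W :=
  ofSectors fun n => sector n ∘ₗ tensorMap L n

/-- The annihilation operator with linear one-particle functional `ℓ = ⟨g, ·⟩`. -/
def annihilate (ℓ : V →ₗ[ℂ] ℂ) : FockFin V →ₗ[ℂ] FockFin V :=
  (annihilateFull ℓ).restrict <| mem_of_generators _ fun n f => by
    cases n with
    | zero => simp [annihilateFull]
    | succ n =>
      simp only [annihilateFull, ofSectors_sector, LinearMap.smul_apply, LinearMap.comp_apply,
        contract_symProd, map_smul, map_sum]
      exact Submodule.smul_mem _ _ <| Submodule.smul_mem _ _ <| Submodule.sum_mem _ fun p _ =>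
        Submodule.smul_mem _ _ <| sector_mem _ _

/-- The creation operator `a†(f)`. -/
def create (f : V) : FockFin V →ₗ[ℂ] FockFin V :=
  (createFull f).restrict <| mem_of_generators _ fun n x => by
    simp only [createFull, ofSectors_sector, LinearMap.smul_apply, LinearMap.comp_apply,
      insertion_symProd, map_smul]
    exact Submodule.smul_mem _ _ <| Submodule.smul_mem _ _ <| sector_mem _ _

/-- The second quantization of `L` on finite-particle vectors. -/
def fockMap {W : Type*} [NormedAddCommGroup W] [InnerProductSpace ℂ W] (L : V →ₗ[ℂ] W) :
    FockFin V →ₗ[ℂ] FockFin W :=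
  (mapFull L).restrict <| mem_of_generators _ fun n x => by
    simp only [mapFull, ofSectors_sector, LinearMap.comp_apply, tensorMap_symProd]
    exact sector_mem _ _

theorem annihilate_locallyNilpotent (ℓ : V →ₗ[ℂ] ℂ) (x : FockFin V) :
    ∃ K, (annihilate ℓ ^ K) x = 0 := by
  have key : ∀ x : FullFin V, ∃ K, (annihilateFull ℓ ^ K) x = 0 := by
    have hs : ∀ (n : ℕ) (y : TP V n), (annihilateFull ℓ ^ (n + 1)) (sector n y) = 0 := by
      intro n
      induction n with
      | zero => intro y; simp [annihilateFull]
      | succ n ih =>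
        intro y
        rw [pow_succ, Module.End.mul_apply]
        have : annihilateFull ℓ (sector (n + 1) y) =
            (Real.sqrt (n + 1) : ℂ) • sector n (contract ℓ n y) := by
          simp only [annihilateFull, ofSectors_sector]
          rfl
        rw [this, map_smul, ih, smul_zero]
    intro x
    refine DFinsupp.induction (p := fun x : Π₀ n, TP V n =>
      ∃ K, (annihilateFull ℓ ^ K) (show FullFin V from x) = 0) x ⟨0, rfl⟩ ?_
    rintro n y z - - ⟨K, hK⟩
    refine ⟨K + (n + 1), ?_⟩
    change (annihilateFull ℓ ^ (K + (n + 1))) (sector n y + (show FullFin V from z)) = 0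
    rw [map_add]
    conv_lhs => 
      congr
      · rw [pow_add, Module.End.mul_apply, hs, map_zero]
      · rw [add_comm, pow_add, Module.End.mul_apply, hK, map_zero]
    simp
  obtain ⟨K, hK⟩ := key (show symTensors V from x).1
  refine ⟨K, Subtype.ext ?_⟩
  have h : ∀ (k : ℕ) (y : FockFin V), (show symTensors V from (annihilate ℓ ^ k) y).1 =
      (annihilateFull ℓ ^ k) (show symTensors V from y).1 := by
    intro k
    induction k with
    | zero => intro y; rfl
    | succ k ih => intro y; rw [pow_succ, pow_succ, Module.End.mul_apply, Module.End.mul_apply, ih]; rfl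
  rw [h, hK]; rfl

end Fock

section Exponential

variable {M : Type*} [AddCommGroup M] [Module ℂ M]

/-- The exponential series of a locally nilpotent operator; on each vector the series is finite. -/
def expNilpotent (N : M →ₗ[ℂ] M) (hN : ∀ x, ∃ K, (N ^ K) x = 0) : M →ₗ[ℂ] M :=
  have hfin : ∀ x, (Function.support fun k : ℕ => ((k.factorial : ℂ))⁻¹ • (N ^ k) x).Finite := by
    intro x
    obtain ⟨K, hK⟩ := hN x
    refine (Set.finite_lt_nat K).subset fun k hk => ?_
    by_contra hlt
    obtain ⟨j, rfl⟩ := Nat.exists_eq_add_of_le' (not_lt.1 hlt)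
    exact hk (by simp [pow_add, hK])
  { toFun := fun x => ∑ᶠ k : ℕ, ((k.factorial : ℂ))⁻¹ • (N ^ k) x
    map_add' := fun x y => by
      simp only [map_add, smul_add]
      exact finsum_add_distrib (hfin x) (hfin y)
    map_smul' := fun c x => by
      simp only [map_smul, RingHom.id_apply]
      rw [smul_finsum' c (hfin x)]
      exact finsum_congr fun k => smul_comm _ _ _ }

theorem smul_locallyNilpotent {N : M →ₗ[ℂ] M} (hN : ∀ x, ∃ K, (N ^ K) x = 0) (c : ℂ) (x : M) :
    ∃ K, ((c • N) ^ K) x = 0 := by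
  obtain ⟨K, hK⟩ := hN x
  exact ⟨K, by rw [smul_pow, LinearMap.smul_apply, hK, smul_zero]⟩

theorem map_locallyNilpotent {S : Type*} [AddCommGroup S] [Module ℂ S] {N : M →ₗ[ℂ] M}
    (hN : ∀ x, ∃ K, (N ^ K) x = 0) (C : S →ₗ[ℂ] S) (x : S ⊗[ℂ] M) :
    ∃ K, ((TensorProduct.map C N) ^ K) x = 0 := by
  induction x using TensorProduct.induction_on with
  | zero => exact ⟨0, rfl⟩
  | tmul s m =>
    obtain ⟨K, hK⟩ := hN m
    exact ⟨K, by rw [TensorProduct.map_pow, TensorProduct.map_tmul, hK, TensorProduct.tmul_zero]⟩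
  | add x y hx hy =>
    obtain ⟨K, hK⟩ := hx
    obtain ⟨J, hJ⟩ := hy
    refine ⟨J + K, ?_⟩
    rw [map_add]
    nth_rewrite 2 [add_comm J K]
    rw [pow_add, pow_add, Module.End.mul_apply, Module.End.mul_apply, hK, hJ]
    simp

end Exponential

section Spectral

variable (S : Type*) [NormedAddCommGroup S] [InnerProductSpace ℂ S] [CompleteSpace S]

/-- Projection-valued measures on the Borel sets of `ℂ`. -/
structure PVM where
  proj : Set ℂ → S →L[ℂ] S
  isStarProjection : ∀ M, MeasurableSet M → IsStarProjection (proj M)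
  not_measurable : ∀ M, ¬ MeasurableSet M → proj M = 0
  proj_univ : proj Set.univ = 1
  hasSum : ∀ M : ℕ → Set ℂ, (∀ i, MeasurableSet (M i)) → Pairwise (Function.onFun Disjoint M) →
    ∀ x, HasSum (fun i => proj (M i) x) (proj (⋃ i, M i) x)

variable {S}

theorem PVM.proj_empty (E : PVM S) : E.proj ∅ = 0 := by
  ext x
  have h := (E.hasSum (fun _ => ∅) (fun _ => MeasurableSet.empty)
    (fun _ _ _ => by simp [Function.onFun]) x).summable
  simpa using (summable_const_iff _).1 h

theorem inner_proj_self {P : S →L[ℂ] S} (hP : IsStarProjection P) (x : S) :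
    ⟪x, P x⟫_ℂ = ((‖P x‖ ^ 2 : ℝ) : ℂ) := by
  have h1 : P (P x) = P x := congrArg (fun Q : S →L[ℂ] S => Q x) hP.isIdempotentElem
  have h2 : ContinuousLinearMap.adjoint P = P := hP.isSelfAdjoint
  conv_lhs => rw [← h1, ← ContinuousLinearMap.adjoint_inner_left, h2]
  rw [inner_self_eq_norm_sq_to_K]
  norm_cast

/-- The positive measure `M ↦ ⟨ψ, E(M) ψ⟩`. -/
def PVM.diag (E : PVM S) (ψ : S) : Measure ℂ :=
  Measure.ofMeasurable (fun M _ => ENNReal.ofReal (⟪ψ, E.proj M ψ⟫_ℂ).re)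
    (by simp [E.proj_empty])
    (fun M hM hd => by
      have h := (E.hasSum M hM hd ψ).mapL (Complex.reCLM.comp ((innerSL ℂ ψ).restrictScalars ℝ))
      have h' : HasSum (fun i => (⟪ψ, E.proj (M i) ψ⟫_ℂ).re) (⟪ψ, E.proj (⋃ i, M i) ψ⟫_ℂ).re := h
      rw [← h'.tsum_eq]
      refine ENNReal.ofReal_tsum_of_nonneg (fun i => ?_) h'.summable
      rw [inner_proj_self (E.isStarProjection _ (hM i)), Complex.ofReal_re]
      positivity)

theorem PVM.diag_apply (E : PVM S) (ψ : S) {M : Set ℂ} (hM : MeasurableSet M) :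
    E.diag ψ M = ENNReal.ofReal (⟪ψ, E.proj M ψ⟫_ℂ).re := Measure.ofMeasurable_apply M hM

/-- `E` is the spectral measure of `B`: `⟨x, B x⟩ = ∫ z ⟨x, dE(z) x⟩` for all `x`. -/
def PVM.IsSpectralMeasureOf (E : PVM S) (B : S →L[ℂ] S) : Prop :=
  ∀ ψ : S, Integrable (fun z : ℂ => z) (E.diag ψ) ∧ ∫ z, z ∂(E.diag ψ) = ⟪ψ, B ψ⟫_ℂ

section Existence

variable {B : S →L[ℂ] S} (hB : IsStarNormal B)

/-- real continuous functional calculus -/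
def rho (f : C(spectrum ℂ B, ℝ)) : S →L[ℂ] S :=
  cfcHom (R := ℂ) hB ⟨fun z => (f z : ℂ), by fun_prop⟩

theorem rho_add (f g : C(spectrum ℂ B, ℝ)) : rho hB (f + g) = rho hB f + rho hB g := by
  rw [rho, rho, rho, ← map_add]
  congr 1
  ext z
  simp

theorem rho_sub (f g : C(spectrum ℂ B, ℝ)) : rho hB (f - g) = rho hB f - rho hB g := by
  rw [rho, rho, rho, ← map_sub]
  congr 1
  ext z
  simp

theorem rho_mul (f g : C(spectrum ℂ B, ℝ)) : rho hB (f * g) = rho hB f * rho hB g := by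
  rw [rho, rho, rho, ← map_mul]
  congr 1
  ext z
  simp

theorem rho_smul (c : ℝ) (f : C(spectrum ℂ B, ℝ)) : rho hB (c • f) = (c : ℂ) • rho hB f := by
  rw [rho, rho, ← map_smul]
  congr 1
  ext z
  simp

theorem rho_one : rho hB 1 = 1 := by
  rw [rho, ← map_one (cfcHom (R := ℂ) hB)]
  congr 1

theorem rho_adjoint (f : C(spectrum ℂ B, ℝ)) : ContinuousLinearMap.adjoint (rho hB f) = rho hB f := by
  rw [rho, ← ContinuousLinearMap.star_eq_adjoint, ← map_star]
  congr 1
  ext z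
  simp

theorem inner_rho_comm (f : C(spectrum ℂ B, ℝ)) (x y : S) :
    ⟪rho hB f x, y⟫_ℂ = ⟪x, rho hB f y⟫_ℂ := by
  conv_lhs => rw [← rho_adjoint, ContinuousLinearMap.adjoint_inner_left]

theorem inner_rho_self (f : C(spectrum ℂ B, ℝ)) (x : S) :
    ⟪x, rho hB f x⟫_ℂ = (⟪x, rho hB f x⟫_ℂ).re := by
  rw [eq_comm, ← Complex.conj_eq_iff_re, inner_conj_symm, inner_rho_comm]

theorem inner_rho_sq (f : C(spectrum ℂ B, ℝ)) (x : S) :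
    (⟪x, rho hB (f * f) x⟫_ℂ).re = ‖rho hB f x‖ ^ 2 := by
  rw [rho_mul, mul_apply_eq_comp, ← inner_rho_comm, inner_self_eq_norm_sq_to_K]
  norm_cast

theorem exists_measure (x : S) : ∃ μ : Measure (spectrum ℂ B), μ.Regular ∧ IsFiniteMeasure μ ∧
    ∀ f : C(spectrum ℂ B, ℝ), ∫ z, f z ∂μ = (⟪x, rho hB f x⟫_ℂ).re := by
  let Λ : CompactlySupportedContinuousMap (spectrum ℂ B) ℝ →ₚ[ℝ] ℝ := PositiveLinearMap.mk₀
    { toFun := fun f => (⟪x, rho hB f.toContinuousMap x⟫_ℂ).re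
      map_add' := fun f g => by
        change (⟪x, rho hB (f.toContinuousMap + g.toContinuousMap) x⟫_ℂ).re = _
        simp [rho_add]
      map_smul' := fun c f => by
        change (⟪x, rho hB (c • f.toContinuousMap) x⟫_ℂ).re = _
        simp [rho_smul] }
    (fun f hf => by
      have hs : f.toContinuousMap =
          (⟨fun z => Real.sqrt (f z), by fun_prop⟩ : C(spectrum ℂ B, ℝ)) *
            ⟨fun z => Real.sqrt (f z), by fun_prop⟩ := by
        ext z
        exact (Real.mul_self_sqrt (hf z)).symm
      change 0 ≤ (⟪x, rho hB f.toContinuousMap x⟫_ℂ).re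
      rw [hs, inner_rho_sq]
      positivity)
  refine ⟨RealRMK.rieszMeasure Λ, inferInstance, inferInstance, fun f => ?_⟩
  exact RealRMK.integral_rieszMeasure Λ ⟨f, HasCompactSupport.of_compactSpace _⟩

def mu (x : S) : Measure (spectrum ℂ B) := (exists_measure hB x).choose

instance (x : S) : (mu hB x).Regular := (exists_measure hB x).choose_spec.1
instance (x : S) : IsFiniteMeasure (mu hB x) := (exists_measure hB x).choose_spec.2.1

theorem integral_mu (x : S) (f : C(spectrum ℂ B, ℝ)) :
    ∫ z, f z ∂(mu hB x) = (⟪x, rho hB f x⟫_ℂ).re := (exists_measure hB x).choose_spec.2.2 f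

theorem mu_univ (x : S) : (mu hB x).real Set.univ = ‖x‖ ^ 2 := by
  have := integral_mu hB x 1
  rw [rho_one] at this
  simpa [inner_self_eq_norm_sq_to_K, ← Complex.ofReal_pow] using this

theorem memLp_mu (x : S) (f : C(spectrum ℂ B, ℝ)) : MemLp f 2 (mu hB x) :=
  f.continuous.memLp_of_hasCompactSupport (HasCompactSupport.of_compactSpace _)

theorem eLpNorm_mu (x : S) (f : C(spectrum ℂ B, ℝ)) :
    eLpNorm f 2 (mu hB x) = ‖rho hB f x‖ₑ := by
  rw [(memLp_mu hB x f).eLpNorm_eq_integral_rpow_norm (by simp) (by simp)]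
  have h : ∫ z, ‖f z‖ ^ (2 : ENNReal).toReal ∂(mu hB x) = ‖rho hB f x‖ ^ 2 := by
    rw [← inner_rho_sq, ← integral_mu]
    refine integral_congr_ae (Filter.Eventually.of_forall fun z => ?_)
    simp [pow_two]
  rw [h, ← Real.rpow_natCast, ← Real.rpow_mul (norm_nonneg _)]
  simp

/-- indicator -/
def ind (M : Set (spectrum ℂ B)) : spectrum ℂ B → ℝ := M.indicator fun _ => 1

def Approx (M : Set (spectrum ℂ B)) (x : S) (f : ℕ → C(spectrum ℂ B, ℝ)) : Prop :=
  Filter.Tendsto (fun n => eLpNorm (⇑(f n) - ind M) 2 (mu hB x)) Filter.atTop (nhds 0)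

theorem memLp_ind {M : Set (spectrum ℂ B)} (hM : MeasurableSet M) (μ : Measure (spectrum ℂ B))
    [IsFiniteMeasure μ] : MemLp (ind M) 2 μ :=
  memLp_indicator_const 2 hM 1 (Or.inr (measure_ne_top _ _))

theorem exists_approx {M : Set (spectrum ℂ B)} (hM : MeasurableSet M) (x y z : S) :
    ∃ f, Approx hB M x f ∧ Approx hB M y f ∧ Approx hB M z f := by
  let ν := mu hB x + (mu hB y + mu hB z)
  have h : ∀ n : ℕ, ∃ g : C(spectrum ℂ B, ℝ), eLpNorm (⇑g - ind M) 2 ν ≤ ((n : ENNReal) + 1)⁻¹ := by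
    intro n
    obtain ⟨g, hg, -⟩ := (memLp_ind hM ν).exists_boundedContinuous_eLpNorm_sub_le (by simp)
      (ε := ((n : ENNReal) + 1)⁻¹) (by simp)
    exact ⟨g.toContinuousMap, by rw [eLpNorm_sub_comm]; exact hg⟩
  choose g hg using h
  have h0 : Filter.Tendsto (fun n => eLpNorm (⇑(g n) - ind M) 2 ν) Filter.atTop (nhds 0) := by
    refine tendsto_of_tendsto_of_tendsto_of_le_of_le tendsto_const_nhds ?_ (fun _ => zero_le) hg
    have := (Filter.tendsto_add_atTop_iff_nat 1).2 ENNReal.tendsto_inv_nat_nhds_zero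
    simpa using this
  have mono : ∀ w, mu hB w ≤ ν → Approx hB M w g := fun w hw =>
    tendsto_of_tendsto_of_tendsto_of_le_of_le tendsto_const_nhds h0 (fun _ => zero_le)
      fun n => eLpNorm_mono_measure _ hw
  refine ⟨g, mono x ?_, mono y ?_, mono z ?_⟩
  · exact Measure.le_add_right le_rfl
  · exact Measure.le_add_left (Measure.le_add_right le_rfl)
  · exact Measure.le_add_left (Measure.le_add_left le_rfl)

theorem approx_edist {M : Set (spectrum ℂ B)} (hM : MeasurableSet M) (x : S)
    (f g : C(spectrum ℂ B, ℝ)) :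
    edist (rho hB f x) (rho hB g x) ≤
      eLpNorm (⇑f - ind M) 2 (mu hB x) + eLpNorm (⇑g - ind M) 2 (mu hB x) := by
  rw [edist_eq_enorm_sub, ← sub_apply, ← rho_sub, ← eLpNorm_mu]
  have : (⇑(f - g) : spectrum ℂ B → ℝ) = (⇑f - ind M) - (⇑g - ind M) := by
    ext z; simp
  rw [this]
  have hi := memLp_ind hM (mu hB x)
  exact eLpNorm_sub_le ((memLp_mu hB x f).sub hi).1 ((memLp_mu hB x g).sub hi).1 (by norm_num)

theorem exists_limit {M : Set (spectrum ℂ B)} (hM : MeasurableSet M) (x : S) :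
    ∃ y, ∀ f, Approx hB M x f → Filter.Tendsto (fun n => rho hB (f n) x) Filter.atTop (nhds y) := by
  obtain ⟨g, hg, -, -⟩ := exists_approx hB hM x x x
  have hc : CauchySeq fun n => rho hB (g n) x := by
    rw [EMetric.cauchySeq_iff]
    intro ε hε
    obtain ⟨N, hN⟩ := Filter.eventually_atTop.1 (hg.eventually_lt_const (ENNReal.half_pos hε.ne'))
    refine ⟨N, fun m hm n hn => (approx_edist hB hM x _ _).trans_lt ?_⟩
    exact (ENNReal.add_lt_add (hN m hm) (hN n hn)).trans_eq (ENNReal.add_halves ε)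
  obtain ⟨y, hy⟩ := cauchySeq_tendsto_of_complete hc
  refine ⟨y, fun f hf => ?_⟩
  rw [tendsto_iff_edist_tendsto_0] at hy ⊢
  have h2 : Filter.Tendsto (fun n => (eLpNorm (⇑(f n) - ind M) 2 (mu hB x) +
      eLpNorm (⇑(g n) - ind M) 2 (mu hB x)) + edist (rho hB (g n) x) y) Filter.atTop (nhds 0) := by
    simpa using (hf.add hg).add hy
  refine tendsto_of_tendsto_of_tendsto_of_le_of_le tendsto_const_nhds h2 (fun _ => zero_le)
    fun n => ?_
  exact (edist_triangle _ (rho hB (g n) x) _).trans (add_le_add_left (approx_edist hB hM x _ _) _)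

def projFun {M : Set (spectrum ℂ B)} (hM : MeasurableSet M) (x : S) : S := (exists_limit hB hM x).choose

theorem tendsto_projFun {M : Set (spectrum ℂ B)} (hM : MeasurableSet M) {x : S}
    {f : ℕ → C(spectrum ℂ B, ℝ)} (hf : Approx hB M x f) :
    Filter.Tendsto (fun n => rho hB (f n) x) Filter.atTop (nhds (projFun hB hM x)) :=
  (exists_limit hB hM x).choose_spec f hf

theorem norm_projFun_sq {M : Set (spectrum ℂ B)} (hM : MeasurableSet M) (x : S) :
    ‖projFun hB hM x‖ ^ 2 = (mu hB x).real M := by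
  obtain ⟨f, hf, -, -⟩ := exists_approx hB hM x x x
  have h1 : Filter.Tendsto (fun n => ‖rho hB (f n) x‖ₑ) Filter.atTop
      (nhds ‖projFun hB hM x‖ₑ) := (tendsto_projFun hB hM hf).enorm
  have h2 : Filter.Tendsto (fun n => ‖rho hB (f n) x‖ₑ) Filter.atTop
      (nhds (eLpNorm (ind M) 2 (mu hB x))) := by
    simp only [← eLpNorm_mu]
    have h0 : Filter.Tendsto (fun n => (memLp_mu hB x (f n)).toLp (f n)) Filter.atTop
        (nhds ((memLp_ind hM (mu hB x)).toLp (ind M))) :=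
      (Lp.tendsto_Lp_iff_tendsto_eLpNorm'' _ _ _ _).2 hf
    have h1 := h0.enorm
    simpa only [Lp.enorm_toLp] using h1
  have h3 := tendsto_nhds_unique h1 h2
  rw [ind, eLpNorm_indicator_const hM (by simp) (by simp)] at h3
  have h4 := congrArg ENNReal.toReal h3
  rw [toReal_enorm] at h4
  rw [h4, measureReal_def]
  simp only [enorm_one, one_mul]
  rw [← ENNReal.toReal_pow, ← ENNReal.rpow_natCast, ← ENNReal.rpow_mul]
  norm_num

theorem inner_projFun {M : Set (spectrum ℂ B)} (hM : MeasurableSet M) (x : S) :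
    ⟪x, projFun hB hM x⟫_ℂ = ((mu hB x).real M : ℂ) := by
  obtain ⟨f, hf, -, -⟩ := exists_approx hB hM x x x
  have h1 : Filter.Tendsto (fun n => ⟪x, rho hB (f n) x⟫_ℂ) Filter.atTop
      (nhds ⟪x, projFun hB hM x⟫_ℂ) := tendsto_const_nhds.inner (tendsto_projFun hB hM hf)
  refine tendsto_nhds_unique h1 ?_
  have h2 : ∀ n, ⟪x, rho hB (f n) x⟫_ℂ = ((∫ z, f n z ∂(mu hB x) : ℝ) : ℂ) := fun n => by
    rw [inner_rho_self, integral_mu]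
  simp only [h2]
  refine (Complex.continuous_ofReal.tendsto _).comp ?_
  have h3 : (mu hB x).real M = ∫ z, ind M z ∂(mu hB x) := by
    exact (integral_indicator_one hM).symm
  rw [h3]
  refine tendsto_integral_of_L1' _ (memLp_ind hM _).1
    (Filter.Eventually.of_forall fun n => (memLp_mu hB x (f n)).integrable (by norm_num)) ?_
  have h4 := ENNReal.Tendsto.mul_const (b := (mu hB x) Set.univ ^ (1 / (1 : ENNReal).toReal - 1 / (2 : ENNReal).toReal)) hf (Or.inr (ENNReal.rpow_ne_top_of_nonneg (by norm_num) (measure_ne_top _ _)))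
  rw [zero_mul] at h4
  exact tendsto_of_tendsto_of_tendsto_of_le_of_le tendsto_const_nhds h4 (fun _ => zero_le)
    fun n => eLpNorm_le_eLpNorm_mul_rpow_measure_univ (by norm_num)
      ((memLp_mu hB x (f n)).sub (memLp_ind hM _)).1

theorem projFun_symm {M : Set (spectrum ℂ B)} (hM : MeasurableSet M) (x y : S) :
    ⟪projFun hB hM x, y⟫_ℂ = ⟪x, projFun hB hM y⟫_ℂ := by
  obtain ⟨f, hf, hf', -⟩ := exists_approx hB hM x y y
  have h1 := (tendsto_projFun hB hM hf).inner (tendsto_const_nhds (x := y)) (𝕜 := ℂ)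
  have h2 := (tendsto_const_nhds (x := x)).inner (tendsto_projFun hB hM hf') (𝕜 := ℂ)
  simp only [inner_rho_comm] at h1
  exact tendsto_nhds_unique h1 h2

def projOp {M : Set (spectrum ℂ B)} (hM : MeasurableSet M) : S →L[ℂ] S :=
  LinearMap.mkContinuous
    { toFun := projFun hB hM
      map_add' := fun x y => by
        obtain ⟨f, h1, h2, h3⟩ := exists_approx hB hM x y (x + y)
        refine tendsto_nhds_unique (tendsto_projFun hB hM h3) ?_
        simp only [map_add]
        exact (tendsto_projFun hB hM h1).add (tendsto_projFun hB hM h2)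
      map_smul' := fun c x => by
        obtain ⟨f, h1, h2, -⟩ := exists_approx hB hM x (c • x) x
        refine tendsto_nhds_unique (tendsto_projFun hB hM h2) ?_
        simp only [map_smul]
        exact (tendsto_projFun hB hM h1).const_smul c }
    1 (fun x => by
      change ‖projFun hB hM x‖ ≤ 1 * ‖x‖
      rw [one_mul]
      refine le_of_sq_le_sq ?_ (norm_nonneg _)
      rw [norm_projFun_sq, ← mu_univ hB]
      exact measureReal_mono (Set.subset_univ _))

theorem inner_projOp {M : Set (spectrum ℂ B)} (hM : MeasurableSet M) (x : S) :
    ⟪x, projOp hB hM x⟫_ℂ = ((mu hB x).real M : ℂ) := inner_projFun hB hM x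

theorem ext_inner {P Q : S →L[ℂ] S} (h : ∀ x, ⟪x, P x⟫_ℂ = ⟪x, Q x⟫_ℂ) : P = Q := by
  have : (P : S →ₗ[ℂ] S) = Q := by
    rw [← ext_inner_map]
    intro x
    rw [← inner_conj_symm, ← inner_conj_symm ((Q : S →ₗ[ℂ] S) x)]
    exact congrArg _ (h x)
  exact ContinuousLinearMap.coe_injective this

theorem projOp_isStarProjection {M : Set (spectrum ℂ B)} (hM : MeasurableSet M) :
    IsStarProjection (projOp hB hM) := by
  refine ⟨ext_inner fun x => ?_, ?_⟩
  · change ⟪x, projFun hB hM (projFun hB hM x)⟫_ℂ = ⟪x, projFun hB hM x⟫_ℂ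
    rw [← projFun_symm, inner_projFun, inner_self_eq_norm_sq_to_K, ← norm_projFun_sq hB hM]
    norm_cast
  · exact ContinuousLinearMap.isSelfAdjoint_iff'.2
      ((ContinuousLinearMap.eq_adjoint_iff _ _).2 fun x y => projFun_symm hB hM x y).symm

/-- The spectral projection attached to a Borel set of the plane. -/
def spectralProj (M : Set ℂ) : S →L[ℂ] S :=
  open scoped Classical in
  if hM : MeasurableSet M then projOp hB (M := Subtype.val ⁻¹' M) (measurable_subtype_coe hM) else 0

theorem inner_spectralProj {M : Set ℂ} (hM : MeasurableSet M) (x : S) :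
    ⟪x, spectralProj hB M x⟫_ℂ = ((mu hB x).real (Subtype.val ⁻¹' M) : ℂ) := by
  rw [spectralProj, dif_pos hM, inner_projOp]

theorem spectralProj_isStarProjection {M : Set ℂ} (hM : MeasurableSet M) :
    IsStarProjection (spectralProj hB M) := by
  rw [spectralProj, dif_pos hM]
  exact projOp_isStarProjection hB _

theorem norm_spectralProj_sq {M : Set ℂ} (hM : MeasurableSet M) (x : S) :
    ‖spectralProj hB M x‖ ^ 2 = (mu hB x).real (Subtype.val ⁻¹' M) := by
  have := inner_spectralProj hB hM x
  rw [inner_proj_self (spectralProj_isStarProjection hB hM)] at this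
  exact_mod_cast this

theorem spectralProj_diff_sum {M : ℕ → Set ℂ} (hM : ∀ i, MeasurableSet (M i))
    (hd : Pairwise (Function.onFun Disjoint M)) (s : Finset ℕ) :
    spectralProj hB (⋃ i, M i) - ∑ i ∈ s, spectralProj hB (M i) =
      spectralProj hB ((⋃ i, M i) \ ⋃ i ∈ s, M i) := by
  refine ext_inner fun x => ?_
  have hU := MeasurableSet.iUnion hM
  have hs : MeasurableSet (⋃ i ∈ s, M i) := s.measurableSet_biUnion fun i _ => hM i
  rw [sub_apply, inner_sub_right, sum_apply, inner_sum,
    inner_spectralProj hB hU, inner_spectralProj hB (hU.diff hs)]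
  simp only [inner_spectralProj hB (hM _)]
  rw [Set.preimage_sdiff, measureReal_sdiff _ (measurable_subtype_coe hs)]
  · rw [Set.preimage_iUnion₂, measureReal_biUnion_finset]
    · push_cast; rfl
    · intro i _ j _ hij
      exact Disjoint.preimage _ (hd hij)
    · exact fun i _ => measurable_subtype_coe (hM i)
  · exact Set.preimage_mono (Set.iUnion₂_subset fun i _ => Set.subset_iUnion M i)

theorem hasSum_spectralProj {M : ℕ → Set ℂ} (hM : ∀ i, MeasurableSet (M i))
    (hd : Pairwise (Function.onFun Disjoint M)) (x : S) :
    HasSum (fun i => spectralProj hB (M i) x) (spectralProj hB (⋃ i, M i) x) := by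
  have hm : HasSum (fun i => (mu hB x).real (Subtype.val ⁻¹' M i))
      ((mu hB x).real (Subtype.val ⁻¹' ⋃ i, M i)) := by
    rw [Set.preimage_iUnion]
    have h := measure_iUnion (μ := mu hB x)
      (f := fun i => (Subtype.val ⁻¹' M i : Set (spectrum ℂ B)))
      (fun i j hij => Disjoint.preimage _ (hd hij)) (fun i => measurable_subtype_coe (hM i))
    have h' := ENNReal.hasSum_toReal (f := fun i => mu hB x (Subtype.val ⁻¹' M i))
      (h ▸ measure_ne_top _ _)
    rw [← ENNReal.tsum_toReal_eq (fun i => measure_ne_top _ _), ← h] at h'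
    exact h'
  have hU := MeasurableSet.iUnion hM
  rw [HasSum, tendsto_iff_norm_sub_tendsto_zero]
  have h0 := (tendsto_const_nhds (x := (mu hB x).real (Subtype.val ⁻¹' ⋃ i, M i))).sub hm
  rw [sub_self] at h0
  have h1 := (Real.continuous_sqrt.tendsto 0).comp h0
  rw [Real.sqrt_zero] at h1
  refine h1.congr fun s => ?_
  have hs : MeasurableSet (⋃ i ∈ s, M i) := s.measurableSet_biUnion fun i _ => hM i
  have h2 : ‖∑ i ∈ s, spectralProj hB (M i) x - spectralProj hB (⋃ i, M i) x‖ =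
      ‖spectralProj hB ((⋃ i, M i) \ ⋃ i ∈ s, M i) x‖ := by
    rw [← spectralProj_diff_sum hB hM hd, norm_sub_rev, sub_apply, sum_apply]
  rw [h2, ← Real.sqrt_sq (norm_nonneg (spectralProj hB _ x)), norm_spectralProj_sq hB (hU.diff hs)]
  refine congrArg Real.sqrt ?_
  have h3 := congrArg (fun P : S →L[ℂ] S => (⟪x, P x⟫_ℂ).re) (spectralProj_diff_sum hB hM hd s)
  simp only [sub_apply, inner_sub_right, sum_apply, inner_sum,
    inner_spectralProj hB hU, inner_spectralProj hB (hU.diff hs), inner_spectralProj hB (hM _)] at h3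
  simpa using h3

/-- The spectral measure. -/
def spectralPVM : PVM S where
  proj := spectralProj hB
  isStarProjection _ := spectralProj_isStarProjection hB
  not_measurable M hM := by rw [spectralProj, dif_neg hM]
  proj_univ := ext_inner fun x => by
    rw [inner_spectralProj hB MeasurableSet.univ, Set.preimage_univ, mu_univ,
      one_apply_eq_self, inner_self_eq_norm_sq_to_K]
    norm_cast
  hasSum _ := hasSum_spectralProj hB

theorem spectralPVM_diag (x : S) : (spectralPVM hB).diag x = (mu hB x).map Subtype.val := by
  ext M hM
  rw [PVM.diag_apply _ _ hM, Measure.map_apply measurable_subtype_coe hM]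
  change ENNReal.ofReal (⟪x, spectralProj hB M x⟫_ℂ).re = _
  rw [inner_spectralProj hB hM, Complex.ofReal_re, ofReal_measureReal]

theorem spectralPVM_spec : (spectralPVM hB).IsSpectralMeasureOf B := by
  intro x
  rw [spectralPVM_diag]
  have hc : Continuous fun z : spectrum ℂ B => (z : ℂ) := continuous_subtype_val
  have hi : Integrable (fun z : spectrum ℂ B => (z : ℂ)) (mu hB x) :=
    hc.integrable_of_hasCompactSupport (HasCompactSupport.of_compactSpace _)
  refine ⟨?_, ?_⟩
  · exact (integrable_map_measure (by fun_prop) (by fun_prop)).2 hi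
  · rw [integral_map (by fun_prop) (by fun_prop)]
    let fr : C(spectrum ℂ B, ℝ) := ⟨fun z => (z : ℂ).re, by fun_prop⟩
    let fi : C(spectrum ℂ B, ℝ) := ⟨fun z => (z : ℂ).im, by fun_prop⟩
    have hBdec : B = rho hB fr + Complex.I • rho hB fi := by
      conv_lhs => rw [← cfcHom_id (R := ℂ) (a := B) hB]
      rw [rho, rho, ← map_smul, ← map_add]
      congr 1
      ext z
      simp [fr, fi, mul_comm Complex.I, Complex.re_add_im]
    have h1 : ∫ z : spectrum ℂ B, (z : ℂ) ∂(mu hB x) =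
        ((∫ z, fr z ∂(mu hB x) : ℝ) : ℂ) + Complex.I * ((∫ z, fi z ∂(mu hB x) : ℝ) : ℂ) := by
      rw [mul_comm]
      exact (integral_re_add_im hi).symm
    rw [h1, integral_mu, integral_mu, ← inner_rho_self, ← inner_rho_self]
    conv_rhs => rw [hBdec]
    rw [add_apply, smul_apply, inner_add_right, inner_smul_right]

end Existence

end Spectral
section DOI

variable {S : Type*} [NormedAddCommGroup S] [InnerProductSpace ℂ S] [CompleteSpace S]

/-- `A` is `(E, E)`-decomposable: for all `ψ, φ` there is a complex measure `μ` on `ℂ × ℂ` with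
`μ(M × N) = ⟨E(M) ψ, A E(N) φ⟩`, and the total variation norms are bounded uniformly for `ψ, φ` in
the unit ball. -/
def IsDecomposable (E : PVM S) (A : S →L[ℂ] S) : Prop :=
  ∃ μ : S → S → ComplexMeasure (ℂ × ℂ),
    (∀ ψ φ M N, MeasurableSet M → MeasurableSet N →
      μ ψ φ (M ×ˢ N) = ⟪E.proj M ψ, A (E.proj N φ)⟫_ℂ) ∧
    ∃ C : NNReal, ∀ ψ φ, ‖ψ‖ ≤ 1 → ‖φ‖ ≤ 1 → (μ ψ φ).variation Set.univ ≤ C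

/-- The complex measure `⟨dE(λ) ψ, A dE(μ) φ⟩` (a complex measure is determined by its values on
rectangles). -/
def doiMeasure {E : PVM S} {A : S →L[ℂ] S} (hA : IsDecomposable E A) (ψ φ : S) :
    ComplexMeasure (ℂ × ℂ) := hA.choose ψ φ

/-- The double operator integral `∬ f(λ, μ) ⟨dE(λ) ψ, A dE(μ) φ⟩`. -/
def doi {E : PVM S} {A : S →L[ℂ] S} (hA : IsDecomposable E A) (f : ℂ × ℂ → ℂ) (ψ φ : S) : ℂ :=
  (doiMeasure hA ψ φ).integral f (ContinuousLinearMap.mul ℝ ℂ)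

end DOI

section Gelfand

/-- The continuous anti-dual `T'`. -/
abbrev AntiDual (T : Type*) [AddCommGroup T] [Module ℂ T] [TopologicalSpace T] : Type _ :=
  T →L⋆[ℂ] ℂ

/-- A Gel'fand triple `T ⊆ h ⊆ T'`: a continuous injective linear map of the topological vector
space `T` into the Hilbert space `h` with dense image. -/
structure GelfandTriple (T h : Type*) [AddCommGroup T] [Module ℂ T] [TopologicalSpace T]
    [NormedAddCommGroup h] [InnerProductSpace ℂ h] where
  emb : T →L[ℂ] h
  injective : Function.Injective emb
  denseRange : DenseRange emb

variable {T h : Type*} [AddCommGroup T] [Module ℂ T] [TopologicalSpace T]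
  [NormedAddCommGroup h] [InnerProductSpace ℂ h]

namespace GelfandTriple

variable (G : GelfandTriple T h)

/-- `T`, viewed as a dense subspace of `h`. -/
abbrev test : Submodule ℂ h := LinearMap.range (G.emb : T →ₗ[ℂ] h)

def equivTest : T ≃ₗ[ℂ] G.test := LinearEquiv.ofInjective (G.emb : T →ₗ[ℂ] h) G.injective

/-- The embedding `h → T'`, `x ↦ (f ↦ ⟨f, x⟩)`. -/
def ofHilbert (x : h) : AntiDual T := (innerSLFlip ℂ x).comp G.emb

/-- The duality bracket `f ↦ ⟨g, f⟩ = conj (g f)` on test functions. -/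
def bracket (g : AntiDual T) : G.test →ₗ[ℂ] ℂ where
  toFun u := conj (g (G.equivTest.symm u))
  map_add' u w := by simp
  map_smul' c u := by simp

/-- `χ_g(l, m)`: equal to `exp((conj l * m - (|l|² + |m|²) / 2) ‖g‖²)` if `g ∈ h`, and to the
indicator function of the diagonal if `g ∈ T' \ h`. -/
def chi (g : AntiDual T) (l m : ℂ) : ℂ :=
  open scoped Classical in
  if hg : ∃ x : h, G.ofHilbert x = g then
    Complex.exp ((conj l * m - ((‖l‖ ^ 2 + ‖m‖ ^ 2 : ℝ) : ℂ) / 2) * ((‖hg.choose‖ ^ 2 : ℝ) : ℂ))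
  else if l = m then 1 else 0

/-- The annihilation operator `a(g)`, `g ∈ T'`, on `F_fin(T)`. -/
def annih (g : AntiDual T) : FockFin G.test →ₗ[ℂ] FockFin G.test := annihilate (G.bracket g)

/-- `exp(c a(g))` on `F_fin(T)`. -/
def expAnnih (c : ℂ) (g : AntiDual T) : FockFin G.test →ₗ[ℂ] FockFin G.test :=
  expNilpotent (c • G.annih g) (smul_locallyNilpotent (annihilate_locallyNilpotent _) c)

/-- The integrand
`(l, m) ↦ χ_g(l, m) ⟨exp(conj m a(g)) Ξ, exp(conj l a(g)) Θ⟩` of the double operator integral. -/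
def spinKernel (g : AntiDual T) (Ξ Θ : FockFin G.test) (z : ℂ × ℂ) : ℂ :=
  G.chi g z.1 z.2 * ⟪G.expAnnih (conj z.2) g Ξ, G.expAnnih (conj z.1) g Θ⟫_ℂ

end GelfandTriple

/-- A dispersion relation: a linear homeomorphism `ω` of `T` which is a positive (hence symmetric)
operator in `h` on the dense domain `T`. -/
structure Dispersion (G : GelfandTriple T h) where
  op : T ≃L[ℂ] T
  nonneg : ∀ f, 0 ≤ (⟪G.emb f, G.emb (op f)⟫_ℂ).re ∧ (⟪G.emb f, G.emb (op f)⟫_ℂ).im = 0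

/-- The field configuration `g = -v/ω ∈ T'`, i.e. `g(f) = -v(ω⁻¹ f)`. -/
def Dispersion.config {G : GelfandTriple T h} (ω : Dispersion G) (v : AntiDual T) : AntiDual T :=
  -(v.comp (ω.op.symm : T →L[ℂ] T))

end Gelfand

section SpinBoson

variable {S T h : Type*} [NormedAddCommGroup S] [InnerProductSpace ℂ S] [CompleteSpace S]
  [AddCommGroup T] [Module ℂ T] [TopologicalSpace T]
  [NormedAddCommGroup h] [InnerProductSpace ℂ h]
  (G : GelfandTriple T h) (B : S →L[ℂ] S) (g : AntiDual T)

/-- The singular dressing `exp(B* ⊗ a(g))` on the algebraic tensor product `S ⊗ F_fin(T)`. -/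
def dressing : S ⊗[ℂ] FockFin G.test →ₗ[ℂ] S ⊗[ℂ] FockFin G.test :=
  expNilpotent
    (TensorProduct.map (ContinuousLinearMap.adjoint B : S →ₗ[ℂ] S) (G.annih g))
    (map_locallyNilpotent (annihilate_locallyNilpotent _) _)

/-- `S ⊗ F_fin(T)` (algebraic tensor product) with the inner product
`⟨Ψ, Φ⟩_{B,g} = ⟨exp(B* ⊗ a(g)) Ψ, exp(B* ⊗ a(g)) Φ⟩`. -/
def PreRenorm (_G : GelfandTriple T h) (_B : S →L[ℂ] S) (_g : AntiDual T) : Type _ :=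
  S ⊗[ℂ] FockFin _G.test

instance : AddCommGroup (PreRenorm G B g) := inferInstanceAs (AddCommGroup (S ⊗[ℂ] FockFin G.test))
instance : Module ℂ (PreRenorm G B g) := inferInstanceAs (Module ℂ (S ⊗[ℂ] FockFin G.test))

def dressingPre : PreRenorm G B g →ₗ[ℂ] S ⊗[ℂ] FockFin G.test := dressing G B g

instance : SeminormedAddCommGroup (PreRenorm G B g) :=
  SeminormedAddCommGroup.induced (PreRenorm G B g) (S ⊗[ℂ] FockFin G.test) (dressingPre G B g)

instance : InnerProductSpace ℂ (PreRenorm G B g) :=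
  inducedInner (E := PreRenorm G B g) (F := S ⊗[ℂ] FockFin G.test) (dressingPre G B g)

/-- The renormalized spin-boson space `B_{B,g}`. -/
abbrev RenormSpace : Type _ := UniformSpace.Completion (PreRenorm G B g)

/-- The canonical map of `S ⊗ F_fin(T)` onto a dense subspace of `B_{B,g}`. -/
def toRenorm : S ⊗[ℂ] FockFin G.test →ₗ[ℂ] RenormSpace G B g :=
  (UniformSpace.Completion.toComplL (𝕜 := ℂ) (E := PreRenorm G B g)).toLinearMap ∘ₗ
    (LinearMap.id : S ⊗[ℂ] FockFin G.test →ₗ[ℂ] S ⊗[ℂ] FockFin G.test)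

variable (S h) in
/-- The Hilbert tensor product `B_0 = S ⊗ F(h)`. -/
abbrev SpinFock : Type _ := UniformSpace.Completion (S ⊗[ℂ] FockFin h)

variable (h) in
/-- The bounded operator `X ⊗ 1` on `S ⊗ F(h)`. -/
def ampliation (X : S →L[ℂ] S) : SpinFock S h →L[ℂ] SpinFock S h :=
  (ContinuousLinearMap.rTensor (FockFin h) X).completion

/-- `exp(-½ B* B ‖x‖²) exp(B ⊗ a†(x)) Ψ` in `S ⊗ F(h)`, for `x ∈ h` and `Ψ` in the algebraic tensor
product `S ⊗ F_fin(T)`; the exponential series is absolutely convergent. -/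
def regularDressing (x : h) (Ψ : S ⊗[ℂ] FockFin G.test) : SpinFock S h :=
  ampliation h (NormedSpace.exp ((-(‖x‖ ^ 2 / 2 : ℝ) : ℂ) • (ContinuousLinearMap.adjoint B * B)))
    (∑' k : ℕ, ((k.factorial : ℂ))⁻¹ •
      ((((TensorProduct.map (B : S →ₗ[ℂ] S) (create x)) ^ k)
        (LinearMap.lTensor S (fockMap G.test.subtype) Ψ) : S ⊗[ℂ] FockFin h) : SpinFock S h))

/-- The regularized renormalized free-spin form
`⟨e^{-½ B*B ‖x‖²} e^{B ⊗ a†(x)} Ψ, (A ⊗ 1) e^{-½ B*B ‖x‖²} e^{B ⊗ a†(x)} Φ⟩`, for `x ∈ h`. -/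
def regularSpinForm (A : S →L[ℂ] S) (x : h) (Ψ Φ : S ⊗[ℂ] FockFin G.test) : ℂ :=
  ⟪regularDressing G B x Ψ, ampliation h A (regularDressing G B x Φ)⟫_ℂ

end SpinBoson
end SpinBoson

end

noncomputable section

namespace SpinBoson

universe u

/-! ### Contraction, insertion and symmetrisation on tensor powers -/

section TensorPowers

variable {V : Type u} [NormedAddCommGroup V] [InnerProductSpace ℂ V]

/-! Everything rests on an exact formula for the regularized form on pure tensors when the field
configuration is a vector `x` of the Hilbert space. Put `t = ‖x‖²`, and write `c`, `a` for creation
and annihilation with `x`, and `N = exp(-½ t B*B)`. Expanding both exponentials gives a double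
series in `(k, l)` with terms `⟨N B^k ψ, A N B^l φ⟩ ⟨c^k Ξ, c^l Θ⟩ / (k! l!)`. The commutation
relation `a c = c a + t` and normal ordering turn the Fock factor into a sum over the number `j` of
contractions, with `k = p + j`, `l = q + j` and coefficient `t^j / (j! p! q!) ⟨a^q Ξ, a^p Θ⟩`
(`inner_create_pow`). Annihilation operators are nilpotent on finite-particle vectors, so only
finitely many pairs `(p, q)` survive and the series is resummed along diagonals
(`hasSum_inner_create_pow`, `regularSpinForm_tmul`).

The remaining sum over `j` lives on the spin side. By the functional calculus and decomposability
each term is a double operator integral, and the exponential series in `t conj λ μ` combines with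
the two Gaussians into the kernel `exp((conj λ μ - (|λ|² + |μ|²)/2) t)` (`hasSum_inner_gaussOp`).
Thus the regularized form is the integral (*) with `g` given by `x`. The kernel has modulus `exp(-t
|λ - μ|² / 2) ≤ 1`. When `g` lies in `h`, norm convergence makes `t` converge. When it does not,
weak convergence forces `t → ∞` (`tendsto_norm_atTop_of_not_mem`), and the kernel tends to the
indicator of the diagonal. Dominated convergence for the finite variation measure then gives the
limit (*) (`tendsto_regularSpinForm_tmul`).

The sharp bound uses the same formula with the identity in place of `A`. Normality of `B` lets the
sum over `j` produce `exp(t B*B)`, which cancels `N²`, so the norms of the regularized vectors tend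
to the norm of `exp(B* ⊗ a(g)) Ψ` (`tendsto_norm_regularDressing`). Cauchy-Schwarz with constant
`‖A‖`, as well as symmetry and sesquilinearity, pass to the limit. Some approximating net always
exists (`exists_approximates`), so the form can be constructed as such a limit, extended to the
completion by continuity, and is unique because pure tensors span a dense subspace. Riesz
representation supplies the operator. -/

theorem slot_induction {n : ℕ} {P : TP V (n + 1) → Prop} (zero : P 0)
    (slot : ∀ v x, P (slot n v x)) (add : ∀ x y, P x → P y → P (x + y)) (z : TP V (n + 1)) :
    P z :=
  TensorProduct.induction_on (R := ℂ) (M := V) (N := TP V n) (motive := P) z zero slot add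

theorem inner_slot (n : ℕ) (v w : V) (x y : TP V n) :
    ⟪slot n v x, slot n w y⟫_ℂ = ⟪v, w⟫_ℂ * ⟪x, y⟫_ℂ :=
  TensorProduct.inner_tmul ..

theorem inner_tprod (n : ℕ) (f g : Fin n → V) :
    ⟪tprod n f, tprod n g⟫_ℂ = ∏ i, ⟪f i, g i⟫_ℂ := by
  induction n with
  | zero => simp [tprod, vac]
  | succ n ih =>
    rw [tprod, tprod, inner_slot, ih, Fin.prod_univ_succ]
    rfl

/-- Reindexing the product over positions moves `τ` to the other side, where the sum over all
permutations absorbs it. -/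
theorem inner_tprod_comp_symProd (n : ℕ) (f g : Fin n → V) (τ : Equiv.Perm (Fin n)) :
    ⟪tprod n (f ∘ τ), symProd n g⟫_ℂ = ⟪tprod n f, symProd n g⟫_ℂ := by
  simp only [symProd, inner_smul_right, inner_sum, inner_tprod]
  congr 1
  rw [← Equiv.sum_comp (Equiv.mulRight τ)]
  refine Finset.sum_congr rfl fun σ _ => ?_
  exact Equiv.prod_comp τ fun i => ⟪f i, g (σ i)⟫_ℂ

/-- Symmetrisation is an orthogonal projection, so one symmetric side suffices: the `n!` terms on
the other side are equal and cancel the normalisation. -/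
theorem inner_symProd_symProd (n : ℕ) (f g : Fin n → V) :
    ⟪symProd n f, symProd n g⟫_ℂ = ⟪tprod n f, symProd n g⟫_ℂ := by
  conv_lhs => rw [symProd]
  rw [inner_smul_left, sum_inner]
  simp only [inner_tprod_comp_symProd]
  rw [Finset.sum_const, Finset.card_univ, Fintype.card_perm, Fintype.card_fin, nsmul_eq_mul,
    ← mul_assoc]
  simp [n.factorial_ne_zero]

theorem inner_slot_symProd (n : ℕ) (v : V) (f : Fin n → V) (g : Fin (n + 1) → V) :
    ⟪slot n v (symProd n f), symProd (n + 1) g⟫_ℂ =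
      ⟪tprod (n + 1) (Fin.cons v f), symProd (n + 1) g⟫_ℂ := by
  conv_lhs => rw [symProd]
  rw [map_smul, map_sum, inner_smul_left, sum_inner]
  -- `decomposeFin.symm (0, σ)` fixes position 0 and acts by `σ` on the others, so each summand is a
  -- rearrangement of one pure tensor.
  have h : ∀ σ : Equiv.Perm (Fin n), slot n v (tprod n (f ∘ σ)) =
      tprod (n + 1) ((Fin.cons v f : Fin (n + 1) → V) ∘ Equiv.Perm.decomposeFin.symm (0, σ)) := by
    intro σ
    rw [tprod]
    congr 2
  simp only [h, inner_tprod_comp_symProd]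
  rw [Finset.sum_const, Finset.card_univ, Fintype.card_perm, Fintype.card_fin, nsmul_eq_mul,
    ← mul_assoc]
  simp [n.factorial_ne_zero]

theorem inner_slot_right (n : ℕ) (v : V) (x : TP V n) (z : TP V (n + 1)) :
    ⟪slot n v x, z⟫_ℂ = ⟪x, contract (innerSL ℂ v : V →ₗ[ℂ] ℂ) n z⟫_ℂ := by
  induction z using slot_induction with
  | zero => simp
  | slot w y => rw [inner_slot, contract_slot, inner_smul_right]; rfl
  | add y z hy hz => rw [inner_add_right, hy, hz, map_add, inner_add_right]

theorem inner_insertion_symProd (n : ℕ) (v : V) (f : Fin n → V) (g : Fin (n + 1) → V) :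
    ⟪insertion v n (symProd n f), symProd (n + 1) g⟫_ℂ =
      (n + 1 : ℂ) * ⟪symProd n f, contract (innerSL ℂ v : V →ₗ[ℂ] ℂ) n (symProd (n + 1) g)⟫_ℂ := by
  rw [insertion_symProd, inner_smul_left, ← inner_slot_right, inner_slot_symProd,
    inner_symProd_symProd]
  simp

theorem contract_insertion_zero (ℓ : V →ₗ[ℂ] ℂ) (v : V) (x : TP V 0) :
    contract ℓ 0 (insertion v 0 x) = ℓ v • x := contract_slot ℓ 0 v x

/-- The inserted vector is either in front, where contraction turns it into the scalar `ℓ v`, or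
further back, where contraction meets the old first factor. This is the commutation relation before
normalisation. -/
theorem contract_insertion_succ (ℓ : V →ₗ[ℂ] ℂ) (v : V) (n : ℕ) (x : TP V (n + 1)) :
    contract ℓ (n + 1) (insertion v (n + 1) x) = ℓ v • x + insertion v n (contract ℓ n x) := by
  induction x using slot_induction with
  | zero => simp
  | slot w y =>
    rw [insertion_slot, map_add, contract_slot, contract_slot, contract_slot, map_smul]
  | add y z hy hz => 
    simp only [map_add, hy, hz, smul_add]
    abel

theorem inner_tensorMap {W : Type*} [NormedAddCommGroup W] [InnerProductSpace ℂ W]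
    {L : V →ₗ[ℂ] W} (hL : ∀ v w, ⟪L v, L w⟫_ℂ = ⟪v, w⟫_ℂ) (n : ℕ) (x y : TP V n) :
    ⟪tensorMap L n x, tensorMap L n y⟫_ℂ = ⟪x, y⟫_ℂ := by
  induction n with
  | zero =>
    have h : ∀ z : TP V 0, ∃ c : ℂ, z = c • vac V := fun z =>
      ⟨zeroEquiv V z PUnit.unit, by
        apply (zeroEquiv V).injective
        ext i
        simp [vac]⟩
    obtain ⟨c, rfl⟩ := h x
    obtain ⟨d, rfl⟩ := h y
    simp only [map_smul, tensorMap_vac, inner_smul_left, inner_smul_right]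
    simp [vac]
  | succ n ih =>
    induction x using slot_induction with
    | zero => simp
    | add x x' hx hx' => rw [map_add, inner_add_left, hx, hx', inner_add_left]
    | slot v x =>
      induction y using slot_induction with
      | zero => simp
      | add y y' hy hy' => rw [map_add, inner_add_right, hy, hy', inner_add_right]
      | slot w y => rw [tensorMap_slot, tensorMap_slot, inner_slot, inner_slot, hL, ih]

theorem contract_tensorMap {W : Type*} [NormedAddCommGroup W] [InnerProductSpace ℂ W]
    (L : V →ₗ[ℂ] W) (ℓ : W →ₗ[ℂ] ℂ) (n : ℕ) (x : TP V (n + 1)) :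
    contract ℓ n (tensorMap L (n + 1) x) = tensorMap L n (contract (ℓ ∘ₗ L) n x) := by
  induction x using slot_induction with
  | zero => simp
  | slot w y => rw [tensorMap_slot, contract_slot, contract_slot, map_smul]; rfl
  | add y z hy hz => simp only [map_add, hy, hz]

end TensorPowers

/-! ### Creation and annihilation: commutation relation and adjointness -/

section FockOperators

variable {V : Type u} [NormedAddCommGroup V] [InnerProductSpace ℂ V]

theorem toHilbertSum_sector (n : ℕ) (x : TP V n) :
    toHilbertSum (sector n x) = lp.single 2 n x := by
  ext m
  rw [lp.coeFn_single]
  change (DFinsupp.single n x : Π₀ n, TP V n) m = _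
  by_cases h : n = m
  · subst h; simp
  · rw [DFinsupp.single_eq_of_ne (Ne.symm h), Pi.single_eq_of_ne (Ne.symm h)]

theorem inner_sector_same (n : ℕ) (x y : TP V n) :
    ⟪sector n x, sector n y⟫_ℂ = ⟪x, y⟫_ℂ := by
  change ⟪toHilbertSum (sector n x), toHilbertSum (sector n y)⟫_ℂ = _
  rw [toHilbertSum_sector, toHilbertSum_sector, lp.inner_single_left, lp.coeFn_single,
    Pi.single_eq_same]

theorem inner_sector_ne {m n : ℕ} (h : m ≠ n) (x : TP V m) (y : TP V n) :
    ⟪sector m x, sector n y⟫_ℂ = 0 := by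
  change ⟪toHilbertSum (sector m x), toHilbertSum (sector n y)⟫_ℂ = _
  rw [toHilbertSum_sector, toHilbertSum_sector, lp.inner_single_left, lp.coeFn_single,
    Pi.single_eq_of_ne h, inner_zero_right]

theorem sector_induction {P : FullFin V → Prop} (zero : P 0) (sector : ∀ n x, P (sector n x))
    (add : ∀ x y, P x → P y → P (x + y)) (z : FullFin V) : P z :=
  DFinsupp.induction (p := fun x : Π₀ n, TP V n => P x) z zero
    fun n x _ _ _ hf => add _ _ (sector n x) hf

theorem fullFin_hom_ext {M : Type*} [AddCommGroup M] [Module ℂ M] {f g : FullFin V →ₗ[ℂ] M}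
    (h : ∀ n x, f (sector n x) = g (sector n x)) : f = g := by
  ext x
  induction x using sector_induction with
  | zero => simp
  | sector n x => exact h n x
  | add x y hx hy => rw [map_add, map_add, hx, hy]

theorem annihilateFull_zero (ℓ : V →ₗ[ℂ] ℂ) (x : TP V 0) :
    annihilateFull ℓ (sector 0 x) = 0 := by
  simp [annihilateFull]

theorem annihilateFull_succ (ℓ : V →ₗ[ℂ] ℂ) (n : ℕ) (x : TP V (n + 1)) :
    annihilateFull ℓ (sector (n + 1) x) = (Real.sqrt (n + 1) : ℂ) • sector n (contract ℓ n x) := by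
  simp [annihilateFull]

theorem createFull_sector (v : V) (n : ℕ) (x : TP V n) :
    createFull v (sector n x) = (Real.sqrt (n + 1) : ℂ)⁻¹ • sector (n + 1) (insertion v n x) := by
  simp [createFull]

theorem sqrt_succ_ne_zero (n : ℕ) : (Real.sqrt (n + 1) : ℂ) ≠ 0 := by
  have : 0 < Real.sqrt (n + 1) := Real.sqrt_pos.2 (by positivity)
  exact_mod_cast this.ne'

/-- The square-root normalisations cancel in both orders, leaving `contract_insertion_succ`. The
relation already holds on all tensors; symmetry enters only for adjointness. -/
theorem annihilateFull_comp_createFull (ℓ : V →ₗ[ℂ] ℂ) (v : V) :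
    annihilateFull ℓ * createFull v = createFull v * annihilateFull ℓ + ℓ v • 1 := by
  refine fullFin_hom_ext fun n x => ?_
  simp only [Module.End.mul_apply, LinearMap.add_apply, LinearMap.smul_apply, Module.End.one_apply]
  rw [createFull_sector, map_smul, annihilateFull_succ, smul_smul,
    inv_mul_cancel₀ (sqrt_succ_ne_zero n), one_smul]
  cases n with
  | zero =>
    rw [annihilateFull_zero, map_zero, zero_add (ℓ v • sector 0 x), ← map_smul]
    exact congrArg _ (contract_insertion_zero ℓ v x)
  | succ n =>
    rw [annihilateFull_succ, map_smul, createFull_sector, smul_smul,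
      mul_inv_cancel₀ (sqrt_succ_ne_zero n), one_smul, contract_insertion_succ, map_add, map_smul,
      add_comm]

/-- Different particle numbers are orthogonal. In the matching sector the insertion of `v` gives a
factor `m + 1`, and dividing by `√(m + 1)` leaves the normalisation of the annihilation operator. -/
theorem inner_createFull_symProd (v : V) (m n : ℕ) (f : Fin m → V) (g : Fin n → V) :
    ⟪createFull v (sector m (symProd m f)), sector n (symProd n g)⟫_ℂ =
      ⟪sector m (symProd m f),
        annihilateFull (innerSL ℂ v : V →ₗ[ℂ] ℂ) (sector n (symProd n g))⟫_ℂ := by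
  rw [createFull_sector, inner_smul_left]
  cases n with
  | zero => 
    rw [annihilateFull_zero, inner_sector_ne (Nat.succ_ne_zero m)]
    simp
  | succ n =>
    rw [annihilateFull_succ, inner_smul_right]
    by_cases h : m = n
    · subst h
      rw [inner_sector_same, inner_sector_same, inner_insertion_symProd, ← mul_assoc]
      congr 1
      rw [map_inv₀, Complex.conj_ofReal, inv_mul_eq_iff_eq_mul₀ (sqrt_succ_ne_zero m),
        ← Complex.ofReal_mul, Real.mul_self_sqrt (by positivity)]
      push_cast
      rfl
    · rw [inner_sector_ne h, inner_sector_ne (by simpa using h)]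
      simp

/-- The inclusion of the symmetric tensors into all tensors. -/
def toFull : FockFin V →ₗ[ℂ] FullFin V := (symTensors V).subtype

theorem toFull_injective : Function.Injective (toFull (V := V)) := Subtype.val_injective

/-- The symmetric product `f 0 ⊗_s ⋯ ⊗_s f (n - 1)` as a finite-particle vector. -/
def symVector (n : ℕ) (f : Fin n → V) : FockFin V :=
  (⟨sector n (symProd n f), sector_mem n f⟩ : symTensors V)

theorem toFull_annihilate (ℓ : V →ₗ[ℂ] ℂ) (x : FockFin V) :
    toFull (annihilate ℓ x) = annihilateFull ℓ (toFull x) := rfl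

theorem toFull_annihilate_pow (ℓ : V →ₗ[ℂ] ℂ) (k : ℕ) (x : FockFin V) :
    toFull ((annihilate ℓ ^ k) x) = (annihilateFull ℓ ^ k) (toFull x) := by
  induction k generalizing x with
  | zero => rfl
  | succ k ih => 
    rw [pow_succ, pow_succ, Module.End.mul_apply, Module.End.mul_apply, ih, toFull_annihilate]

theorem inner_toFull (x y : FockFin V) : ⟪toFull x, toFull y⟫_ℂ = ⟪x, y⟫_ℂ := rfl

theorem fock_induction {P : FockFin V → Prop}
    (zero : P 0) (sym : ∀ n f, P (symVector n f))
    (add : ∀ x y, P x → P y → P (x + y)) (smul : ∀ (c : ℂ) x, P x → P (c • x)) (z : FockFin V) :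
    P z := by
  obtain ⟨z, hz⟩ : symTensors V := z
  refine Submodule.span_induction
    (p := fun z hz => P (show symTensors V from ⟨z, hz⟩)) ?_ zero ?_ ?_ hz
  · rintro _ ⟨n, f, rfl⟩
    exact sym n f
  · intro x y hx hy h1 h2
    exact add _ _ h1 h2
  · intro c x hx h
    exact smul c _ h

theorem inner_create_left (v : V) (x y : FockFin V) :
    ⟪create v x, y⟫_ℂ = ⟪x, annihilate (innerSL ℂ v : V →ₗ[ℂ] ℂ) y⟫_ℂ := by
  induction x using fock_induction with
  | zero => simp
  | add x x' hx hx' => rw [map_add, inner_add_left, inner_add_left, hx, hx']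
  | smul c x hx => rw [map_smul, inner_smul_left, inner_smul_left, hx]
  | sym m f =>
    induction y using fock_induction with
    | zero => simp
    | add x x' hx hx' => rw [map_add, inner_add_right, inner_add_right, hx, hx']
    | smul c x hx => rw [map_smul, inner_smul_right, inner_smul_right, hx]
    | sym n g => exact inner_createFull_symProd v m n f g

theorem annihilate_mul_create (ℓ : V →ₗ[ℂ] ℂ) (v : V) :
    annihilate ℓ * create v = create v * annihilate ℓ + ℓ v • 1 := by
  ext x
  exact toFull_injective (LinearMap.congr_fun (annihilateFull_comp_createFull ℓ v) (toFull x))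

variable {W : Type*} [NormedAddCommGroup W] [InnerProductSpace ℂ W]

theorem inner_fockMap {L : V →ₗ[ℂ] W} (hL : ∀ v w, ⟪L v, L w⟫_ℂ = ⟪v, w⟫_ℂ)
    (x y : FockFin V) : ⟪fockMap L x, fockMap L y⟫_ℂ = ⟪x, y⟫_ℂ := by
  have h : ∀ x y : FullFin V, ⟪mapFull L x, mapFull L y⟫_ℂ = ⟪x, y⟫_ℂ := by
    intro x y
    induction x using sector_induction with
    | zero => simp
    | add x x' hx hx' => rw [map_add, inner_add_left, inner_add_left, hx, hx']
    | sector m x =>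
      induction y using sector_induction with
      | zero => simp
      | add x x' hx hx' => rw [map_add, inner_add_right, inner_add_right, hx, hx']
      | sector n y =>
        have e : ∀ n (x : TP V n), mapFull L (sector n x) = sector n (tensorMap L n x) := by
          simp [mapFull]
        rw [e, e]
        by_cases hmn : m = n
        · subst hmn
          rw [inner_sector_same, inner_sector_same, inner_tensorMap hL]
        · rw [inner_sector_ne hmn, inner_sector_ne hmn]
  exact h _ _

/-- Contracting with `ℓ` after applying `L` to each factor is contracting with `ℓ ∘ L` before. It
transports annihilation from the Fock space of `h` to that of the test functions. -/
theorem annihilate_fockMap (L : V →ₗ[ℂ] W) (ℓ : W →ₗ[ℂ] ℂ) (x : FockFin V) :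
    annihilate ℓ (fockMap L x) = fockMap L (annihilate (ℓ ∘ₗ L) x) := by
  have h : annihilateFull ℓ ∘ₗ mapFull L = mapFull L ∘ₗ annihilateFull (ℓ ∘ₗ L) := by
    refine fullFin_hom_ext fun n x => ?_
    have e : ∀ n (x : TP V n), mapFull L (sector n x) = sector n (tensorMap L n x) := by
      simp [mapFull]
    rw [LinearMap.comp_apply, LinearMap.comp_apply, e]
    cases n with
    | zero => rw [annihilateFull_zero, annihilateFull_zero, map_zero]
    | succ n => 
      rw [annihilateFull_succ, annihilateFull_succ, map_smul, e, contract_tensorMap]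
  exact toFull_injective (LinearMap.congr_fun h (toFull x))

theorem annihilate_pow_fockMap (L : V →ₗ[ℂ] W) (ℓ : W →ₗ[ℂ] ℂ) (k : ℕ) (x : FockFin V) :
    (annihilate ℓ ^ k) (fockMap L x) = fockMap L ((annihilate (ℓ ∘ₗ L) ^ k) x) := by
  induction k generalizing x with
  | zero => rfl
  | succ k ih => 
    rw [pow_succ, pow_succ, Module.End.mul_apply, Module.End.mul_apply, annihilate_fockMap, ih]

end FockOperators

/-! ### Normal ordering for a scalar commutator -/

section NormalOrdering

variable {R : Type*} [Ring R] [Algebra ℂ R] {a c : R} {t : ℂ}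

/-- The commutator with `a` is a derivation, so each of the `l + 1` factors `c` contributes `t`
times the product of the others. -/
theorem mul_pow_of_commutator (h : a * c = c * a + t • 1) (l : ℕ) :
    a * c ^ (l + 1) = c ^ (l + 1) * a + ((l + 1 : ℂ) * t) • c ^ l := by
  induction l with
  | zero => simp [h]
  | succ l ih =>
    rw [pow_succ c (l + 1), ← mul_assoc, ih, add_mul, mul_assoc, h, mul_add, smul_mul_assoc,
      ← pow_succ, mul_smul_comm, mul_one, add_assoc, ← add_smul, ← mul_assoc, ← pow_succ]
    congr 2
    push_cast
    ring

/-- The falling factorials make the formula valid for every `j` despite truncated subtraction: once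
`j ≥ l`, the correction term has coefficient zero. -/
theorem mul_pow_sub_of_commutator (h : a * c = c * a + t • 1) (l j : ℕ) :
    (l.descFactorial j : ℂ) • (a * c ^ (l - j)) = (l.descFactorial j : ℂ) • (c ^ (l - j) * a) +
      ((l.descFactorial (j + 1) : ℂ) * t) • c ^ (l - (j + 1)) := by
  rcases lt_or_ge j l with hj | hj
  · obtain ⟨m, rfl⟩ := Nat.exists_eq_add_of_lt hj
    have h1 : j + m + 1 - j = m + 1 := by omega
    have h2 : j + m + 1 - (j + 1) = m := by omega
    rw [Nat.descFactorial_succ, h1, h2, mul_pow_of_commutator h, smul_add, smul_smul]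
    congr 2
    push_cast
    ring
  · have h1 : l - j = 0 := by omega
    rw [Nat.descFactorial_of_lt (Nat.lt_succ_of_le hj), h1]
    simp

/-- Normal ordering of `a ^ k * c ^ l` for operators with `a * c - c * a = t`. -/
theorem pow_mul_pow_of_commutator (h : a * c = c * a + t • 1) (k l : ℕ) :
    a ^ k * c ^ l = ∑ j ∈ Finset.range (k + 1),
      ((k.choose j : ℂ) * (l.descFactorial j : ℂ) * t ^ j) • (c ^ (l - j) * a ^ (k - j)) := by
  induction k with
  | zero => simp
  | succ k ih =>
    -- Moving one more `a` through a summand with `j` contractions produces one with `j` and one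
    -- with `j + 1` contractions.
    have step : ∀ j ∈ Finset.range (k + 1),
        a * (((k.choose j : ℂ) * (l.descFactorial j : ℂ) * t ^ j) • (c ^ (l - j) * a ^ (k - j))) =
          ((k.choose j : ℂ) * (l.descFactorial j : ℂ) * t ^ j) •
            (c ^ (l - j) * a ^ (k + 1 - j)) +
          ((k.choose j : ℂ) * (l.descFactorial (j + 1) : ℂ) * t ^ (j + 1)) •
            (c ^ (l - (j + 1)) * a ^ (k + 1 - (j + 1))) := by
      intro j hj
      have hk : k + 1 - j = (k - j) + 1 := by have := Finset.mem_range.1 hj; omega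
      have e := congrArg (fun z => (((k.choose j : ℂ) * t ^ j) • z) * a ^ (k - j))
        (mul_pow_sub_of_commutator h l j)
      simp only [smul_add, add_mul, smul_mul_assoc, smul_smul] at e
      rw [hk, Nat.add_sub_add_right, pow_succ' a, ← mul_assoc, mul_smul_comm, ← mul_assoc]
      convert e using 2 <;> ring_nf
    rw [pow_succ', mul_assoc, ih, Finset.mul_sum, Finset.sum_congr rfl step,
      Finset.sum_add_distrib, Finset.sum_range_succ' _ (k + 1)]
    -- Pascal's rule splits the coefficients for `k + 1` into the same two families.
    simp only [Nat.choose_succ_succ, Nat.cast_add, add_mul, add_smul, Finset.sum_add_distrib]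
    rw [Finset.sum_range_succ' _ k, Finset.sum_range_succ _ k, Finset.sum_range_succ _ k]
    simp only [Nat.choose_succ_self, Nat.choose_zero_right]
    simp
    abel

end NormalOrdering

/-! ### Resummation of double series along diagonals -/

section ShiftedSums

/-- Substitute `p = k - j`, `q = l - j`. As `G` vanishes outside `p, q < K`, the sum runs over a box
independent of `(k, l)`, on which the pair determines `j = k - p`. -/
theorem sum_range_shift {M : Type*} [AddCommMonoid M] {K : ℕ} {G : ℕ → ℕ → ℕ → M}
    (hG : ∀ p q j, K ≤ p ∨ K ≤ q → G p q j = 0) (k l : ℕ) :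
    (∑ j ∈ Finset.range (k + 1), if j ≤ l then G (k - j) (l - j) j else 0) =
      ∑ p ∈ Finset.range K, ∑ q ∈ Finset.range K,
        if p ≤ k ∧ l = q + (k - p) then G p q (k - p) else 0 := by
  rw [← Finset.sum_range_reflect]
  have h1 : ∀ p, (∑ q ∈ Finset.range K, if p ≤ k ∧ l = q + (k - p) then G p q (k - p) else 0) =
      if p ≤ k then (if k - p ≤ l then G p (l - (k - p)) (k - p) else 0) else 0 := by
    intro p
    by_cases hp : p ≤ k
    · by_cases hl : k - p ≤ l
      · rw [if_pos hp, if_pos hl]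
        by_cases hK : K ≤ l - (k - p)
        · rw [hG _ _ _ (Or.inr hK)]
          refine Finset.sum_eq_zero fun q hq => if_neg fun h => ?_
          have := Finset.mem_range.1 hq
          omega
        · rw [Finset.sum_eq_single (l - (k - p)), if_pos ⟨hp, by omega⟩]
          · exact fun q _ hq => if_neg (by omega)
          · exact fun h => absurd (Finset.mem_range.2 (by omega)) h
      · rw [if_pos hp, if_neg hl]
        exact Finset.sum_eq_zero fun q _ => if_neg (by omega)
    · rw [if_neg hp]
      exact Finset.sum_eq_zero fun q _ => if_neg (by omega)
  simp only [h1]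
  rw [← Finset.sum_filter (p := fun p => p ≤ k)]
  -- The index sets `p ≤ k` and `p ≤ k, p < K` differ only where `p ≥ K`, and there `G` is zero.
  refine Finset.sum_congr_of_eq_on_inter ?_ ?_ ?_
  · intro p hp hp'
    simp only [Finset.mem_range, Finset.mem_filter] at hp hp'
    have h3 : k - (k + 1 - 1 - p) = p := by omega
    rw [h3, hG p _ _ (Or.inl (by omega)), ite_self]
  · intro p hp hp'
    simp only [Finset.mem_range, Finset.mem_filter] at hp hp'
    omega
  · intro p hp _
    simp only [Finset.mem_range] at hp
    have h3 : k - (k + 1 - 1 - p) = p := by omega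
    have h4 : k + 1 - 1 - p = k - p := by omega
    rw [h3, h4]

/-- Only the finitely many diagonals `j ↦ (p + j, q + j)` with `p, q < K` carry nonzero terms, so
convergence of one single series on each diagonal gives unconditional convergence of the double
series. -/
theorem hasSum_shift {K : ℕ} {u : ℕ → ℕ → ℂ} {G : ℕ → ℕ → ℕ → ℂ} {s : ℕ → ℕ → ℂ}
    (hG : ∀ p q j, K ≤ p ∨ K ≤ q → G p q j = 0)
    (hs : ∀ p q, HasSum (fun j => u (p + j) (q + j) * G p q j) (s p q)) :
    HasSum (fun z : ℕ × ℕ => u z.1 z.2 * ∑ j ∈ Finset.range (z.1 + 1),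
        if j ≤ z.2 then G (z.1 - j) (z.2 - j) j else 0)
      (∑ p ∈ Finset.range K, ∑ q ∈ Finset.range K, s p q) := by
  simp only [sum_range_shift hG, Finset.mul_sum]
  refine hasSum_sum fun p _ => hasSum_sum fun q _ => ?_
  have hi : Function.Injective fun j : ℕ => (p + j, q + j) := fun i j h => by
    simpa using congrArg Prod.fst h
  refine (hi.hasSum_iff ?_).1 ?_
  · rintro ⟨k, l⟩ hkl
    rw [if_neg, mul_zero]
    rintro ⟨h1, h2⟩
    refine hkl ⟨k - p, Prod.ext ?_ ?_⟩ <;> dsimp only at * <;> omega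
  · convert hs p q using 2 with j
    simp

end ShiftedSums

/-! ### Inner products of iterated creation operators -/

section Wick

variable {V : Type u} [NormedAddCommGroup V] [InnerProductSpace ℂ V]

theorem inner_create_pow_left (v : V) (k : ℕ) (x y : FockFin V) :
    ⟪(create v ^ k) x, y⟫_ℂ = ⟪x, (annihilate (innerSL ℂ v : V →ₗ[ℂ] ℂ) ^ k) y⟫_ℂ := by
  induction k generalizing x with
  | zero => rfl
  | succ k ih => 
    rw [pow_succ, pow_succ', Module.End.mul_apply, Module.End.mul_apply, ih, inner_create_left]

theorem inner_create_pow_right (v : V) (k : ℕ) (x y : FockFin V) :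
    ⟪x, (create v ^ k) y⟫_ℂ = ⟪(annihilate (innerSL ℂ v : V →ₗ[ℂ] ℂ) ^ k) x, y⟫_ℂ := by
  rw [← inner_conj_symm, inner_create_pow_left, inner_conj_symm]

/-- The coefficients of the normally ordered expansion of `⟪c ^ k x, c ^ l y⟫ / (k! l!)`. -/
def wickCoeff (v : V) (x y : FockFin V) (p q j : ℕ) : ℂ :=
  ((‖v‖ ^ 2 : ℝ) : ℂ) ^ j / (j.factorial * p.factorial * q.factorial) *
    ⟪(annihilate (innerSL ℂ v : V →ₗ[ℂ] ℂ) ^ q) x, (annihilate (innerSL ℂ v : V →ₗ[ℂ] ℂ) ^ p) y⟫_ℂ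

/-- Move `c ^ k` across as `a ^ k`, normally order `a ^ k * c ^ l`, and move the remaining powers of
`c` back. The index `j` counts contractions; the binomial and falling factorial reduce to `1 / (j!
p! q!)`. -/
theorem inner_create_pow (v : V) (x y : FockFin V) (k l : ℕ) :
    ((k.factorial : ℂ) * l.factorial)⁻¹ * ⟪(create v ^ k) x, (create v ^ l) y⟫_ℂ =
      ∑ j ∈ Finset.range (k + 1), if j ≤ l then wickCoeff v x y (k - j) (l - j) j else 0 := by
  have hc : annihilate (innerSL ℂ v : V →ₗ[ℂ] ℂ) * create v =
      create v * annihilate (innerSL ℂ v : V →ₗ[ℂ] ℂ) + ((‖v‖ ^ 2 : ℝ) : ℂ) • 1 := by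
    rw [annihilate_mul_create]
    congr 2
    change ⟪v, v⟫_ℂ = _
    rw [inner_self_eq_norm_sq_to_K]
    norm_cast
  rw [inner_create_pow_left, ← Module.End.mul_apply, pow_mul_pow_of_commutator hc,
    LinearMap.sum_apply, inner_sum, Finset.mul_sum]
  refine Finset.sum_congr rfl fun j hj => ?_
  rw [LinearMap.smul_apply, inner_smul_right, Module.End.mul_apply, inner_create_pow_right]
  by_cases hl : j ≤ l
  · rw [if_pos hl, wickCoeff, ← mul_assoc]
    congr 1
    obtain ⟨q, rfl⟩ := Nat.exists_eq_add_of_le hl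
    obtain ⟨p, rfl⟩ := Nat.exists_eq_add_of_le (Nat.lt_succ_iff.1 (Finset.mem_range.1 hj))
    rw [Nat.add_sub_cancel_left, Nat.add_sub_cancel_left]
    have h1 : ((j + p).choose j : ℂ) * j.factorial * p.factorial = (j + p).factorial := by
      have := Nat.choose_mul_factorial_mul_factorial (Nat.le_add_right j p)
      rw [Nat.add_sub_cancel_left] at this
      exact_mod_cast this
    have h2 : (q.factorial : ℂ) * (j + q).descFactorial j = (j + q).factorial := by
      have := Nat.factorial_mul_descFactorial (Nat.le_add_right j q)
      rw [Nat.add_sub_cancel_left] at this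
      exact_mod_cast this
    rw [← h1, ← h2]
    have n1 : (j.factorial : ℂ) ≠ 0 := by exact_mod_cast j.factorial_ne_zero
    have n2 : (p.factorial : ℂ) ≠ 0 := by exact_mod_cast p.factorial_ne_zero
    have n3 : (q.factorial : ℂ) ≠ 0 := by exact_mod_cast q.factorial_ne_zero
    have n4 : ((j + p).choose j : ℂ) ≠ 0 := by
      exact_mod_cast (Nat.choose_pos (Nat.le_add_right j p)).ne'
    have n5 : ((j + q).descFactorial j : ℂ) ≠ 0 := by
      have := (Nat.pos_of_ne_zero ((Nat.descFactorial_eq_zero_iff_lt).not.2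
        (not_lt.2 (Nat.le_add_right j q)))).ne'
      exact_mod_cast this
    field_simp
  · rw [if_neg hl, Nat.descFactorial_of_lt (not_le.1 hl)]
    simp

theorem pow_apply_eq_zero_of_le {M : Type*} [AddCommGroup M] [Module ℂ M] {N : M →ₗ[ℂ] M}
    {x : M} {K k : ℕ} (hK : (N ^ K) x = 0) (h : K ≤ k) : (N ^ k) x = 0 := by
  obtain ⟨m, rfl⟩ := Nat.exists_eq_add_of_le' h
  rw [pow_add, Module.End.mul_apply, hK, map_zero]

/-- The weights `u` stand for the spin matrix elements. The sum over contractions is left as the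
hypothesis `hs`, to be evaluated differently for a decomposable operator and for the identity. -/
theorem hasSum_inner_create_pow (v : V) (x y : FockFin V) {K : ℕ}
    (hx : (annihilate (innerSL ℂ v : V →ₗ[ℂ] ℂ) ^ K) x = 0)
    (hy : (annihilate (innerSL ℂ v : V →ₗ[ℂ] ℂ) ^ K) y = 0) {u s : ℕ → ℕ → ℂ}
    (hs : ∀ p q, HasSum
      (fun j => (j.factorial : ℂ)⁻¹ * ((‖v‖ ^ 2 : ℝ) : ℂ) ^ j * u (p + j) (q + j)) (s p q)) :
    HasSum (fun z : ℕ × ℕ => u z.1 z.2 * (((z.1.factorial : ℂ) * z.2.factorial)⁻¹ *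
        ⟪(create v ^ z.1) x, (create v ^ z.2) y⟫_ℂ))
      (∑ p ∈ Finset.range K, ∑ q ∈ Finset.range K, s p q * (((p.factorial : ℂ) * q.factorial)⁻¹ *
        ⟪(annihilate (innerSL ℂ v : V →ₗ[ℂ] ℂ) ^ q) x,
          (annihilate (innerSL ℂ v : V →ₗ[ℂ] ℂ) ^ p) y⟫_ℂ)) := by
  simp only [inner_create_pow]
  refine hasSum_shift ?_ fun p q => ?_
  · rintro p q j (h | h)
    · rw [wickCoeff, pow_apply_eq_zero_of_le hy h, inner_zero_right, mul_zero]
    · rw [wickCoeff, pow_apply_eq_zero_of_le hx h, inner_zero_left, mul_zero]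
  · refine ((hs p q).mul_right (((p.factorial : ℂ) * q.factorial)⁻¹ *
        ⟪(annihilate (innerSL ℂ v : V →ₗ[ℂ] ℂ) ^ q) x,
          (annihilate (innerSL ℂ v : V →ₗ[ℂ] ℂ) ^ p) y⟫_ℂ)).congr_fun fun j => ?_
    rw [wickCoeff, div_eq_mul_inv, mul_inv, mul_inv, mul_inv]
    ring

theorem exists_annihilate_pow_eq_zero (ℓ : V →ₗ[ℂ] ℂ) (x y : FockFin V) :
    ∃ K, (annihilate ℓ ^ K) x = 0 ∧ (annihilate ℓ ^ K) y = 0 := by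
  obtain ⟨K, hK⟩ := annihilate_locallyNilpotent ℓ x
  obtain ⟨J, hJ⟩ := annihilate_locallyNilpotent ℓ y
  exact ⟨K + J, pow_apply_eq_zero_of_le hK (Nat.le_add_right _ _),
    pow_apply_eq_zero_of_le hJ (Nat.le_add_left _ _)⟩

theorem hasSum_exp_series (z : ℂ) :
    HasSum (fun j : ℕ => (j.factorial : ℂ)⁻¹ * z ^ j) (Complex.exp z) := by
  rw [Complex.exp_eq_exp_ℂ]
  exact NormedSpace.exp_series_hasSum_exp' (𝕂 := ℂ) z

/-- On the diagonal `k = l`, the preceding lemma with weights `(4r²)^k` makes the squares of `(2r)^k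
‖c^k x‖ / k!` summable. The inequality `2XY ≤ X² + Y²` with `Y = 2^{-k}` removes the squares. -/
theorem summable_norm_create_pow (v : V) (x : FockFin V) {r : ℝ} (hr : 0 ≤ r) :
    Summable fun k : ℕ => r ^ k * ((k.factorial : ℝ)⁻¹ * ‖(create v ^ k) x‖) := by
  obtain ⟨K, hK, -⟩ := exists_annihilate_pow_eq_zero (innerSL ℂ v : V →ₗ[ℂ] ℂ) x x
  have h := (hasSum_inner_create_pow v x x hK hK (u := fun k _ => ((4 * r ^ 2 : ℝ) : ℂ) ^ k)
    (s := fun p _ => Complex.exp (((‖v‖ ^ 2 : ℝ) : ℂ) * ((4 * r ^ 2 : ℝ) : ℂ)) *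
      ((4 * r ^ 2 : ℝ) : ℂ) ^ p) fun p q => by
        refine ((hasSum_exp_series
          (((‖v‖ ^ 2 : ℝ) : ℂ) * ((4 * r ^ 2 : ℝ) : ℂ))).mul_right _).congr_fun fun j => ?_
        rw [pow_add, mul_pow]
        ring).summable
  have hd : Function.Injective fun k : ℕ => (k, k) := fun i j h => congrArg Prod.fst h
  have h1 := (h.comp_injective hd).norm
  have h2 := (h1.add (summable_geometric_of_lt_one (r := 1 / 4) (by norm_num) (by norm_num)))
  refine Summable.of_nonneg_of_le (fun k => by positivity) (fun k => ?_) h2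
  simp only [Function.comp_apply]
  rw [inner_self_eq_norm_sq_to_K]
  simp only [norm_mul, norm_inv, norm_pow, Complex.norm_natCast, RCLike.norm_ofReal, abs_norm,
    Complex.norm_real, Real.norm_of_nonneg hr, Real.norm_ofNat]
  rw [mul_pow]
  set w := (k.factorial : ℝ)⁻¹ * ‖(create v ^ k) x‖
  have e : (4 : ℝ) ^ k * (r ^ 2) ^ k * (((k.factorial : ℝ) * k.factorial)⁻¹ *
      ‖(create v ^ k) x‖ ^ 2) = (2 ^ k * (r ^ k * w)) ^ 2 := by
    have h4 : (4 : ℝ) ^ k = 2 ^ k * 2 ^ k := by rw [← mul_pow]; norm_num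
    simp only [w, mul_inv, h4]
    ring
  have e' : ((1 : ℝ) / 4) ^ k = ((2 ^ k)⁻¹) ^ 2 := by
    rw [show (1 : ℝ) / 4 = (2⁻¹) ^ 2 by norm_num, ← pow_mul, ← inv_pow, ← pow_mul, mul_comm]
  rw [e, e']
  have h3 := two_mul_le_add_sq (2 ^ k * (r ^ k * w)) (((2 : ℝ) ^ k)⁻¹)
  have h4 : 2 * (2 ^ k * (r ^ k * w)) * ((2 : ℝ) ^ k)⁻¹ = 2 * (r ^ k * w) := by
    have : (2 : ℝ) ^ k ≠ 0 := by positivity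
    field_simp
  have h5 : 0 ≤ r ^ k * w := by positivity
  linarith

end Wick

/-! ### Double operator integrals of product functions -/

section SpectralCalculus

variable {S : Type*} [NormedAddCommGroup S] [InnerProductSpace ℂ S] [CompleteSpace S]

theorem tendsto_inner_of_tendsto_inner_self {ι : Type*} {l : Filter ι} {T : ι → S →L[ℂ] S}
    {X : S →L[ℂ] S} (h : ∀ x, Tendsto (fun i => ⟪x, T i x⟫_ℂ) l (𝓝 ⟪x, X x⟫_ℂ)) (x y : S) :
    Tendsto (fun i => ⟪x, T i y⟫_ℂ) l (𝓝 ⟪x, X y⟫_ℂ) := by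
  have h' : ∀ x, Tendsto (fun i => ⟪T i x, x⟫_ℂ) l (𝓝 ⟪X x, x⟫_ℂ) := by
    intro x
    have := (Complex.continuous_conj.tendsto _).comp (h x)
    simpa only [Function.comp_def, inner_conj_symm] using this
  have hp : ∀ Y : S →L[ℂ] S, ⟪Y y, x⟫_ℂ = (⟪Y (x + y), x + y⟫_ℂ - ⟪Y (x - y), x - y⟫_ℂ +
      Complex.I * ⟪Y (x + Complex.I • y), x + Complex.I • y⟫_ℂ -
      Complex.I * ⟪Y (x - Complex.I • y), x - Complex.I • y⟫_ℂ) / 4 := fun Y =>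
    inner_map_polarization (Y : S →ₗ[ℂ] S) x y
  have h2 : Tendsto (fun i => ⟪T i y, x⟫_ℂ) l (𝓝 ⟪X y, x⟫_ℂ) := by
    rw [hp X]
    refine Tendsto.congr (fun i => (hp (T i)).symm) ?_
    exact ((((h' _).sub (h' _)).add ((h' _).const_mul _)).sub ((h' _).const_mul _)).div_const _
  have := (Complex.continuous_conj.tendsto _).comp h2
  simpa only [Function.comp_def, inner_conj_symm] using this

variable (E : PVM S)

instance (ψ : S) : IsFiniteMeasure (E.diag ψ) :=
  ⟨by rw [E.diag_apply ψ MeasurableSet.univ]; exact ENNReal.ofReal_lt_top⟩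

theorem PVM.inner_proj (ψ : S) {M : Set ℂ} (hM : MeasurableSet M) :
    ⟪ψ, E.proj M ψ⟫_ℂ = ((E.diag ψ).real M : ℂ) := by
  rw [measureReal_def, E.diag_apply ψ hM, inner_proj_self (E.isStarProjection M hM),
    Complex.ofReal_re, ENNReal.toReal_ofReal (by positivity)]

/-- The spectral integral `∫ s dE` of a simple function. -/
def PVM.simple (s : SimpleFunc ℂ ℂ) : S →L[ℂ] S := ∑ y ∈ s.range, y • E.proj (s ⁻¹' {y})

theorem PVM.simple_apply (s : SimpleFunc ℂ ℂ) (x : S) :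
    E.simple s x = ∑ y ∈ s.range, y • E.proj (s ⁻¹' {y}) x := by
  simp [PVM.simple, sum_apply]

theorem PVM.inner_simple_self (s : SimpleFunc ℂ ℂ) (ψ : S) :
    ⟪ψ, E.simple s ψ⟫_ℂ = ∫ z, s z ∂(E.diag ψ) := by
  rw [← SimpleFunc.integral_eq_integral _ (SimpleFunc.integrable_of_isFiniteMeasure s),
    SimpleFunc.integral_eq, PVM.simple_apply, inner_sum]
  refine Finset.sum_congr rfl fun y _ => ?_
  rw [inner_smul_right, E.inner_proj ψ (s.measurableSet_fiber y), mul_comm]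
  simp

/-- Dominated convergence for each finite measure `E.diag ψ` gives convergence of quadratic forms,
and polarization gives matrix elements. Weak convergence is enough, so `X` need be known only
through its quadratic form. -/
theorem PVM.tendsto_inner_simple {f : ℂ → ℂ} {C : ℝ} {s : ℕ → SimpleFunc ℂ ℂ}
    (hs : ∀ z, Tendsto (fun n => s n z) atTop (𝓝 (f z))) (hC : ∀ n z, ‖s n z‖ ≤ C)
    {X : S →L[ℂ] S} (hX : ∀ ψ, ⟪ψ, X ψ⟫_ℂ = ∫ z, f z ∂(E.diag ψ)) (x y : S) :
    Tendsto (fun n => ⟪x, E.simple (s n) y⟫_ℂ) atTop (𝓝 ⟪x, X y⟫_ℂ) := by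
  refine tendsto_inner_of_tendsto_inner_self (fun ψ => ?_) x y
  simp only [hX, E.inner_simple_self]
  exact tendsto_integral_of_dominated_convergence (fun _ => C)
    (fun n => (s n).aestronglyMeasurable) (integrable_const C)
    (fun n => Eventually.of_forall fun z => hC n z) (Eventually.of_forall hs)

variable {E} {A : S →L[ℂ] S} (hA : IsDecomposable E A)

theorem doiMeasure_prod (ψ φ : S) {M N : Set ℂ} (hM : MeasurableSet M) (hN : MeasurableSet N) :
    doiMeasure hA ψ φ (M ×ˢ N) = ⟪E.proj M ψ, A (E.proj N φ)⟫_ℂ :=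
  hA.choose_spec.1 ψ φ M N hM hN

/-- Rectangles form a generating π-system that contains the whole space. Hence the chosen
`doiMeasure` is determined by the matrix elements it represents. -/
theorem complexMeasure_ext_prod {μ ν : ComplexMeasure (ℂ × ℂ)}
    (h : ∀ M N, MeasurableSet M → MeasurableSet N → μ (M ×ˢ N) = ν (M ×ˢ N)) : μ = ν := by
  refine VectorMeasure.ext_of_generateFrom _ ?_ generateFrom_prod.symm isPiSystem_prod ?_
  · rintro _ ⟨M, hM, N, hN, rfl⟩
    exact h M N hM hN
  · rw [← Set.univ_prod_univ]
    exact h _ _ MeasurableSet.univ MeasurableSet.univ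

theorem doiMeasure_smul (c d : ℂ) (ψ φ : S) :
    doiMeasure hA (c • ψ) (d • φ) = (conj c * d) • doiMeasure hA ψ φ := by
  refine complexMeasure_ext_prod fun M N hM hN => ?_
  rw [smul_apply, doiMeasure_prod hA _ _ hM hN, doiMeasure_prod hA _ _ hM hN,
    map_smul, map_smul, map_smul, inner_smul_left, inner_smul_right, smul_eq_mul, mul_assoc]

/-- Decomposability bounds the variation only on the unit ball; homogeneity carries finiteness to
all vectors. -/
instance isFiniteMeasure_variation_doiMeasure (ψ φ : S) :
    IsFiniteMeasure (doiMeasure hA ψ φ).variation := by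
  obtain ⟨C, hC⟩ := hA.choose_spec.2
  have key : ∀ x : S, ∃ (c : ℂ) (y : S), ‖y‖ ≤ 1 ∧ x = c • y := by
    intro x
    have hpos : 0 < ‖x‖ + 1 := by positivity
    -- Dividing by `‖x‖ + 1` rather than `‖x‖` covers the zero vector too.
    refine ⟨((‖x‖ + 1 : ℝ) : ℂ), ((‖x‖ + 1 : ℝ) : ℂ)⁻¹ • x, ?_, ?_⟩
    · rw [norm_smul, norm_inv, Complex.norm_real, Real.norm_of_nonneg hpos.le,
        inv_mul_le_iff₀ hpos]
      linarith
    · rw [smul_smul, mul_inv_cancel₀ (by exact_mod_cast hpos.ne'), one_smul]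
  obtain ⟨c, x, hx, rfl⟩ := key ψ
  obtain ⟨d, y, hy, rfl⟩ := key φ
  have : IsFiniteMeasure (doiMeasure hA x y).variation :=
    ⟨(hC x y hx hy).trans_lt ENNReal.coe_lt_top⟩
  rw [doiMeasure_smul]
  infer_instance

theorem doi_const_indicator (c : ℂ) {M : Set (ℂ × ℂ)} (hM : MeasurableSet M) (ψ φ : S) :
    doi hA (M.indicator fun _ => c) ψ φ = c * doiMeasure hA ψ φ M := by
  exact VectorMeasure.integral_indicator_const c hM

theorem doi_const_mul (c : ℂ) (f : ℂ × ℂ → ℂ) (ψ φ : S) :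
    doi hA (fun z => c * f z) ψ φ = c * doi hA f ψ φ :=
  setToFun_smul (𝕜 := ℂ) _ (fun c _ x => mul_assoc c x _) c f

theorem integrable_doiMeasure_of_bound {f : ℂ × ℂ → ℂ} (hf : Measurable f) {C : ℝ} {ψ φ : S}
    (hC : ∀ᵐ z ∂(doiMeasure hA ψ φ).variation, ‖f z‖ ≤ C) :
    (doiMeasure hA ψ φ).Integrable f :=
  Integrable.of_bound hf.aestronglyMeasurable C hC

/-- Both sides split over pairs of fibres, and on a rectangle the measure is the required matrix
element. -/
theorem doi_simple (s t : SimpleFunc ℂ ℂ) (ψ φ : S) :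
    doi hA (fun z => conj (s z.1) * t z.2) ψ φ = ⟪E.simple s ψ, A (E.simple t φ)⟫_ℂ := by
  have hm : ∀ x y : ℂ, MeasurableSet ((s ⁻¹' {x}) ×ˢ (t ⁻¹' {y})) := fun x y =>
    (s.measurableSet_fiber x).prod (t.measurableSet_fiber y)
  have h1 : (fun z : ℂ × ℂ => conj (s z.1) * t z.2) = fun z => ∑ x ∈ s.range, ∑ y ∈ t.range,
      ((s ⁻¹' {x}) ×ˢ (t ⁻¹' {y})).indicator (fun _ => conj x * y) z := by
    ext z
    rw [Finset.sum_eq_single (s z.1), Finset.sum_eq_single (t z.2)]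
    · rw [Set.indicator_of_mem (by simp)]
    · intro y _ hy
      exact Set.indicator_of_notMem (fun h => hy (by simpa using h.2.symm)) _
    · exact fun h => absurd (SimpleFunc.mem_range_self _ _) h
    · intro x _ hx
      refine Finset.sum_eq_zero fun y _ => ?_
      exact Set.indicator_of_notMem (fun h => hx (by simpa using h.1.symm)) _
    · exact fun h => absurd (SimpleFunc.mem_range_self _ _) h
  have hi : ∀ x y : ℂ, (doiMeasure hA ψ φ).Integrable
      (((s ⁻¹' {x}) ×ˢ (t ⁻¹' {y})).indicator fun _ => conj x * y) := fun x y =>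
    (integrable_const _).indicator (hm x y)
  rw [h1, doi, VectorMeasure.integral_finsetSum _ fun x _ => integrable_finsetSum _ fun y _ => hi x y]
  rw [PVM.simple_apply, PVM.simple_apply, sum_inner]
  refine Finset.sum_congr rfl fun x _ => ?_
  rw [VectorMeasure.integral_finsetSum _ fun y _ => hi x y, map_sum, inner_sum]
  refine Finset.sum_congr rfl fun y _ => ?_
  rw [map_smul, inner_smul_left, inner_smul_right, ← doiMeasure_prod hA ψ φ
    (s.measurableSet_fiber x) (t.measurableSet_fiber y), ← mul_assoc]
  exact doi_const_indicator hA _ (hm x y) ψ φ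

theorem exists_simple_approx {f : ℂ → ℂ} (hf : Measurable f) {C : ℝ} (hC : ∀ z, ‖f z‖ ≤ C) :
    ∃ s : ℕ → SimpleFunc ℂ ℂ, (∀ z, Tendsto (fun n => s n z) atTop (𝓝 (f z))) ∧
      ∀ n z, ‖s n z‖ ≤ C :=
  ⟨hf.stronglyMeasurable.approxBounded C,
    fun z => hf.stronglyMeasurable.tendsto_approxBounded_of_norm_le (hC z),
    fun n z => hf.stronglyMeasurable.norm_approxBounded_le
      ((norm_nonneg _).trans (hC 0)) n z⟩

/-- The approximating operators converge only weakly, so the two sides of the inner product cannot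
be passed to the limit together. The second variable goes first, with a simple function fixed in the
first; then the first variable follows. -/
theorem doi_conj_mul {f k : ℂ → ℂ} (hf : Measurable f) (hk : Measurable k) {C : ℝ}
    (hfC : ∀ z, ‖f z‖ ≤ C) (hkC : ∀ z, ‖k z‖ ≤ C) {X Y : S →L[ℂ] S}
    (hX : ∀ ψ, ⟪ψ, X ψ⟫_ℂ = ∫ z, f z ∂(E.diag ψ)) (hY : ∀ ψ, ⟪ψ, Y ψ⟫_ℂ = ∫ z, k z ∂(E.diag ψ))
    (ψ φ : S) : doi hA (fun z => conj (f z.1) * k z.2) ψ φ = ⟪X ψ, A (Y φ)⟫_ℂ := by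
  have hC : 0 ≤ C := (norm_nonneg _).trans (hfC 0)
  obtain ⟨s, hs, hsC⟩ := exists_simple_approx hf hfC
  obtain ⟨t, ht, htC⟩ := exists_simple_approx hk hkC
  have step : ∀ n, doi hA (fun z => conj (s n z.1) * k z.2) ψ φ =
      ⟪E.simple (s n) ψ, A (Y φ)⟫_ℂ := by
    intro n
    have h1 : Tendsto (fun m => doi hA (fun z => conj (s n z.1) * t m z.2) ψ φ) atTop
        (𝓝 (doi hA (fun z => conj (s n z.1) * k z.2) ψ φ)) := by
      refine VectorMeasure.tendsto_integral_of_dominated_convergence (fun _ => C * C) (fun m => ?_)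
        (integrable_const _) (fun m => Eventually.of_forall fun z => ?_)
        (Eventually.of_forall fun z => (ht z.2).const_mul _)
      · have h1 : Measurable (s n) := (s n).measurable
        have h2 : Measurable (t m) := (t m).measurable
        exact Measurable.aestronglyMeasurable (by fun_prop)
      · rw [norm_mul, RCLike.norm_conj]
        gcongr
        exacts [hsC _ _, htC _ _]
    refine tendsto_nhds_unique h1 ?_
    simp only [doi_simple]
    -- The adjoint of `A` moves everything fixed to the left, so weak convergence on the right
    -- applies.
    have h2 := E.tendsto_inner_simple ht htC hY (ContinuousLinearMap.adjoint A (E.simple (s n) ψ)) φ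
    simpa only [ContinuousLinearMap.adjoint_inner_left] using h2
  have h1 : Tendsto (fun n => doi hA (fun z => conj (s n z.1) * k z.2) ψ φ) atTop
      (𝓝 (doi hA (fun z => conj (f z.1) * k z.2) ψ φ)) := by
    refine VectorMeasure.tendsto_integral_of_dominated_convergence (fun _ => C * C) (fun m => ?_)
      (integrable_const _) (fun m => Eventually.of_forall fun z => ?_)
      (Eventually.of_forall fun z => ((Complex.continuous_conj.tendsto _).comp (hs z.1)).mul_const _)
    · have h1 : Measurable (s m) := (s m).measurable
      exact Measurable.aestronglyMeasurable (by fun_prop)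
    · rw [norm_mul, RCLike.norm_conj]
      gcongr
      exacts [hsC _ _, hkC _]
  refine tendsto_nhds_unique h1 ?_
  simp only [step]
  have h2 := (Complex.continuous_conj.tendsto _).comp (E.tendsto_inner_simple hs hsC hX (A (Y φ)) ψ)
  simpa only [Function.comp_def, inner_conj_symm] using h2

variable {B : S →L[ℂ] S} (hB : IsStarNormal B)

theorem spectralPVM_proj_eq_zero {M : Set ℂ} (hM : Disjoint M (spectrum ℂ B)) :
    (spectralPVM hB).proj M = 0 := by
  by_cases hm : MeasurableSet M
  · ext x
    have h := norm_spectralProj_sq hB hm x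
    have e : (Subtype.val ⁻¹' M : Set (spectrum ℂ B)) = ∅ := by
      ext z
      simpa using fun h => Set.disjoint_left.1 hM h z.2
    rw [e, measureReal_empty] at h
    simpa using! h
  · exact (spectralPVM hB).not_measurable M hm

theorem measurableSet_spectrum : MeasurableSet (spectrum ℂ B) :=
  (spectrum.isClosed B).measurableSet

/-- The spectral projections of sets off the spectrum vanish. As the spectrum is compact, both
integration variables are then almost everywhere bounded, which makes polynomial integrands
harmless. -/
theorem ae_mem_spectrum (hA : IsDecomposable (spectralPVM hB) A) (ψ φ : S) :
    ∀ᵐ z ∂(doiMeasure hA ψ φ).variation, z.1 ∈ spectrum ℂ B ∧ z.2 ∈ spectrum ℂ B := by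
  have hK : MeasurableSet (spectrum ℂ B) := measurableSet_spectrum
  -- Vanishing of the complex measure on `Z` alone would not control its variation. The restriction
  -- to `Z` vanishes on all rectangles, hence is zero, and so is its variation.
  have key : ∀ Z : Set (ℂ × ℂ), MeasurableSet Z →
      (∀ M N, MeasurableSet M → MeasurableSet N → doiMeasure hA ψ φ ((M ×ˢ N) ∩ Z) = 0) →
      (doiMeasure hA ψ φ).variation Z = 0 := by
    intro Z hZ h
    have h0 : (doiMeasure hA ψ φ).restrict Z = 0 := by
      refine complexMeasure_ext_prod fun M N hM hN => ?_
      rw [VectorMeasure.restrict_apply _ hZ (hM.prod hN), h M N hM hN]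
      rfl
    have h1 := VectorMeasure.variation_restrict (μ := doiMeasure hA ψ φ) hZ
    rw [h0, VectorMeasure.variation_zero] at h1
    have h2 := congrArg (fun m : Measure (ℂ × ℂ) => m Z) h1
    simpa using h2.symm
  have h1 : (doiMeasure hA ψ φ).variation ((spectrum ℂ B)ᶜ ×ˢ Set.univ) = 0 := by
    refine key _ (hK.compl.prod MeasurableSet.univ) fun M N hM hN => ?_
    rw [Set.prod_inter_prod, Set.inter_univ, doiMeasure_prod hA _ _ (hM.inter hK.compl) hN,
      spectralPVM_proj_eq_zero hB (disjoint_compl_left.mono_left Set.inter_subset_right)]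
    simp
  have h2 : (doiMeasure hA ψ φ).variation (Set.univ ×ˢ (spectrum ℂ B)ᶜ) = 0 := by
    refine key _ (MeasurableSet.univ.prod hK.compl) fun M N hM hN => ?_
    rw [Set.prod_inter_prod, Set.inter_univ, doiMeasure_prod hA _ _ hM (hN.inter hK.compl),
      spectralPVM_proj_eq_zero hB (disjoint_compl_left.mono_left Set.inter_subset_right)]
    simp
  have h3 := measure_union_null h1 h2
  rw [ae_iff]
  refine measure_mono_null (fun z hz => ?_) h3
  simp only [Set.mem_ofPred_eq, not_and_or] at hz
  simpa using hz

/-- The functional calculus sees `f` only on the spectrum; the indicator makes the integrand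
globally bounded, as `doi_conj_mul` demands. Real and imaginary parts are treated separately because
the scalar measures were built from real functions. -/
theorem integral_diag_cfc {f : ℂ → ℂ} (hf : Continuous f) (ψ : S) :
    ⟪ψ, cfc f B ψ⟫_ℂ = ∫ z, (spectrum ℂ B).indicator f z ∂((spectralPVM hB).diag ψ) := by
  let fr : C(spectrum ℂ B, ℝ) := ⟨fun z => (f z).re, by fun_prop⟩
  let fi : C(spectrum ℂ B, ℝ) := ⟨fun z => (f z).im, by fun_prop⟩
  have hdec : cfc f B = rho hB fr + Complex.I • rho hB fi := by
    rw [cfc_apply f B hB hf.continuousOn, rho, rho, ← map_smul, ← map_add]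
    congr 1
    ext z
    simp [fr, fi, mul_comm Complex.I, Complex.re_add_im]
  have hi : Integrable (fun z : spectrum ℂ B => f z) (mu hB ψ) :=
    Continuous.integrable_of_hasCompactSupport (by fun_prop)
      (HasCompactSupport.of_compactSpace _)
  have h1 : ∫ z : spectrum ℂ B, f z ∂(mu hB ψ) =
      ((∫ z, fr z ∂(mu hB ψ) : ℝ) : ℂ) + Complex.I * ((∫ z, fi z ∂(mu hB ψ) : ℝ) : ℂ) := by
    rw [mul_comm]
    exact (integral_re_add_im hi).symm
  rw [spectralPVM_diag, integral_map (by fun_prop)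
    (hf.measurable.indicator measurableSet_spectrum).aestronglyMeasurable]
  have h2 : ∀ z : spectrum ℂ B, (spectrum ℂ B).indicator f z = f z := fun z =>
    Set.indicator_of_mem z.2 f
  simp only [h2]
  rw [h1, integral_mu, integral_mu, ← inner_rho_self, ← inner_rho_self, hdec, add_apply,
    smul_apply, inner_add_right, inner_smul_right]

theorem exists_bound_on_spectrum {f : ℂ → ℂ} (hf : Continuous f) :
    ∃ C, ∀ z ∈ spectrum ℂ B, ‖f z‖ ≤ C :=
  (spectrum.isCompact B).exists_bound_of_continuousOn hf.continuousOn

/-- `∬ conj (f λ) k(μ) ⟨dE(λ) ψ, A dE(μ) φ⟩ = ⟨f(B) ψ, A k(B) φ⟩`. -/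
theorem doi_cfc (hA : IsDecomposable (spectralPVM hB) A) {f k : ℂ → ℂ} (hf : Continuous f)
    (hk : Continuous k) (ψ φ : S) :
    doi hA (fun z => conj (f z.1) * k z.2) ψ φ = ⟪cfc f B ψ, A (cfc k B φ)⟫_ℂ := by
  obtain ⟨C, hC⟩ := exists_bound_on_spectrum (B := B) hf
  obtain ⟨D, hD⟩ := exists_bound_on_spectrum (B := B) hk
  have hb : ∀ {g : ℂ → ℂ} {c : ℝ}, (∀ z ∈ spectrum ℂ B, ‖g z‖ ≤ c) → c ≤ max 0 (max C D) →
      ∀ z, ‖(spectrum ℂ B).indicator g z‖ ≤ max 0 (max C D) := by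
    intro g c hg hc z
    by_cases hz : z ∈ spectrum ℂ B
    · rw [Set.indicator_of_mem hz]
      exact (hg z hz).trans hc
    · rw [Set.indicator_of_notMem hz, norm_zero]
      exact le_max_left _ _
  rw [← doi_conj_mul hA (hf.measurable.indicator measurableSet_spectrum)
    (hk.measurable.indicator measurableSet_spectrum)
    (hb hC ((le_max_left C D).trans (le_max_right _ _)))
    (hb hD ((le_max_right C D).trans (le_max_right _ _)))
    (integral_diag_cfc hB hf) (integral_diag_cfc hB hk)]
  refine VectorMeasure.integral_congr_ae ?_
  filter_upwards [ae_mem_spectrum hB hA ψ φ] with z hz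
  rw [Set.indicator_of_mem hz.1, Set.indicator_of_mem hz.2]

end SpectralCalculus

/-! ### The sum over contractions on the spin side -/

section GaussianCalculus

variable {S : Type*} [NormedAddCommGroup S] [InnerProductSpace ℂ S] [CompleteSpace S]
  {B : S →L[ℂ] S}

variable (B) in
/-- The operator `exp(-½ t B* B)`. -/
def gaussOp (t : ℝ) : S →L[ℂ] S :=
  NormedSpace.exp ((-(t / 2 : ℝ) : ℂ) • (ContinuousLinearMap.adjoint B * B))

/-- The function `z ↦ exp(-½ t |z|²) z ^ k`. -/
def gaussPow (t : ℝ) (k : ℕ) (z : ℂ) : ℂ :=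
  Complex.exp (((-(t / 2) : ℝ) : ℂ) * (conj z * z)) * z ^ k

theorem continuous_gaussPow (t : ℝ) (k : ℕ) : Continuous (gaussPow t k) := by
  unfold gaussPow
  fun_prop

theorem cfc_gaussPow (hB : IsStarNormal B) (t : ℝ) (k : ℕ) :
    cfc (gaussPow t k) B = gaussOp B t * B ^ k := by
  have h1 : cfc (fun z : ℂ => conj z * z) B = ContinuousLinearMap.adjoint B * B := by
    rw [cfc_mul (fun z : ℂ => conj z) (fun z => z) B (by fun_prop) (by fun_prop), cfc_id' ℂ B]
    congr 1
    exact cfc_star_id (R := ℂ) B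
  have h2 : cfc (fun z : ℂ => ((-(t / 2) : ℝ) : ℂ) * (conj z * z)) B =
      (-(t / 2 : ℝ) : ℂ) • (ContinuousLinearMap.adjoint B * B) := by
    rw [cfc_const_mul _ _ B (by fun_prop), h1, Complex.ofReal_neg]
  have h3 : cfc (fun z : ℂ => Complex.exp (((-(t / 2) : ℝ) : ℂ) * (conj z * z))) B =
      gaussOp B t := by
    rw [cfc_comp' Complex.exp (fun z : ℂ => ((-(t / 2) : ℝ) : ℂ) * (conj z * z)) B
      (by fun_prop) (by fun_prop)]
    rw [CFC.complex_exp_eq_normedSpace_exp (cfc_predicate _ _), h2]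
    rfl
  unfold gaussPow
  rw [cfc_mul _ _ B (by fun_prop) (by fun_prop), h3, cfc_pow_id B k]

/-- The kernel `exp((conj l * m - (|l|² + |m|²) / 2) t)`. -/
def gaussKernel (t : ℝ) (l m : ℂ) : ℂ :=
  Complex.exp ((conj l * m - ((‖l‖ ^ 2 + ‖m‖ ^ 2 : ℝ) : ℂ) / 2) * (t : ℂ))

theorem conj_mul_self_eq (z : ℂ) : conj z * z = ((‖z‖ ^ 2 : ℝ) : ℂ) := by
  rw [mul_comm, Complex.mul_conj, Complex.normSq_eq_norm_sq]

theorem conj_gaussPow_mul (t : ℝ) (p q : ℕ) (l m : ℂ) :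
    conj (gaussPow t p l) * gaussPow t q m = conj l ^ p * m ^ q *
      Complex.exp (-(((‖l‖ ^ 2 + ‖m‖ ^ 2 : ℝ) : ℂ) / 2 * t)) := by
  have e : conj (Complex.exp (((-(t / 2) : ℝ) : ℂ) * (conj l * l))) =
      Complex.exp (((-(t / 2) : ℝ) : ℂ) * (conj l * l)) := by
    rw [← Complex.exp_conj]
    rw [map_mul, Complex.conj_ofReal, map_mul, Complex.conj_conj, mul_comm l]
  have e2 : Complex.exp (-(((‖l‖ ^ 2 + ‖m‖ ^ 2 : ℝ) : ℂ) / 2 * t)) =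
      Complex.exp (((-(t / 2) : ℝ) : ℂ) * (conj l * l)) *
        Complex.exp (((-(t / 2) : ℝ) : ℂ) * (conj m * m)) := by
    rw [← Complex.exp_add, conj_mul_self_eq, conj_mul_self_eq]
    congr 1
    push_cast
    ring
  rw [gaussPow, gaussPow, map_mul, map_pow, e, e2]
  ring

/-- The real part of `conj l * m - (|l|² + |m|²)/2` is `-|l - m|²/2`. This yields both the
domination by 1 and the decay off the diagonal. -/
theorem norm_gaussKernel (t : ℝ) (l m : ℂ) :
    ‖gaussKernel t l m‖ = Real.exp (-(‖l - m‖ ^ 2 / 2 * t)) := by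
  rw [gaussKernel, Complex.norm_exp]
  congr 1
  rw [Complex.mul_re, Complex.ofReal_im, Complex.ofReal_re, mul_zero, sub_zero, ← neg_mul]
  congr 1
  rw [Complex.sub_re, ← Complex.normSq_eq_norm_sq, ← Complex.normSq_eq_norm_sq,
    ← Complex.normSq_eq_norm_sq, Complex.normSq_apply, Complex.normSq_apply, Complex.normSq_apply]
  have : ((((l.re * l.re + l.im * l.im + (m.re * m.re + m.im * m.im) : ℝ) : ℂ) / 2).re) =
      (l.re * l.re + l.im * l.im + (m.re * m.re + m.im * m.im)) / 2 := by
    rw [← Complex.ofReal_ofNat, ← Complex.ofReal_div, Complex.ofReal_re]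
  rw [this]
  simp
  ring

theorem norm_gaussKernel_le_one {t : ℝ} (ht : 0 ≤ t) (l m : ℂ) : ‖gaussKernel t l m‖ ≤ 1 := by
  rw [norm_gaussKernel, Real.exp_le_one_iff, neg_nonpos]
  positivity

variable {A : S →L[ℂ] S} (hB : IsStarNormal B) (hA : IsDecomposable (spectralPVM hB) A)

theorem exists_ae_norm_le (ψ φ : S) :
    ∃ R : ℝ, 0 ≤ R ∧ ∀ᵐ z ∂(doiMeasure hA ψ φ).variation, ‖z.1‖ ≤ R ∧ ‖z.2‖ ≤ R := by
  obtain ⟨R, hR⟩ := exists_bound_on_spectrum (B := B) continuous_id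
  refine ⟨max 0 R, le_max_left _ _, ?_⟩
  filter_upwards [ae_mem_spectrum hB hA ψ φ] with z hz
  exact ⟨(hR _ hz.1).trans (le_max_right _ _), (hR _ hz.2).trans (le_max_right _ _)⟩

/-- Each term is a double operator integral with product integrand. Under the integral sign the sum
is the exponential series of `t conj λ μ`, which merges with the two Gaussians into `gaussKernel`.
-/
theorem hasSum_inner_gaussOp {t : ℝ} (ht : 0 ≤ t) (ψ φ : S) (p q : ℕ) :
    HasSum (fun j : ℕ => (j.factorial : ℂ)⁻¹ * (t : ℂ) ^ j *
        ⟪gaussOp B t ((B ^ (p + j)) ψ), A (gaussOp B t ((B ^ (q + j)) φ))⟫_ℂ)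
      (doi hA (fun z => conj z.1 ^ p * z.2 ^ q * gaussKernel t z.1 z.2) ψ φ) := by
  obtain ⟨R, hR, hae⟩ := exists_ae_norm_le hB hA ψ φ
  have hterm : ∀ j : ℕ, (j.factorial : ℂ)⁻¹ * (t : ℂ) ^ j *
      ⟪gaussOp B t ((B ^ (p + j)) ψ), A (gaussOp B t ((B ^ (q + j)) φ))⟫_ℂ =
      doi hA (fun z => ((j.factorial : ℂ)⁻¹ * (t : ℂ) ^ j) *
        (conj (gaussPow t (p + j) z.1) * gaussPow t (q + j) z.2)) ψ φ := by
    intro j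
    rw [doi_const_mul, doi_cfc hB hA (continuous_gaussPow _ _) (continuous_gaussPow _ _),
      cfc_gaussPow hB, cfc_gaussPow hB]
    rfl
  simp only [hterm]
  -- With `R` bounding both variables almost everywhere and the Gaussians bounded by 1, this
  -- exponential series dominates.
  have hsum : Summable fun j : ℕ => R ^ p * R ^ q * ((j.factorial : ℝ)⁻¹ * (t * (R * R)) ^ j) := by
    refine Summable.mul_left _ ?_
    refine (Real.summable_pow_div_factorial (t * (R * R))).congr fun j => ?_
    rw [div_eq_inv_mul]
  refine VectorMeasure.hasSum_integral_of_dominated_convergence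
    (fun j _ => R ^ p * R ^ q * ((j.factorial : ℝ)⁻¹ * (t * (R * R)) ^ j)) (fun j => ?_)
    (fun j => ?_) (Eventually.of_forall fun _ => hsum) (integrable_const _)
    (Eventually.of_forall fun z => ?_)
  · have h1 := continuous_gaussPow t (p + j)
    have h2 := continuous_gaussPow t (q + j)
    exact Continuous.aestronglyMeasurable (by fun_prop)
  · filter_upwards [hae] with z hz
    rw [conj_gaussPow_mul]
    have hexp : ‖Complex.exp (-(((‖z.1‖ ^ 2 + ‖z.2‖ ^ 2 : ℝ) : ℂ) / 2 * t))‖ ≤ 1 := by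
      rw [Complex.norm_exp, Real.exp_le_one_iff, Complex.neg_re, neg_nonpos]
      have : ((((‖z.1‖ ^ 2 + ‖z.2‖ ^ 2 : ℝ) : ℂ) / 2 * t)).re =
          (‖z.1‖ ^ 2 + ‖z.2‖ ^ 2) / 2 * t := by
        rw [← Complex.ofReal_ofNat, ← Complex.ofReal_div, ← Complex.ofReal_mul, Complex.ofReal_re]
      rw [this]
      positivity
    have e : R ^ p * R ^ q * ((j.factorial : ℝ)⁻¹ * (t * (R * R)) ^ j) =
        ((j.factorial : ℝ)⁻¹ * t ^ j) * (R ^ (p + j) * R ^ (q + j) * 1) := by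
      rw [mul_pow, mul_pow]
      ring
    rw [e, norm_mul, norm_mul, norm_mul, norm_mul, norm_inv, Complex.norm_natCast, norm_pow,
      norm_pow, norm_pow, RCLike.norm_conj, Complex.norm_real, Real.norm_of_nonneg ht]
    have h1 := hz.1
    have h2 := hz.2
    gcongr
  · have h := (hasSum_exp_series (t * (conj z.1 * z.2))).mul_left
      (conj z.1 ^ p * z.2 ^ q * Complex.exp (-(((‖z.1‖ ^ 2 + ‖z.2‖ ^ 2 : ℝ) : ℂ) / 2 * t)))
    have e : conj z.1 ^ p * z.2 ^ q * gaussKernel t z.1 z.2 =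
        conj z.1 ^ p * z.2 ^ q * Complex.exp (-(((‖z.1‖ ^ 2 + ‖z.2‖ ^ 2 : ℝ) : ℂ) / 2 * t)) *
          Complex.exp (t * (conj z.1 * z.2)) := by
      rw [mul_assoc _ (Complex.exp _), ← Complex.exp_add, gaussKernel]
      congr 2
      ring
    rw [e]
    refine h.congr_fun fun j => ?_
    rw [conj_gaussPow_mul, mul_pow, mul_pow]
    ring

theorem gaussOp_isSelfAdjoint (t : ℝ) : ContinuousLinearMap.adjoint (gaussOp B t) = gaussOp B t := by
  rw [← ContinuousLinearMap.star_eq_adjoint, gaussOp, NormedSpace.star_exp]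
  congr 1
  rw [star_smul, star_mul, ← ContinuousLinearMap.star_eq_adjoint, star_star]
  simp

theorem commute_adjoint_mul_self (hB : IsStarNormal B) :
    Commute B (ContinuousLinearMap.adjoint B * B) ∧
      Commute (ContinuousLinearMap.adjoint B) (ContinuousLinearMap.adjoint B * B) := by
  have h : Commute (ContinuousLinearMap.adjoint B) B := hB.star_comm_self
  exact ⟨h.symm.mul_right (Commute.refl B), (Commute.refl _).mul_right h⟩

theorem commute_gaussOp (t : ℝ) {X : S →L[ℂ] S}
    (h : Commute X (ContinuousLinearMap.adjoint B * B)) : Commute X (gaussOp B t) :=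
  (h.smul_right _).exp_right

theorem exp_mul_gaussOp_sq (t : ℝ) :
    NormedSpace.exp ((t : ℂ) • (ContinuousLinearMap.adjoint B * B)) *
      (gaussOp B t * gaussOp B t) = 1 := by
  let : NormedAlgebra ℚ (S →L[ℂ] S) := NormedAlgebra.restrictScalars ℚ ℂ _
  have hc : ∀ a b : ℂ, Commute (a • (ContinuousLinearMap.adjoint B * B))
      (b • (ContinuousLinearMap.adjoint B * B)) := fun a b =>
    ((Commute.refl _).smul_left a).smul_right b
  rw [gaussOp, ← NormedSpace.exp_add_of_commute (hc _ _), ← add_smul,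
    ← NormedSpace.exp_add_of_commute (hc _ _), ← add_smul]
  have : (t : ℂ) + (-((t / 2 : ℝ) : ℂ) + -((t / 2 : ℝ) : ℂ)) = 0 := by
    push_cast
    ring
  rw [this, zero_smul, NormedSpace.exp_zero]

/-- For the identity the sum is found by operator algebra. Since `B` is normal, all factors commute
past each other, and the series `∑ t^j (B*B)^j / j!` is `exp(t B*B)`, which cancels the two Gaussian
operators. -/
theorem hasSum_inner_gaussOp_self (hB : IsStarNormal B) (t : ℝ) (ψ φ : S) (p q : ℕ) :
    HasSum (fun j : ℕ => (j.factorial : ℂ)⁻¹ * (t : ℂ) ^ j *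
        ⟪gaussOp B t ((B ^ (p + j)) ψ), gaussOp B t ((B ^ (q + j)) φ)⟫_ℂ)
      ⟪(ContinuousLinearMap.adjoint B ^ q) ψ, (ContinuousLinearMap.adjoint B ^ p) φ⟫_ℂ := by
  set D := ContinuousLinearMap.adjoint B with hD
  set N := gaussOp B t with hN
  have cBD : Commute B D := (show Commute D B from hB.star_comm_self).symm
  have cB := (commute_adjoint_mul_self hB).1
  have cD := (commute_adjoint_mul_self hB).2
  have hadj : ∀ (k : ℕ) (x y : S), ⟪(B ^ k) x, y⟫_ℂ = ⟪x, (D ^ k) y⟫_ℂ := by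
    intro k x y
    induction k generalizing x with
    | zero => rfl
    | succ k ih =>
      rw [pow_succ, pow_succ', mul_apply_eq_comp, mul_apply_eq_comp, ih, hD,
        ContinuousLinearMap.adjoint_inner_right]
  have hadj' : ∀ (k : ℕ) (x y : S), ⟪x, (B ^ k) y⟫_ℂ = ⟪(D ^ k) x, y⟫_ℂ := by
    intro k x y
    rw [← inner_conj_symm, hadj, inner_conj_symm]
  -- The factors depending on `j` are collected in the middle, and `B ^ q` is brought to the far
  -- left so that it can cross the inner product onto `ψ`.
  have hop : ∀ j : ℕ, D ^ (p + j) * (N * (N * B ^ (q + j))) =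
      B ^ q * (((D * B) ^ j * (N * N)) * D ^ p) := by
    intro j
    have c1 : Commute (N * N) (B ^ (q + j)) :=
      (((commute_gaussOp t cB).mul_right (commute_gaussOp t cB)).pow_left _).symm
    have c2 : Commute (D ^ p) (N * N) :=
      ((commute_gaussOp t cD).mul_right (commute_gaussOp t cD)).pow_left _
    have c3 : Commute (D ^ (p + j)) (B ^ (q + j)) := cBD.symm.pow_pow _ _
    have c4 : Commute D B := cBD.symm
    rw [← mul_assoc N, c1.eq, ← mul_assoc, c3.eq, pow_add B, pow_add D, mul_assoc ((D * B) ^ j),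
      ← c2.eq, c4.mul_pow, (cBD.symm.pow_pow j j).eq, (Commute.pow_pow (Commute.refl D) p j).eq]
    simp only [mul_assoc]
  have hinner : ∀ j : ℕ, ⟪N ((B ^ (p + j)) ψ), N ((B ^ (q + j)) φ)⟫_ℂ =
      ⟪(D ^ q) ψ, ((D * B) ^ j * (N * N)) ((D ^ p) φ)⟫_ℂ := by
    intro j
    have h1 : ⟪N ((B ^ (p + j)) ψ), N ((B ^ (q + j)) φ)⟫_ℂ =
        ⟪(B ^ (p + j)) ψ, N (N ((B ^ (q + j)) φ))⟫_ℂ := by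
      conv_rhs => rw [← ContinuousLinearMap.adjoint_inner_left, hN, gaussOp_isSelfAdjoint]
    rw [h1, hadj, ← hadj']
    exact congrArg (fun X : S →L[ℂ] S => ⟪ψ, X φ⟫_ℂ) (hop j)
  have hexp := NormedSpace.exp_series_hasSum_exp' (𝕂 := ℂ) ((t : ℂ) • (D * B))
  have h2 := (hexp.mul_right (N * N)).mapL
    ((innerSL ℂ ((D ^ q) ψ)).comp (ContinuousLinearMap.apply ℂ S ((D ^ p) φ)))
  rw [exp_mul_gaussOp_sq] at h2
  refine HasSum.congr_fun h2 fun j => ?_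
  rw [hinner, smul_pow, smul_smul, smul_mul_assoc, map_smul]
  rfl

end GaussianCalculus

/-- Inner products of partial sums are sums over squares. Squares are cofinal among finite index
sets, so they compute the unconditional double sum. -/
theorem tendsto_range_product_range :
    Tendsto (fun n : ℕ => Finset.range n ×ˢ Finset.range n) atTop
      (atTop : Filter (Finset (ℕ × ℕ))) := by
  have h : Tendsto (fun n : ℕ => (Finset.range n, Finset.range n)) atTop
      (atTop ×ˢ atTop) := tendsto_finset_range.prodMk tendsto_finset_range
  rw [Filter.prod_atTop_atTop_eq] at h
  exact Tendsto.comp (g := fun p : Finset ℕ × Finset ℕ => p.1 ×ˢ p.2) tendsto_finsetProd_atTop h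

/-! ### The regularized form for a Hilbert space vector -/

section RegularForm

variable {S T h : Type*} [NormedAddCommGroup S] [InnerProductSpace ℂ S] [CompleteSpace S]
  [AddCommGroup T] [Module ℂ T] [TopologicalSpace T]
  [NormedAddCommGroup h] [InnerProductSpace ℂ h]
  (G : GelfandTriple T h) (B : S →L[ℂ] S) (x : h)

theorem emb_equivTest_symm (u : G.test) : G.emb (G.equivTest.symm u) = u := by
  obtain ⟨f, rfl⟩ := G.equivTest.surjective u
  rw [LinearEquiv.symm_apply_apply]
  rfl

theorem bracket_ofHilbert :
    G.bracket (G.ofHilbert x) = (innerSL ℂ x : h →ₗ[ℂ] ℂ) ∘ₗ G.test.subtype := by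
  ext u
  change conj ⟪G.emb (G.equivTest.symm u), x⟫_ℂ = ⟪x, (u : h)⟫_ℂ
  rw [emb_equivTest_symm, inner_conj_symm]

theorem annihilate_pow_fockMap_test (k : ℕ) (Ξ : FockFin G.test) :
    (annihilate (innerSL ℂ x : h →ₗ[ℂ] ℂ) ^ k) (fockMap G.test.subtype Ξ) =
      fockMap G.test.subtype ((G.annih (G.ofHilbert x) ^ k) Ξ) := by
  rw [annihilate_pow_fockMap, ← bracket_ofHilbert]
  rfl

theorem inner_fockMap_test (Ξ Θ : FockFin G.test) :
    ⟪fockMap G.test.subtype Ξ, fockMap G.test.subtype Θ⟫_ℂ = ⟪Ξ, Θ⟫_ℂ :=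
  inner_fockMap (fun _ _ => rfl) Ξ Θ

variable (h) in
theorem ampliation_coe_tmul (X : S →L[ℂ] S) (ψ : S) (Ξ : FockFin h) :
    ampliation h X ((ψ ⊗ₜ[ℂ] Ξ : S ⊗[ℂ] FockFin h) : SpinFock S h) =
      ((X ψ ⊗ₜ[ℂ] Ξ : S ⊗[ℂ] FockFin h) : SpinFock S h) :=
  ContinuousLinearMap.completion_apply_coe _ _

variable (h) in
theorem norm_ampliation_apply_le (X : S →L[ℂ] S) (z : SpinFock S h) :
    ‖ampliation h X z‖ ≤ ‖X‖ * ‖z‖ := by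
  induction z using UniformSpace.Completion.induction_on with
  | hp => exact isClosed_le (by fun_prop) (by fun_prop)
  | ih z =>
    rw [ampliation, ContinuousLinearMap.completion_apply_coe, UniformSpace.Completion.norm_coe,
      UniformSpace.Completion.norm_coe]
    exact (ContinuousLinearMap.le_opNorm _ _).trans
      (mul_le_mul_of_nonneg_right (ContinuousLinearMap.norm_rTensor_le _ X) (norm_nonneg _))

variable (h) in
theorem ampliation_one (z : SpinFock S h) : ampliation h (1 : S →L[ℂ] S) z = z := by
  induction z using UniformSpace.Completion.induction_on with
  | hp => exact isClosed_eq (by fun_prop) (by fun_prop)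
  | ih z =>
    rw [ampliation, ContinuousLinearMap.completion_apply_coe, ContinuousLinearMap.rTensor_one]
    rfl

variable (h) in
theorem inner_ampliation_left (X : S →L[ℂ] S) (y z : SpinFock S h) :
    ⟪ampliation h X y, z⟫_ℂ = ⟪y, ampliation h (ContinuousLinearMap.adjoint X) z⟫_ℂ := by
  induction y, z using UniformSpace.Completion.induction_on₂ with
  | hp => exact isClosed_eq (by fun_prop) (by fun_prop)
  | ih y z =>
    rw [ampliation, ampliation, ContinuousLinearMap.completion_apply_coe,
      ContinuousLinearMap.completion_apply_coe, UniformSpace.Completion.inner_coe,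
      UniformSpace.Completion.inner_coe]
    induction y using TensorProduct.induction_on with
    | zero => simp
    | add y y' hy hy' => rw [map_add, inner_add_left, inner_add_left, hy, hy']
    | tmul s m =>
      induction z using TensorProduct.induction_on with
      | zero => simp
      | add y y' hy hy' => rw [map_add, inner_add_right, inner_add_right, hy, hy']
      | tmul s' m' =>
        rw [ContinuousLinearMap.rTensor_tmul, ContinuousLinearMap.rTensor_tmul,
          TensorProduct.inner_tmul, TensorProduct.inner_tmul,
          ContinuousLinearMap.adjoint_inner_right]

/-- The terms of the exponential series of `B ⊗ a†(x)`. -/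
def dressingTerm (k : ℕ) (Ψ : S ⊗[ℂ] FockFin G.test) : SpinFock S h :=
  ((k.factorial : ℂ))⁻¹ • ((((TensorProduct.map (B : S →ₗ[ℂ] S) (create x)) ^ k)
    (LinearMap.lTensor S (fockMap G.test.subtype) Ψ) : S ⊗[ℂ] FockFin h) : SpinFock S h)

theorem dressingTerm_add (k : ℕ) (Ψ Φ : S ⊗[ℂ] FockFin G.test) :
    dressingTerm G B x k (Ψ + Φ) = dressingTerm G B x k Ψ + dressingTerm G B x k Φ := by
  rw [dressingTerm, map_add, map_add, UniformSpace.Completion.coe_add, smul_add]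
  rfl

theorem dressingTerm_smul (k : ℕ) (c : ℂ) (Ψ : S ⊗[ℂ] FockFin G.test) :
    dressingTerm G B x k (c • Ψ) = c • dressingTerm G B x k Ψ := by
  rw [dressingTerm, map_smul, map_smul, UniformSpace.Completion.coe_smul, smul_comm]
  rfl

theorem dressingTerm_tmul (k : ℕ) (ψ : S) (Ξ : FockFin G.test) :
    dressingTerm G B x k (ψ ⊗ₜ[ℂ] Ξ) = ((k.factorial : ℂ))⁻¹ •
      ((((B ^ k) ψ) ⊗ₜ[ℂ] ((create x ^ k) (fockMap G.test.subtype Ξ)) : S ⊗[ℂ] FockFin h) :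
        SpinFock S h) := by
  have hB : ∀ ψ : S, ((B : S →ₗ[ℂ] S) ^ k) ψ = (B ^ k) ψ := by
    intro ψ
    induction k generalizing ψ with
    | zero => rfl
    | succ k ih =>
      rw [pow_succ, pow_succ, Module.End.mul_apply, ih]
      rfl
  rw [dressingTerm, LinearMap.lTensor_tmul, TensorProduct.map_pow, TensorProduct.map_tmul, hB]

/-- On pure tensors `‖B ^ k ψ‖ ≤ ‖B‖ ^ k ‖ψ‖`, and `summable_norm_create_pow` applies with `r =
‖B‖`. -/
theorem summable_dressingTerm (Ψ : S ⊗[ℂ] FockFin G.test) :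
    Summable fun k => dressingTerm G B x k Ψ := by
  induction Ψ using TensorProduct.induction_on with
  | zero => 
    refine summable_zero.congr fun k => ?_
    rw [← zero_smul ℂ (0 : S ⊗[ℂ] FockFin G.test), dressingTerm_smul, zero_smul]
  | add Ψ Φ hΨ hΦ => exact (hΨ.add hΦ).congr fun k => (dressingTerm_add G B x k Ψ Φ).symm
  | tmul ψ Ξ =>
    refine Summable.of_norm_bounded ((summable_norm_create_pow x (fockMap G.test.subtype Ξ)
      (norm_nonneg B)).mul_left ‖ψ‖) fun k => ?_
    rw [dressingTerm_tmul, norm_smul, UniformSpace.Completion.norm_coe, TensorProduct.norm_tmul,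
      norm_inv, Complex.norm_natCast]
    have h1 : ‖(B ^ k) ψ‖ ≤ ‖B‖ ^ k * ‖ψ‖ := by
      induction k with
      | zero => simp
      | succ k ih =>
        rw [pow_succ', mul_apply_eq_comp, pow_succ', mul_assoc]
        exact (B.le_opNorm _).trans (mul_le_mul_of_nonneg_left ih (norm_nonneg B))
    calc _ ≤ ((k.factorial : ℝ))⁻¹ * ((‖B‖ ^ k * ‖ψ‖) *
          ‖(create x ^ k) (fockMap G.test.subtype Ξ)‖) := by gcongr
      _ = _ := by ring

theorem hasSum_regularDressing (Ψ : S ⊗[ℂ] FockFin G.test) :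
    HasSum (fun k => ampliation h (gaussOp B (‖x‖ ^ 2)) (dressingTerm G B x k Ψ))
      (regularDressing G B x Ψ) :=
  (summable_dressingTerm G B x Ψ).hasSum.mapL (ampliation h (gaussOp B (‖x‖ ^ 2)))

theorem regularDressing_add (Ψ Φ : S ⊗[ℂ] FockFin G.test) :
    regularDressing G B x (Ψ + Φ) = regularDressing G B x Ψ + regularDressing G B x Φ := by
  refine (hasSum_regularDressing G B x _).unique ?_
  refine ((hasSum_regularDressing G B x Ψ).add (hasSum_regularDressing G B x Φ)).congr_fun
    fun k => ?_
  rw [dressingTerm_add, map_add]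

theorem regularDressing_smul (c : ℂ) (Ψ : S ⊗[ℂ] FockFin G.test) :
    regularDressing G B x (c • Ψ) = c • regularDressing G B x Ψ := by
  refine (hasSum_regularDressing G B x _).unique ?_
  refine ((hasSum_regularDressing G B x Ψ).const_smul c).congr_fun fun k => ?_
  rw [dressingTerm_smul, map_smul]

theorem tendsto_regularSpinForm_partial (A : S →L[ℂ] S) (Ψ Φ : S ⊗[ℂ] FockFin G.test) :
    Tendsto (fun n => ∑ z ∈ Finset.range n ×ˢ Finset.range n,
      ⟪ampliation h (gaussOp B (‖x‖ ^ 2)) (dressingTerm G B x z.1 Ψ),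
        ampliation h A (ampliation h (gaussOp B (‖x‖ ^ 2)) (dressingTerm G B x z.2 Φ))⟫_ℂ) atTop
      (𝓝 (regularSpinForm G B A x Ψ Φ)) := by
  have h1 := (hasSum_regularDressing G B x Ψ).tendsto_sum_nat
  have h2 := ((hasSum_regularDressing G B x Φ).mapL (ampliation h A)).tendsto_sum_nat
  refine (h1.inner h2 (𝕜 := ℂ)).congr fun n => ?_
  rw [sum_inner, Finset.sum_product]
  refine Finset.sum_congr rfl fun k _ => ?_
  rw [inner_sum]

theorem ampliation_dressingTerm_tmul (X : S →L[ℂ] S) (k : ℕ) (ψ : S) (Ξ : FockFin G.test) :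
    ampliation h X (dressingTerm G B x k (ψ ⊗ₜ[ℂ] Ξ)) = ((k.factorial : ℂ))⁻¹ •
      (((X ((B ^ k) ψ)) ⊗ₜ[ℂ] ((create x ^ k) (fockMap G.test.subtype Ξ)) : S ⊗[ℂ] FockFin h) :
        SpinFock S h) := by
  rw [dressingTerm_tmul, map_smul, ampliation_coe_tmul]

theorem inner_smul_coe_tmul (c d : ℂ) (ψ φ : S) (Ξ Θ : FockFin h) :
    ⟪c • ((ψ ⊗ₜ[ℂ] Ξ : S ⊗[ℂ] FockFin h) : SpinFock S h),
      d • ((φ ⊗ₜ[ℂ] Θ : S ⊗[ℂ] FockFin h) : SpinFock S h)⟫_ℂ =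
      conj c * (d * (⟪ψ, φ⟫_ℂ * ⟪Ξ, Θ⟫_ℂ)) := by
  rw [inner_smul_left, inner_smul_right, UniformSpace.Completion.inner_coe,
    TensorProduct.inner_tmul]

theorem inner_dressingTerm_tmul (A : S →L[ℂ] S) (t : ℝ) (ψ φ : S) (Ξ Θ : FockFin G.test) (k l : ℕ) :
    ⟪ampliation h (gaussOp B t) (dressingTerm G B x k (ψ ⊗ₜ[ℂ] Ξ)),
        ampliation h A (ampliation h (gaussOp B t) (dressingTerm G B x l (φ ⊗ₜ[ℂ] Θ)))⟫_ℂ =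
      ⟪gaussOp B t ((B ^ k) ψ), A (gaussOp B t ((B ^ l) φ))⟫_ℂ *
        (((k.factorial : ℂ) * l.factorial)⁻¹ *
          ⟪(create x ^ k) (fockMap G.test.subtype Ξ), (create x ^ l) (fockMap G.test.subtype Θ)⟫_ℂ)
      := by
  rw [ampliation_dressingTerm_tmul, ampliation_dressingTerm_tmul, map_smul, ampliation_coe_tmul,
    inner_smul_coe_tmul, map_inv₀, Complex.conj_natCast, mul_inv]
  ring

/-- The limit of the partial sums over squares is also the unconditional double sum, which collapses
to finitely many pairs `(p, q)`. Only the spin-side sums `s p q` depend on `A`. -/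
theorem regularSpinForm_tmul (A : S →L[ℂ] S) (ψ φ : S) (Ξ Θ : FockFin G.test) {K : ℕ}
    (hΞ : (G.annih (G.ofHilbert x) ^ K) Ξ = 0) (hΘ : (G.annih (G.ofHilbert x) ^ K) Θ = 0)
    {s : ℕ → ℕ → ℂ} (hs : ∀ p q, HasSum (fun j : ℕ => (j.factorial : ℂ)⁻¹ *
      ((‖x‖ ^ 2 : ℝ) : ℂ) ^ j * ⟪gaussOp B (‖x‖ ^ 2) ((B ^ (p + j)) ψ),
        A (gaussOp B (‖x‖ ^ 2) ((B ^ (q + j)) φ))⟫_ℂ) (s p q)) :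
    regularSpinForm G B A x (ψ ⊗ₜ[ℂ] Ξ) (φ ⊗ₜ[ℂ] Θ) =
      ∑ p ∈ Finset.range K, ∑ q ∈ Finset.range K, s p q * (((p.factorial : ℂ) * q.factorial)⁻¹ *
        ⟪(G.annih (G.ofHilbert x) ^ q) Ξ, (G.annih (G.ofHilbert x) ^ p) Θ⟫_ℂ) := by
  have h1 := hasSum_inner_create_pow x (fockMap G.test.subtype Ξ) (fockMap G.test.subtype Θ)
    (K := K) (by rw [annihilate_pow_fockMap_test, hΞ, map_zero])
    (by rw [annihilate_pow_fockMap_test, hΘ, map_zero])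
    (u := fun k l => ⟪gaussOp B (‖x‖ ^ 2) ((B ^ k) ψ), A (gaussOp B (‖x‖ ^ 2) ((B ^ l) φ))⟫_ℂ) hs
  have h3 := (Filter.Tendsto.comp h1 tendsto_range_product_range).congr fun n =>
    Finset.sum_congr rfl fun z _ => (inner_dressingTerm_tmul G B x A (‖x‖ ^ 2) ψ φ Ξ Θ z.1 z.2).symm
  refine (tendsto_nhds_unique (tendsto_regularSpinForm_partial G B x A _ _) h3).trans ?_
  refine Finset.sum_congr rfl fun p _ => Finset.sum_congr rfl fun q _ => ?_
  rw [annihilate_pow_fockMap_test, annihilate_pow_fockMap_test, inner_fockMap_test]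

theorem regularSpinForm_add_left (A : S →L[ℂ] S) (Ψ Ψ' Φ : S ⊗[ℂ] FockFin G.test) :
    regularSpinForm G B A x (Ψ + Ψ') Φ =
      regularSpinForm G B A x Ψ Φ + regularSpinForm G B A x Ψ' Φ := by
  rw [regularSpinForm, regularDressing_add, inner_add_left]
  rfl

theorem regularSpinForm_add_right (A : S →L[ℂ] S) (Ψ Φ Φ' : S ⊗[ℂ] FockFin G.test) :
    regularSpinForm G B A x Ψ (Φ + Φ') =
      regularSpinForm G B A x Ψ Φ + regularSpinForm G B A x Ψ Φ' := by
  rw [regularSpinForm, regularDressing_add, map_add, inner_add_right]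
  rfl

theorem regularSpinForm_smul_left (A : S →L[ℂ] S) (c : ℂ) (Ψ Φ : S ⊗[ℂ] FockFin G.test) :
    regularSpinForm G B A x (c • Ψ) Φ = conj c * regularSpinForm G B A x Ψ Φ := by
  rw [regularSpinForm, regularDressing_smul, inner_smul_left]
  rfl

theorem regularSpinForm_smul_right (A : S →L[ℂ] S) (c : ℂ) (Ψ Φ : S ⊗[ℂ] FockFin G.test) :
    regularSpinForm G B A x Ψ (c • Φ) = c * regularSpinForm G B A x Ψ Φ := by
  rw [regularSpinForm, regularDressing_smul, map_smul, inner_smul_right]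
  rfl

theorem regularSpinForm_conj {A : S →L[ℂ] S} (hA : IsSelfAdjoint A)
    (Ψ Φ : S ⊗[ℂ] FockFin G.test) :
    conj (regularSpinForm G B A x Φ Ψ) = regularSpinForm G B A x Ψ Φ := by
  have hA' : ContinuousLinearMap.adjoint A = A := hA
  rw [regularSpinForm, regularSpinForm, inner_conj_symm, inner_ampliation_left, hA']

theorem norm_regularSpinForm_le (A : S →L[ℂ] S) (Ψ Φ : S ⊗[ℂ] FockFin G.test) :
    ‖regularSpinForm G B A x Ψ Φ‖ ≤
      ‖A‖ * ‖regularDressing G B x Ψ‖ * ‖regularDressing G B x Φ‖ := by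
  calc _ ≤ ‖regularDressing G B x Ψ‖ * ‖ampliation h A (regularDressing G B x Φ)‖ :=
        norm_inner_le_norm _ _
    _ ≤ ‖regularDressing G B x Ψ‖ * (‖A‖ * ‖regularDressing G B x Φ‖) := by
        gcongr
        exact norm_ampliation_apply_le h A _
    _ = _ := by ring

theorem regularSpinForm_one_self (Ψ : S ⊗[ℂ] FockFin G.test) :
    regularSpinForm G B 1 x Ψ Ψ = ((‖regularDressing G B x Ψ‖ ^ 2 : ℝ) : ℂ) := by
  rw [regularSpinForm, ampliation_one, inner_self_eq_norm_sq_to_K]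
  norm_cast

end RegularForm

/-! ### Finite expansions of the singular exponentials -/

section NilpotentExponential

theorem expNilpotent_eq_sum {M : Type*} [AddCommGroup M] [Module ℂ M] {N : M →ₗ[ℂ] M}
    (hN : ∀ x, ∃ K, (N ^ K) x = 0) {x : M} {K : ℕ} (hK : (N ^ K) x = 0) :
    expNilpotent N hN x = ∑ k ∈ Finset.range K, ((k.factorial : ℂ))⁻¹ • (N ^ k) x := by
  refine finsum_eq_sum_of_support_subset _ fun k hk => ?_
  by_contra hlt
  refine hk ?_
  change ((k.factorial : ℂ))⁻¹ • (N ^ k) x = 0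
  rw [pow_apply_eq_zero_of_le hK (by simpa using hlt), smul_zero]

variable {S T h : Type*} [NormedAddCommGroup S] [InnerProductSpace ℂ S] [CompleteSpace S]
  [AddCommGroup T] [Module ℂ T] [TopologicalSpace T]
  [NormedAddCommGroup h] [InnerProductSpace ℂ h]
  (G : GelfandTriple T h) (B : S →L[ℂ] S) (g : AntiDual T)

theorem expAnnih_eq_sum (c : ℂ) {Ξ : FockFin G.test} {K : ℕ} (hK : (G.annih g ^ K) Ξ = 0) :
    G.expAnnih c g Ξ =
      ∑ k ∈ Finset.range K, (c ^ k * ((k.factorial : ℂ))⁻¹) • (G.annih g ^ k) Ξ := by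
  refine (expNilpotent_eq_sum (N := c • G.annih g) _ (K := K) ?_).trans ?_
  rotate_left
  · refine Finset.sum_congr rfl fun k _ => ?_
    rw [smul_pow, LinearMap.smul_apply, smul_smul, mul_comm]
  · rw [smul_pow, LinearMap.smul_apply, hK, smul_zero]

theorem inner_expAnnih (c d : ℂ) {Ξ Θ : FockFin G.test} {K : ℕ} (hΞ : (G.annih g ^ K) Ξ = 0)
    (hΘ : (G.annih g ^ K) Θ = 0) :
    ⟪G.expAnnih (conj d) g Ξ, G.expAnnih c g Θ⟫_ℂ =
      ∑ p ∈ Finset.range K, ∑ q ∈ Finset.range K, (((p.factorial : ℂ) * q.factorial)⁻¹ *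
        ⟪(G.annih g ^ q) Ξ, (G.annih g ^ p) Θ⟫_ℂ) * (c ^ p * d ^ q) := by
  rw [expAnnih_eq_sum G g _ hΞ, expAnnih_eq_sum G g _ hΘ, inner_sum]
  refine Finset.sum_congr rfl fun p _ => ?_
  rw [sum_inner]
  refine Finset.sum_congr rfl fun q _ => ?_
  rw [inner_smul_left, inner_smul_right, map_mul, map_pow, Complex.conj_conj, map_inv₀,
    Complex.conj_natCast, mul_inv]
  ring

theorem dressing_tmul (ψ : S) {Ξ : FockFin G.test} {K : ℕ} (hK : (G.annih g ^ K) Ξ = 0) :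
    dressing G B g (ψ ⊗ₜ[ℂ] Ξ) = ∑ k ∈ Finset.range K, ((k.factorial : ℂ))⁻¹ •
      ((ContinuousLinearMap.adjoint B ^ k) ψ ⊗ₜ[ℂ] (G.annih g ^ k) Ξ) := by
  have hB : ∀ (k : ℕ) (ψ : S), ((ContinuousLinearMap.adjoint B : S →ₗ[ℂ] S) ^ k) ψ =
      (ContinuousLinearMap.adjoint B ^ k) ψ := by
    intro k ψ
    induction k generalizing ψ with
    | zero => rfl
    | succ k ih =>
      rw [pow_succ, pow_succ, Module.End.mul_apply, ih]
      rfl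
  refine (expNilpotent_eq_sum (M := S ⊗[ℂ] FockFin G.test)
    (N := TensorProduct.map (ContinuousLinearMap.adjoint B : S →ₗ[ℂ] S) (G.annih g)) _ (K := K)
      ?_).trans ?_
  rotate_left
  · refine Finset.sum_congr rfl fun k _ => ?_
    rw [TensorProduct.map_pow, TensorProduct.map_tmul, hB]
  · rw [TensorProduct.map_pow, TensorProduct.map_tmul, hK, TensorProduct.tmul_zero]

theorem inner_smul_tmul {M : Type*} [NormedAddCommGroup M] [InnerProductSpace ℂ M] (c d : ℂ)
    (ψ φ : S) (Ξ Θ : M) :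
    ⟪c • (ψ ⊗ₜ[ℂ] Ξ), d • (φ ⊗ₜ[ℂ] Θ)⟫_ℂ = conj c * (d * (⟪ψ, φ⟫_ℂ * ⟪Ξ, Θ⟫_ℂ)) := by
  rw [TensorProduct.smul_tmul', TensorProduct.smul_tmul', TensorProduct.inner_tmul,
    inner_smul_left, inner_smul_right]
  ring

/-- This has the shape of `regularSpinForm_tmul`, with exactly the sums of
`hasSum_inner_gaussOp_self`; comparing the two identifies the renormalized inner product as a limit.
-/
theorem inner_dressing_tmul (ψ φ : S) {Ξ Θ : FockFin G.test} {K : ℕ}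
    (hΞ : (G.annih g ^ K) Ξ = 0) (hΘ : (G.annih g ^ K) Θ = 0) :
    ⟪dressing G B g (ψ ⊗ₜ[ℂ] Ξ), dressing G B g (φ ⊗ₜ[ℂ] Θ)⟫_ℂ =
      ∑ p ∈ Finset.range K, ∑ q ∈ Finset.range K,
        ⟪(ContinuousLinearMap.adjoint B ^ q) ψ, (ContinuousLinearMap.adjoint B ^ p) φ⟫_ℂ *
          (((p.factorial : ℂ) * q.factorial)⁻¹ * ⟪(G.annih g ^ q) Ξ, (G.annih g ^ p) Θ⟫_ℂ) := by
  rw [dressing_tmul G B g ψ hΞ, dressing_tmul G B g φ hΘ, inner_sum]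
  refine Finset.sum_congr rfl fun p _ => ?_
  rw [sum_inner]
  refine Finset.sum_congr rfl fun q _ => ?_
  refine (inner_smul_tmul _ _ _ _ _ _).trans ?_
  rw [map_inv₀, Complex.conj_natCast, mul_inv]
  ring

end NilpotentExponential

/-! ### Continuity of annihilation in its functional -/

section Annihilation

variable {V : Type u} [NormedAddCommGroup V] [InnerProductSpace ℂ V]

theorem annihilateFull_pow_sector (ℓ : V →ₗ[ℂ] ℂ) (n : ℕ) (x : TP V n) :
    (annihilateFull ℓ ^ (n + 1)) (sector n x) = 0 := by
  induction n with
  | zero => rw [pow_one, annihilateFull_zero]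
  | succ n ih => rw [pow_succ, Module.End.mul_apply, annihilateFull_succ, map_smul, ih, smul_zero]

/-- Each application lowers the particle number, whatever the functional. A uniform `K` keeps the
number of summands fixed along an approximating net. -/
theorem exists_annihilateFull_pow_eq_zero (x : FullFin V) :
    ∃ K, ∀ ℓ : V →ₗ[ℂ] ℂ, (annihilateFull ℓ ^ K) x = 0 := by
  induction x using sector_induction with
  | zero => exact ⟨0, fun ℓ => map_zero _⟩
  | sector n x => exact ⟨n + 1, fun ℓ => annihilateFull_pow_sector ℓ n x⟩
  | add x y hx hy =>
    obtain ⟨K, hK⟩ := hx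
    obtain ⟨J, hJ⟩ := hy
    refine ⟨max K J, fun ℓ => ?_⟩
    rw [map_add, pow_apply_eq_zero_of_le (hK ℓ) (le_max_left _ _),
      pow_apply_eq_zero_of_le (hJ ℓ) (le_max_right _ _), add_zero]

/-- Finite-particle vectors are killed by a power of the annihilation operator that does not depend
on the functional. -/
theorem exists_annihilate_pow_eq_zero_forall (x y : FockFin V) :
    ∃ K, ∀ ℓ : V →ₗ[ℂ] ℂ, (annihilate ℓ ^ K) x = 0 ∧ (annihilate ℓ ^ K) y = 0 := by
  obtain ⟨K, hK⟩ := exists_annihilateFull_pow_eq_zero (toFull x)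
  obtain ⟨J, hJ⟩ := exists_annihilateFull_pow_eq_zero (toFull y)
  refine ⟨max K J, fun ℓ => ⟨?_, ?_⟩⟩
  · refine pow_apply_eq_zero_of_le (K := K) (toFull_injective ?_) (le_max_left _ _)
    rw [toFull_annihilate_pow, hK, map_zero]
  · refine pow_apply_eq_zero_of_le (K := J) (toFull_injective ?_) (le_max_right _ _)
    rw [toFull_annihilate_pow, hJ, map_zero]

variable {ι : Type*}

/-- Convergence of a family of vectors within a finite-dimensional subspace. -/
inductive FiniteTendsto {M : Type*} [AddCommGroup M] [Module ℂ M] (l : Filter ι) :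
    (ι → M) → M → Prop
  | smul {c : ι → ℂ} {d : ℂ} (hc : Tendsto c l (𝓝 d)) (e : M) :
      FiniteTendsto l (fun i => c i • e) (d • e)
  | add {y z : ι → M} {v w : M} (hy : FiniteTendsto l y v) (hz : FiniteTendsto l z w) :
      FiniteTendsto l (fun i => y i + z i) (v + w)

namespace FiniteTendsto

variable {M N : Type*} {l : Filter ι}

theorem const [AddCommGroup M] [Module ℂ M] (e : M) :
    FiniteTendsto l (fun _ : ι => e) e := by
  simpa using FiniteTendsto.smul (l := l) (tendsto_const_nhds (x := (1 : ℂ))) e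

theorem const_smul [AddCommGroup M] [Module ℂ M] {c : ι → ℂ} {d : ℂ} (hc : Tendsto c l (𝓝 d))
    {y : ι → M} {v : M} (hy : FiniteTendsto l y v) :
    FiniteTendsto l (fun i => c i • y i) (d • v) := by
  induction hy with
  | smul hb e => simpa only [smul_smul] using FiniteTendsto.smul (hc.mul hb) e
  | add _ _ hy hz => simpa only [smul_add] using hy.add hz

/-- Norm convergence of `y` would not suffice, as the operators need not be continuous. With
finitely many fixed vectors and convergent scalars, pointwise convergence of the operators is
enough, and the argument can be iterated for powers. -/
theorem map [AddCommGroup M] [Module ℂ M] [AddCommGroup N] [Module ℂ N] {L : ι → M →ₗ[ℂ] N}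
    {L₀ : M →ₗ[ℂ] N} (hL : ∀ e, FiniteTendsto l (fun i => L i e) (L₀ e)) {y : ι → M} {v : M}
    (hy : FiniteTendsto l y v) : FiniteTendsto l (fun i => L i (y i)) (L₀ v) := by
  induction hy with
  | smul hb e => simpa only [map_smul] using (hL e).const_smul hb
  | add _ _ hy hz => simpa only [map_add] using hy.add hz

theorem tendsto [NormedAddCommGroup M] [InnerProductSpace ℂ M] {y : ι → M} {v : M}
    (hy : FiniteTendsto l y v) : Tendsto y l (𝓝 v) := by
  induction hy with
  | smul hb e => exact hb.smul tendsto_const_nhds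
  | add _ _ hy hz => exact hy.add hz

end FiniteTendsto

variable {l : Filter ι} {ℓ : ι → V →ₗ[ℂ] ℂ} {ℓ₀ : V →ₗ[ℂ] ℂ}

theorem finiteTendsto_annihilateFull (h : ∀ v, Tendsto (fun i => ℓ i v) l (𝓝 (ℓ₀ v)))
    (x : FullFin V) : FiniteTendsto l (fun i => annihilateFull (ℓ i) x) (annihilateFull ℓ₀ x) := by
  induction x using sector_induction with
  | zero => simpa only [map_zero] using FiniteTendsto.const (l := l) (0 : FullFin V)
  | add x y hx hy => simpa only [map_add] using hx.add hy
  | sector n x =>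
    cases n with
    | zero => simpa only [annihilateFull_zero] using FiniteTendsto.const (l := l) (0 : FullFin V)
    | succ n =>
      simp only [annihilateFull_succ]
      refine FiniteTendsto.const_smul tendsto_const_nhds ?_
      induction x using slot_induction with
      | zero => simpa only [map_zero] using FiniteTendsto.const (l := l) (0 : FullFin V)
      | add x y hx hy => simpa only [map_add] using hx.add hy
      | slot v x => simpa only [contract_slot, map_smul] using FiniteTendsto.smul (h v) _

theorem finiteTendsto_annihilateFull_pow (h : ∀ v, Tendsto (fun i => ℓ i v) l (𝓝 (ℓ₀ v)))
    (k : ℕ) (x : FullFin V) :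
    FiniteTendsto l (fun i => (annihilateFull (ℓ i) ^ k) x) ((annihilateFull ℓ₀ ^ k) x) := by
  induction k with
  | zero => exact FiniteTendsto.const x
  | succ k ih =>
    simp only [pow_succ', Module.End.mul_apply]
    exact FiniteTendsto.map (finiteTendsto_annihilateFull h) ih

theorem tendsto_inner_annihilate_pow (h : ∀ v, Tendsto (fun i => ℓ i v) l (𝓝 (ℓ₀ v)))
    (p q : ℕ) (x y : FockFin V) :
    Tendsto (fun i => ⟪(annihilate (ℓ i) ^ q) x, (annihilate (ℓ i) ^ p) y⟫_ℂ) l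
      (𝓝 ⟪(annihilate ℓ₀ ^ q) x, (annihilate ℓ₀ ^ p) y⟫_ℂ) := by
  have h1 := ((finiteTendsto_annihilateFull_pow h q (toFull x)).tendsto).inner
    ((finiteTendsto_annihilateFull_pow h p (toFull y)).tendsto) (𝕜 := ℂ)
  simp only [← toFull_annihilate_pow, inner_toFull] at h1
  exact h1

end Annihilation

/-! ### Convergence of the Gaussian kernel under the integral -/

section Kernel

variable {S : Type*} [NormedAddCommGroup S] [InnerProductSpace ℂ S] [CompleteSpace S]
  {A B : S →L[ℂ] S} (hB : IsStarNormal B) (hA : IsDecomposable (spectralPVM hB) A)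

theorem measurable_monomial_mul {κ : ℂ → ℂ → ℂ} (hκ : Measurable fun z : ℂ × ℂ => κ z.1 z.2)
    (p q : ℕ) : Measurable fun z : ℂ × ℂ => conj z.1 ^ p * z.2 ^ q * κ z.1 z.2 := by
  have : Continuous fun z : ℂ × ℂ => conj z.1 ^ p * z.2 ^ q := by fun_prop
  exact this.measurable.mul hκ

theorem norm_monomial_mul_le {κ l m : ℂ} (hκ : ‖κ‖ ≤ 1) {R : ℝ} (hl : ‖l‖ ≤ R) (hm : ‖m‖ ≤ R)
    (p q : ℕ) : ‖conj l ^ p * m ^ q * κ‖ ≤ R ^ p * R ^ q := by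
  have hR : 0 ≤ R := (norm_nonneg l).trans hl
  rw [norm_mul, norm_mul, norm_pow, norm_pow, RCLike.norm_conj]
  calc _ ≤ R ^ p * R ^ q * 1 := by gcongr
    _ = _ := mul_one _

theorem integrable_monomial_mul {κ : ℂ → ℂ → ℂ} (hκ : Measurable fun z : ℂ × ℂ => κ z.1 z.2)
    (hκ1 : ∀ l m, ‖κ l m‖ ≤ 1) (ψ φ : S) (p q : ℕ) :
    (doiMeasure hA ψ φ).Integrable fun z => conj z.1 ^ p * z.2 ^ q * κ z.1 z.2 := by
  obtain ⟨R, -, hR⟩ := exists_ae_norm_le hB hA ψ φ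
  refine integrable_doiMeasure_of_bound hA (measurable_monomial_mul hκ p q)
    (C := R ^ p * R ^ q) ?_
  filter_upwards [hR] with z hz
  exact norm_monomial_mul_le (hκ1 _ _) hz.1 hz.2 p q

theorem measurable_gaussKernel (t : ℝ) : Measurable fun z : ℂ × ℂ => gaussKernel t z.1 z.2 := by
  unfold gaussKernel
  fun_prop

/-- Dominated convergence needs a countably generated filter, while the approximating nets are
arbitrary. They enter the kernel only through `t = ‖x‖²`, so the limit is taken along a filter of
real numbers. -/
theorem tendsto_doi_gaussKernel {L : Filter ℝ} [L.IsCountablyGenerated] (hL : ∀ᶠ t in L, 0 ≤ t)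
    {κ : ℂ → ℂ → ℂ} (hκ : ∀ l m, Tendsto (fun t => gaussKernel t l m) L (𝓝 (κ l m)))
    (ψ φ : S) (p q : ℕ) :
    Tendsto (fun t => doi hA (fun z => conj z.1 ^ p * z.2 ^ q * gaussKernel t z.1 z.2) ψ φ) L
      (𝓝 (doi hA (fun z => conj z.1 ^ p * z.2 ^ q * κ z.1 z.2) ψ φ)) := by
  obtain ⟨R, -, hR⟩ := exists_ae_norm_le hB hA ψ φ
  refine VectorMeasure.tendsto_integral_filter_of_dominated_convergence
    (fun _ => R ^ p * R ^ q) ?_ ?_ (integrable_const _) ?_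
  · exact Eventually.of_forall fun t =>
      (measurable_monomial_mul (measurable_gaussKernel t) p q).aestronglyMeasurable
  · filter_upwards [hL] with t ht
    filter_upwards [hR] with z hz
    exact norm_monomial_mul_le (norm_gaussKernel_le_one ht _ _) hz.1 hz.2 p q
  · exact Eventually.of_forall fun z => tendsto_const_nhds.mul (hκ z.1 z.2)

theorem tendsto_gaussKernel_nhds (t₀ : ℝ) (l m : ℂ) :
    Tendsto (fun t => gaussKernel t l m) (𝓝 t₀) (𝓝 (gaussKernel t₀ l m)) := by
  have : Continuous fun t : ℝ => gaussKernel t l m := by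
    unfold gaussKernel
    fun_prop
  exact this.tendsto t₀

/-- On the diagonal the exponent is zero for all `t`; off it the modulus `exp(-t |l - m|² / 2)`
decays. -/
theorem tendsto_gaussKernel_atTop (l m : ℂ) [Decidable (l = m)] :
    Tendsto (fun t => gaussKernel t l m) atTop (𝓝 (if l = m then 1 else 0)) := by
  split_ifs with h
  · subst h
    refine tendsto_const_nhds.congr fun t => ?_
    rw [gaussKernel, conj_mul_self_eq]
    push_cast
    ring_nf
    exact Complex.exp_zero.symm
  · rw [tendsto_zero_iff_norm_tendsto_zero]
    simp only [norm_gaussKernel]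
    refine Real.tendsto_exp_neg_atTop_nhds_zero.comp ?_
    have : 0 < ‖l - m‖ ^ 2 / 2 := by
      have := norm_pos_iff.2 (sub_ne_zero.2 h)
      positivity
    exact tendsto_id.const_mul_atTop this

end Kernel

/-! ### The limiting kernel -/

section Chi

variable {T h : Type*} [AddCommGroup T] [Module ℂ T] [TopologicalSpace T]
  [NormedAddCommGroup h] [InnerProductSpace ℂ h] (G : GelfandTriple T h)

/-- Test functions are dense in `h`. Hence the vector chosen inside `chi` is the one that represents
`g`. -/
theorem ofHilbert_injective : Function.Injective G.ofHilbert := by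
  intro x y hxy
  exact G.denseRange.eq_of_inner_right ℂ fun f => congrArg (fun g : AntiDual T => g f) hxy

theorem chi_ofHilbert (x : h) (l m : ℂ) :
    G.chi (G.ofHilbert x) l m = gaussKernel (‖x‖ ^ 2) l m := by
  have hx : ∃ y : h, G.ofHilbert y = G.ofHilbert x := ⟨x, rfl⟩
  rw [GelfandTriple.chi, dif_pos hx, ofHilbert_injective G hx.choose_spec]
  rfl

theorem chi_of_not_mem {g : AntiDual T} (hg : ¬ ∃ x : h, G.ofHilbert x = g) (l m : ℂ)
    [Decidable (l = m)] : G.chi g l m = if l = m then 1 else 0 := by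
  rw [GelfandTriple.chi, dif_neg hg]
  congr

theorem measurable_chi (g : AntiDual T) : Measurable fun z : ℂ × ℂ => G.chi g z.1 z.2 := by
  by_cases hg : ∃ x : h, G.ofHilbert x = g
  · obtain ⟨x, rfl⟩ := hg
    simp only [chi_ofHilbert]
    exact measurable_gaussKernel _
  · classical
    simp only [chi_of_not_mem G hg]
    exact Measurable.ite (measurableSet_eq_fun measurable_fst measurable_snd) measurable_const
      measurable_const

theorem norm_chi_le_one (g : AntiDual T) (l m : ℂ) : ‖G.chi g l m‖ ≤ 1 := by
  by_cases hg : ∃ x : h, G.ofHilbert x = g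
  · obtain ⟨x, rfl⟩ := hg
    rw [chi_ofHilbert]
    exact norm_gaussKernel_le_one (by positivity) _ _
  · classical
    rw [chi_of_not_mem G hg]
    split_ifs <;> simp

end Chi

/-! ### Polynomial expansion of the integrand -/

section SpinKernel

variable {S T h : Type*} [NormedAddCommGroup S] [InnerProductSpace ℂ S] [CompleteSpace S]
  [AddCommGroup T] [Module ℂ T] [TopologicalSpace T]
  [NormedAddCommGroup h] [InnerProductSpace ℂ h] (G : GelfandTriple T h)
  {A B : S →L[ℂ] S} (hB : IsStarNormal B) (hA : IsDecomposable (spectralPVM hB) A)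
  (g : AntiDual T)

/-- Nilpotency makes the Fock factor a polynomial in `conj λ` and `μ`, so integrability and limits
reduce to monomials times `chi`. -/
theorem spinKernel_eq {Ξ Θ : FockFin G.test} {K : ℕ} (hΞ : (G.annih g ^ K) Ξ = 0)
    (hΘ : (G.annih g ^ K) Θ = 0) :
    G.spinKernel g Ξ Θ = fun z => ∑ r ∈ Finset.range K ×ˢ Finset.range K,
      (((r.1.factorial : ℂ) * r.2.factorial)⁻¹ *
        ⟪(G.annih g ^ r.2) Ξ, (G.annih g ^ r.1) Θ⟫_ℂ) *
          (conj z.1 ^ r.1 * z.2 ^ r.2 * G.chi g z.1 z.2) := by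
  funext z
  rw [GelfandTriple.spinKernel, inner_expAnnih G g _ _ hΞ hΘ, Finset.mul_sum, Finset.sum_product]
  refine Finset.sum_congr rfl fun p _ => ?_
  rw [Finset.mul_sum]
  refine Finset.sum_congr rfl fun q _ => ?_
  ring

theorem exists_annih_pow_eq_zero (Ξ Θ : FockFin G.test) :
    ∃ K, ∀ g, (G.annih g ^ K) Ξ = 0 ∧ (G.annih g ^ K) Θ = 0 := by
  obtain ⟨K, hK⟩ := exists_annihilate_pow_eq_zero_forall Ξ Θ
  exact ⟨K, fun g => hK (G.bracket g)⟩

theorem integrable_const_mul_monomial (ψ φ : S) (c : ℂ) (p q : ℕ) :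
    (doiMeasure hA ψ φ).Integrable fun z => c * (conj z.1 ^ p * z.2 ^ q * G.chi g z.1 z.2) :=
  Integrable.const_mul
    (integrable_monomial_mul hB hA (measurable_chi G g) (norm_chi_le_one G g) ψ φ p q) c

theorem integrable_spinKernel (ψ φ : S) (Ξ Θ : FockFin G.test) :
    (doiMeasure hA ψ φ).Integrable (G.spinKernel g Ξ Θ) := by
  obtain ⟨K, hK⟩ := exists_annih_pow_eq_zero G Ξ Θ
  rw [spinKernel_eq G g (hK g).1 (hK g).2]
  exact integrable_finsetSum _ fun r _ => integrable_const_mul_monomial G hB hA g ψ φ _ _ _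

theorem doi_spinKernel (ψ φ : S) {Ξ Θ : FockFin G.test} {K : ℕ} (hΞ : (G.annih g ^ K) Ξ = 0)
    (hΘ : (G.annih g ^ K) Θ = 0) :
    doi hA (G.spinKernel g Ξ Θ) ψ φ = ∑ p ∈ Finset.range K, ∑ q ∈ Finset.range K,
      doi hA (fun z => conj z.1 ^ p * z.2 ^ q * G.chi g z.1 z.2) ψ φ *
        (((p.factorial : ℂ) * q.factorial)⁻¹ *
          ⟪(G.annih g ^ q) Ξ, (G.annih g ^ p) Θ⟫_ℂ) := by
  rw [spinKernel_eq G g hΞ hΘ]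
  refine (VectorMeasure.integral_finsetSum _
    fun r _ => integrable_const_mul_monomial G hB hA g ψ φ _ _ _).trans ?_
  rw [Finset.sum_product]
  refine Finset.sum_congr rfl fun p _ => Finset.sum_congr rfl fun q _ => ?_
  exact (doi_const_mul hA _ _ ψ φ).trans (mul_comm _ _)

end SpinKernel

/-! ### Approximating antidual elements by Hilbert space vectors -/

section Approximation

variable {T h : Type*} [AddCommGroup T] [Module ℂ T] [TopologicalSpace T]
  [NormedAddCommGroup h] [InnerProductSpace ℂ h] (G : GelfandTriple T h)

/-- `x → g` weakly, and in the norm of `h` if `g ∈ h`. -/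
structure Approximates {ι : Type*} (l : Filter ι) (x : ι → h) (g : AntiDual T) : Prop where
  weak : ∀ f, Tendsto (fun i => G.ofHilbert (x i) f) l (𝓝 (g f))
  norm : ∀ y, G.ofHilbert y = g → Tendsto x l (𝓝 y)

/-- Hahn-Banach extends the norm-continuous functional from `W` to `h`, and Riesz represents it. It
serves both for all test functions and for finite-dimensional spans. -/
theorem exists_ofHilbert_eq_on [CompleteSpace h] (g : AntiDual T) (W : Submodule ℂ h)
    (hW : W ≤ G.test) (hc : Continuous (G.bracket g ∘ₗ Submodule.inclusion hW)) :
    ∃ x : h, ∀ f, G.emb f ∈ W → G.ofHilbert x f = g f := by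
  obtain ⟨F, hF, -⟩ := exists_extension_norm_eq W
    (⟨G.bracket g ∘ₗ Submodule.inclusion hW, hc⟩ : W →L[ℂ] ℂ)
  refine ⟨(InnerProductSpace.toDual ℂ h).symm F, fun f hf => ?_⟩
  have h1 : F (G.emb f) = conj (g (G.equivTest.symm ⟨G.emb f, f, rfl⟩)) := hF ⟨G.emb f, hf⟩
  have h2 : G.equivTest.symm ⟨G.emb f, f, rfl⟩ = f :=
    G.equivTest.symm_apply_eq.2 rfl
  change ⟪G.emb f, (InnerProductSpace.toDual ℂ h).symm F⟫_ℂ = g f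
  rw [← inner_conj_symm, InnerProductSpace.toDual_symm_apply, h1, h2, Complex.conj_conj]

theorem exists_ofHilbert_eq_of_bound [CompleteSpace h] {g : AntiDual T} {C : ℝ}
    (hC : ∀ f, ‖g f‖ ≤ C * ‖G.emb f‖) : ∃ x : h, G.ofHilbert x = g := by
  obtain ⟨x, hx⟩ := exists_ofHilbert_eq_on G g G.test le_rfl (by
    refine AddMonoidHomClass.continuous_of_bound _ C fun u => ?_
    change ‖conj (g (G.equivTest.symm u))‖ ≤ C * ‖(u : h)‖
    rw [RCLike.norm_conj]
    refine (hC _).trans_eq ?_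
    rw [emb_equivTest_symm])
  exact ⟨x, by ext f; exact hx f ⟨f, rfl⟩⟩

/-- If the norms were frequently below some `C`, then along that part of the filter `|⟨f, x_i⟩| ≤ C
‖f‖` would pass to the limit, making `g` bounded and hence a vector of `h`. -/
theorem tendsto_norm_atTop_of_not_mem [CompleteSpace h] {g : AntiDual T}
    (hg : ¬ ∃ x : h, G.ofHilbert x = g) {ι : Type*} {l : Filter ι} {x : ι → h}
    (hx : ∀ f, Tendsto (fun i => G.ofHilbert (x i) f) l (𝓝 (g f))) :
    Tendsto (fun i => ‖x i‖) l atTop := by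
  refine tendsto_atTop.2 fun C => ?_
  by_contra hC
  have hfr : ∃ᶠ i in l, ‖x i‖ < C := by
    simpa only [not_eventually, not_le] using hC
  have : (l ⊓ 𝓟 {i | ‖x i‖ < C}).NeBot := frequently_mem_iff_neBot.1 hfr
  refine hg (exists_ofHilbert_eq_of_bound G (C := C) fun f => ?_)
  have h1 : Tendsto (fun i => ‖G.ofHilbert (x i) f‖) (l ⊓ 𝓟 {i | ‖x i‖ < C}) (𝓝 ‖g f‖) :=
    (hx f).norm.mono_left inf_le_left
  refine le_of_tendsto h1 ?_
  filter_upwards [mem_inf_of_right (f := l) (mem_principal_self {i | ‖x i‖ < C})] with i hi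
  calc ‖⟪G.emb f, x i⟫_ℂ‖ ≤ ‖G.emb f‖ * ‖x i‖ := norm_inner_le_norm _ _
    _ ≤ ‖G.emb f‖ * C := by
      have hi' : ‖x i‖ < C := hi
      gcongr
    _ = C * ‖G.emb f‖ := mul_comm _ _

/-- A constant net works for `g` in `h`. Otherwise, for each finite set of test functions some
vector agrees with `g` there, a functional on a finite-dimensional space being continuous; directed
by inclusion, these values are eventually exact. -/
theorem exists_approximates [CompleteSpace h] (g : AntiDual T) :
    ∃ x : Finset T → h, Approximates G atTop x g := by
  by_cases hg : ∃ x : h, G.ofHilbert x = g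
  · obtain ⟨y, rfl⟩ := hg
    refine ⟨fun _ => y, fun f => tendsto_const_nhds, fun z hz => ?_⟩
    rw [ofHilbert_injective G hz]
    exact tendsto_const_nhds
  · have key : ∀ s : Finset T, ∃ x : h, ∀ f ∈ s, G.ofHilbert x f = g f := by
      intro s
      have hfin : (G.emb '' (s : Set T)).Finite := s.finite_toSet.image _
      have : FiniteDimensional ℂ (Submodule.span ℂ (G.emb '' (s : Set T))) :=
        FiniteDimensional.span_of_finite ℂ hfin
      obtain ⟨x, hx⟩ := exists_ofHilbert_eq_on G g (Submodule.span ℂ (G.emb '' (s : Set T)))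
        (Submodule.span_le.2 (by rintro _ ⟨f, -, rfl⟩; exact ⟨f, rfl⟩))
        (LinearMap.continuous_of_finiteDimensional _)
      exact ⟨x, fun f hf => hx f (Submodule.subset_span ⟨f, hf, rfl⟩)⟩
    choose x hx using key
    refine ⟨x, fun f => ?_, fun y hy => (hg ⟨y, hy⟩).elim⟩
    refine tendsto_const_nhds.congr' ?_
    filter_upwards [eventually_ge_atTop {f}] with s hs
    exact (hx s f (Finset.singleton_subset_iff.1 hs)).symm

variable {G}

theorem Approximates.tendsto_bracket {ι : Type*} {l : Filter ι} {x : ι → h} {g : AntiDual T}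
    (hx : Approximates G l x g) (u : G.test) :
    Tendsto (fun i => G.bracket (G.ofHilbert (x i)) u) l (𝓝 (G.bracket g u)) :=
  (Complex.continuous_conj.tendsto _).comp (hx.weak _)

end Approximation

/-! ### Limits of the regularized forms and norms -/

section Limit

variable {S T h : Type*} [NormedAddCommGroup S] [InnerProductSpace ℂ S] [CompleteSpace S]
  [AddCommGroup T] [Module ℂ T] [TopologicalSpace T]
  [NormedAddCommGroup h] [InnerProductSpace ℂ h] {G : GelfandTriple T h}
  {A B : S →L[ℂ] S}
  {ι : Type*} {l : Filter ι} {x : ι → h} {g : AntiDual T}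

theorem tendsto_doi_chi [CompleteSpace h] (hB : IsStarNormal B)
    (hA : IsDecomposable (spectralPVM hB) A)
    (hx : Approximates G l x g) (ψ φ : S) (p q : ℕ) :
    Tendsto (fun i => doi hA (fun z => conj z.1 ^ p * z.2 ^ q *
        gaussKernel (‖x i‖ ^ 2) z.1 z.2) ψ φ) l
      (𝓝 (doi hA (fun z => conj z.1 ^ p * z.2 ^ q * G.chi g z.1 z.2) ψ φ)) := by
  by_cases hg : ∃ y : h, G.ofHilbert y = g
  · obtain ⟨y, rfl⟩ := hg
    -- A full neighbourhood would contain negative `t` when `y = 0`, where the kernel is not bounded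
    -- by 1.
    have h1 : Tendsto (fun i => ‖x i‖ ^ 2) l (𝓝[Set.Ici 0] (‖y‖ ^ 2)) :=
      tendsto_nhdsWithin_iff.2 ⟨(hx.norm y rfl).norm.pow 2,
        Eventually.of_forall fun i => sq_nonneg ‖x i‖⟩
    refine (tendsto_doi_gaussKernel hB hA (L := 𝓝[Set.Ici 0] (‖y‖ ^ 2)) self_mem_nhdsWithin
      (fun l m => ?_) ψ φ p q).comp h1
    rw [chi_ofHilbert]
    exact (tendsto_gaussKernel_nhds _ l m).mono_left nhdsWithin_le_nhds
  · classical
    have h1 : Tendsto (fun i => ‖x i‖ ^ 2) l atTop :=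
      (tendsto_pow_atTop two_ne_zero).comp (tendsto_norm_atTop_of_not_mem G hg hx.weak)
    refine (tendsto_doi_gaussKernel hB hA (eventually_ge_atTop 0) (fun l m => ?_) ψ φ p q).comp h1
    rw [chi_of_not_mem G hg]
    exact tendsto_gaussKernel_atTop l m

theorem tendsto_regularSpinForm_tmul [CompleteSpace h] (hB : IsStarNormal B)
    (hA : IsDecomposable (spectralPVM hB) A)
    (hx : Approximates G l x g) (ψ φ : S) (Ξ Θ : FockFin G.test) :
    Tendsto (fun i => regularSpinForm G B A (x i) (ψ ⊗ₜ[ℂ] Ξ) (φ ⊗ₜ[ℂ] Θ)) l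
      (𝓝 (doi hA (G.spinKernel g Ξ Θ) ψ φ)) := by
  obtain ⟨K, hK⟩ := exists_annih_pow_eq_zero G Ξ Θ
  rw [doi_spinKernel G hB hA g ψ φ (hK g).1 (hK g).2]
  refine (tendsto_finsetSum _ fun p _ => tendsto_finsetSum _ fun q _ =>
    (tendsto_doi_chi hB hA hx ψ φ p q).mul (tendsto_const_nhds.mul
      (tendsto_inner_annihilate_pow hx.tendsto_bracket p q Ξ Θ))).congr fun i => ?_
  exact (regularSpinForm_tmul G B (x i) A ψ φ Ξ Θ (hK _).1 (hK _).2
    fun p q => hasSum_inner_gaussOp hB hA (sq_nonneg _) ψ φ p q).symm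

theorem tendsto_regularSpinForm_one_tmul (hB : IsStarNormal B) (hx : Approximates G l x g) (ψ φ : S)
    (Ξ Θ : FockFin G.test) :
    Tendsto (fun i => regularSpinForm G B 1 (x i) (ψ ⊗ₜ[ℂ] Ξ) (φ ⊗ₜ[ℂ] Θ)) l
      (𝓝 ⟪dressing G B g (ψ ⊗ₜ[ℂ] Ξ), dressing G B g (φ ⊗ₜ[ℂ] Θ)⟫_ℂ) := by
  obtain ⟨K, hK⟩ := exists_annih_pow_eq_zero G Ξ Θ
  rw [inner_dressing_tmul G B g ψ φ (hK g).1 (hK g).2]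
  refine (tendsto_finsetSum _ fun p _ => tendsto_finsetSum _ fun q _ =>
    tendsto_const_nhds.mul (tendsto_const_nhds.mul
      (tendsto_inner_annihilate_pow hx.tendsto_bracket p q Ξ Θ))).congr fun i => ?_
  exact (regularSpinForm_tmul G B (x i) 1 ψ φ Ξ Θ (hK _).1 (hK _).2
    fun p q => hasSum_inner_gaussOp_self hB _ ψ φ p q).symm

/-- Zero is itself a pure tensor, so only pure tensors and additivity need checking. -/
theorem tensor_induction₂ {M N : Type*} [AddCommGroup M] [Module ℂ M] [AddCommGroup N] [Module ℂ N]
    {P : M ⊗[ℂ] N → M ⊗[ℂ] N → Prop} (tmul : ∀ m m' n n', P (m ⊗ₜ n) (m' ⊗ₜ n'))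
    (add_left : ∀ x x' y, P x y → P x' y → P (x + x') y)
    (add_right : ∀ x y y', P x y → P x y' → P x (y + y')) (x y : M ⊗[ℂ] N) : P x y := by
  induction x using TensorProduct.induction_on with
  | zero =>
    rw [← TensorProduct.zero_tmul M (0 : N)]
    induction y using TensorProduct.induction_on with
    | zero => rw [← TensorProduct.zero_tmul M (0 : N)]; exact tmul _ _ _ _
    | tmul m n => exact tmul _ _ _ _
    | add y y' hy hy' => exact add_right _ _ _ hy hy'
  | tmul m n =>
    induction y using TensorProduct.induction_on with
    | zero => rw [← TensorProduct.zero_tmul M (0 : N)]; exact tmul _ _ _ _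
    | tmul m n => exact tmul _ _ _ _
    | add y y' hy hy' => exact add_right _ _ _ hy hy'
  | add x x' hx hx' => exact add_left _ _ _ hx hx'

/-- Limits of the regularized forms extend from pure tensors. -/
theorem tendsto_regularSpinForm_of_tmul {a : S ⊗[ℂ] FockFin G.test → S ⊗[ℂ] FockFin G.test → ℂ}
    (tmul : ∀ ψ φ Ξ Θ, Tendsto (fun i => regularSpinForm G B A (x i) (ψ ⊗ₜ[ℂ] Ξ) (φ ⊗ₜ[ℂ] Θ)) l
      (𝓝 (a (ψ ⊗ₜ[ℂ] Ξ) (φ ⊗ₜ[ℂ] Θ))))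
    (add_left : ∀ Ψ Ψ' Φ, a (Ψ + Ψ') Φ = a Ψ Φ + a Ψ' Φ)
    (add_right : ∀ Ψ Φ Φ', a Ψ (Φ + Φ') = a Ψ Φ + a Ψ Φ') (Ψ Φ : S ⊗[ℂ] FockFin G.test) :
    Tendsto (fun i => regularSpinForm G B A (x i) Ψ Φ) l (𝓝 (a Ψ Φ)) := by
  induction Ψ, Φ using tensor_induction₂ with
  | tmul ψ φ Ξ Θ => exact tmul ψ φ Ξ Θ
  | add_left Ψ Ψ' Φ h1 h2 => simpa only [add_left, regularSpinForm_add_left] using h1.add h2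
  | add_right Ψ Φ Φ' h1 h2 => simpa only [add_right, regularSpinForm_add_right] using h1.add h2

/-- Knowing the limit on pure tensors gives its existence everywhere. Defining the form as this
limit makes it sesquilinear and well defined on the tensor product without studying the double
operator integral in its vectors. -/
theorem exists_tendsto_regularSpinForm [CompleteSpace h] (hB : IsStarNormal B)
    (hA : IsDecomposable (spectralPVM hB) A)
    (hx : Approximates G l x g) (Ψ Φ : S ⊗[ℂ] FockFin G.test) :
    ∃ c, Tendsto (fun i => regularSpinForm G B A (x i) Ψ Φ) l (𝓝 c) := by
  induction Ψ, Φ using tensor_induction₂ with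
  | tmul ψ φ Ξ Θ => exact ⟨_, tendsto_regularSpinForm_tmul hB hA hx ψ φ Ξ Θ⟩
  | add_left Ψ Ψ' Φ h1 h2 =>
    obtain ⟨c, hc⟩ := h1
    obtain ⟨d, hd⟩ := h2
    exact ⟨c + d, by simpa only [regularSpinForm_add_left] using hc.add hd⟩
  | add_right Ψ Φ Φ' h1 h2 =>
    obtain ⟨c, hc⟩ := h1
    obtain ⟨d, hd⟩ := h2
    exact ⟨c + d, by simpa only [regularSpinForm_add_right] using hc.add hd⟩

/-- The regularized form of the identity is a squared norm, whose limit is the renormalized one.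
This is what makes the constant in the bound exactly `‖A‖`. -/
theorem tendsto_norm_regularDressing (hB : IsStarNormal B) (hx : Approximates G l x g)
    (Ψ : S ⊗[ℂ] FockFin G.test) :
    Tendsto (fun i => ‖regularDressing G B (x i) Ψ‖) l (𝓝 ‖dressing G B g Ψ‖) := by
  have h1 := tendsto_regularSpinForm_of_tmul (A := 1)
    (a := fun Ψ Φ => ⟪dressing G B g Ψ, dressing G B g Φ⟫_ℂ)
    (fun ψ φ Ξ Θ => tendsto_regularSpinForm_one_tmul hB hx ψ φ Ξ Θ)
    (fun Ψ Ψ' Φ => by rw [map_add, inner_add_left])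
    (fun Ψ Φ Φ' => by rw [map_add, inner_add_right]) Ψ Ψ
  have h2 := (Complex.continuous_re.tendsto _).comp h1
  have h3 := (Real.continuous_sqrt.tendsto _).comp h2
  simp only [regularSpinForm_one_self, Function.comp_def, Complex.ofReal_re,
    Real.sqrt_sq (norm_nonneg _)] at h3
  rw [norm_eq_sqrt_re_inner (𝕜 := ℂ)]
  exact h3

end Limit

/-! ### Extension to the renormalized space and representation -/

section LimitForm

variable {S T h : Type*} [NormedAddCommGroup S] [InnerProductSpace ℂ S] [CompleteSpace S]
  [AddCommGroup T] [Module ℂ T] [TopologicalSpace T]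
  [NormedAddCommGroup h] [InnerProductSpace ℂ h] [CompleteSpace h] {G : GelfandTriple T h}
  {A B : S →L[ℂ] S} {g : AntiDual T}

variable (G A B) in
/-- The limit of the regularized forms along `x`. -/
def limitForm {ι : Type*} (l : Filter ι) (x : ι → h) (Ψ Φ : S ⊗[ℂ] FockFin G.test) : ℂ :=
  limUnder l fun i => regularSpinForm G B A (x i) Ψ Φ

section

variable {ι : Type*} {l : Filter ι} [l.NeBot] {x : ι → h}

theorem tendsto_limitForm (hB : IsStarNormal B) (hA : IsDecomposable (spectralPVM hB) A)
    (hx : Approximates G l x g) (Ψ Φ : S ⊗[ℂ] FockFin G.test) :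
    Tendsto (fun i => regularSpinForm G B A (x i) Ψ Φ) l (𝓝 (limitForm G A B l x Ψ Φ)) :=
  tendsto_nhds_limUnder (exists_tendsto_regularSpinForm hB hA hx Ψ Φ)

theorem norm_limitForm_le (hB : IsStarNormal B) (hA : IsDecomposable (spectralPVM hB) A)
    (hx : Approximates G l x g) (Ψ Φ : S ⊗[ℂ] FockFin G.test) :
    ‖limitForm G A B l x Ψ Φ‖ ≤ ‖A‖ * ‖dressing G B g Ψ‖ * ‖dressing G B g Φ‖ :=
  le_of_tendsto_of_tendsto' (tendsto_limitForm hB hA hx Ψ Φ).norm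
    ((tendsto_const_nhds.mul (tendsto_norm_regularDressing hB hx Ψ)).mul
      (tendsto_norm_regularDressing hB hx Φ)) fun i => norm_regularSpinForm_le G B (x i) A Ψ Φ

theorem limitForm_conj (hB : IsStarNormal B) (hA : IsDecomposable (spectralPVM hB) A)
    (hx : Approximates G l x g) (hAs : IsSelfAdjoint A) (Ψ Φ : S ⊗[ℂ] FockFin G.test) :
    limitForm G A B l x Ψ Φ = conj (limitForm G A B l x Φ Ψ) := by
  refine tendsto_nhds_unique (tendsto_limitForm hB hA hx Ψ Φ)
    (((Complex.continuous_conj.tendsto _).comp (tendsto_limitForm hB hA hx Φ Ψ)).congr fun i => ?_)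
  exact regularSpinForm_conj G B (x i) hAs Ψ Φ

/-- The limit form as a sesquilinear map. -/
def limitSesq (hB : IsStarNormal B) (hA : IsDecomposable (spectralPVM hB) A)
    (hx : Approximates G l x g) :
    S ⊗[ℂ] FockFin G.test →ₗ⋆[ℂ] S ⊗[ℂ] FockFin G.test →ₗ[ℂ] ℂ :=
  LinearMap.mk₂'ₛₗ (starRingEnd ℂ) (RingHom.id ℂ) (limitForm G A B l x)
    (fun Ψ Ψ' Φ => tendsto_nhds_unique (tendsto_limitForm hB hA hx _ _)
      (((tendsto_limitForm hB hA hx Ψ Φ).add (tendsto_limitForm hB hA hx Ψ' Φ)).congr fun i =>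
        (regularSpinForm_add_left G B (x i) A Ψ Ψ' Φ).symm))
    (fun c Ψ Φ => tendsto_nhds_unique (tendsto_limitForm hB hA hx _ _)
      (((tendsto_limitForm hB hA hx Ψ Φ).const_mul (conj c)).congr fun i =>
        (regularSpinForm_smul_left G B (x i) A c Ψ Φ).symm))
    (fun Ψ Φ Φ' => tendsto_nhds_unique (tendsto_limitForm hB hA hx _ _)
      (((tendsto_limitForm hB hA hx Ψ Φ).add (tendsto_limitForm hB hA hx Ψ Φ')).congr fun i =>
        (regularSpinForm_add_right G B (x i) A Ψ Φ Φ').symm))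
    (fun c Ψ Φ => tendsto_nhds_unique (tendsto_limitForm hB hA hx _ _)
      (((tendsto_limitForm hB hA hx Ψ Φ).const_mul c).congr fun i =>
        (regularSpinForm_smul_right G B (x i) A c Ψ Φ).symm))

end

/-- The extension of a bounded sesquilinear form to the completion. -/
def extendForm {E : Type*} [SeminormedAddCommGroup E] [InnerProductSpace ℂ E]
    (b : E →L⋆[ℂ] E →L[ℂ] ℂ) :
    UniformSpace.Completion E →L⋆[ℂ] UniformSpace.Completion E →L[ℂ] ℂ :=
  b.fromCompletion.flip.fromCompletion.flip

theorem extendForm_coe {E : Type*} [SeminormedAddCommGroup E] [InnerProductSpace ℂ E]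
    (b : E →L⋆[ℂ] E →L[ℂ] ℂ) (x y : E) :
    extendForm b (x : UniformSpace.Completion E) (y : UniformSpace.Completion E) = b x y := by
  rw [extendForm, ContinuousLinearMap.flip_apply, ContinuousLinearMap.fromCompletion_apply_coe,
    ContinuousLinearMap.flip_apply, ContinuousLinearMap.fromCompletion_apply_coe]

/-- The space is only seminormed, but the bound makes `b` blind to null vectors, so it passes to the
completion; symmetry and the bound are closed conditions and extend by density. -/
theorem exists_completion_form {E : Type*} [SeminormedAddCommGroup E] [InnerProductSpace ℂ E]
    (b : E →ₗ⋆[ℂ] E →ₗ[ℂ] ℂ) {C : ℝ} (hC : ∀ x y, ‖b x y‖ ≤ C * ‖x‖ * ‖y‖)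
    (hb : ∀ x y, b x y = conj (b y x)) :
    ∃ a : UniformSpace.Completion E →L⋆[ℂ] UniformSpace.Completion E →L[ℂ] ℂ,
      (∀ x y : E, a (x : UniformSpace.Completion E) (y : UniformSpace.Completion E) = b x y) ∧
      (∀ x y, a x y = conj (a y x)) ∧ ∀ x y, ‖a x y‖ ≤ C * ‖x‖ * ‖y‖ := by
  have ha : ∀ x y : E, extendForm (b.mkContinuous₂ C hC) (x : UniformSpace.Completion E)
      (y : UniformSpace.Completion E) = b x y := fun x y => extendForm_coe _ x y
  refine ⟨extendForm (b.mkContinuous₂ C hC), ha, fun x y => ?_, fun x y => ?_⟩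
  · induction x, y using UniformSpace.Completion.induction_on₂ with
    | hp => exact isClosed_eq (by fun_prop) (by fun_prop)
    | ih x y => rw [ha, ha, hb]
  · induction x, y using UniformSpace.Completion.induction_on₂ with
    | hp => exact isClosed_le (by fun_prop) (by fun_prop)
    | ih x y =>
      rw [ha, UniformSpace.Completion.norm_coe, UniformSpace.Completion.norm_coe]
      exact hC x y

/-- A bounded symmetric form is represented by a unique bounded self-adjoint operator. -/
theorem existsUnique_isSelfAdjoint_inner_eq {H : Type*} [NormedAddCommGroup H]
    [InnerProductSpace ℂ H] [CompleteSpace H] (a : H →L⋆[ℂ] H →L[ℂ] ℂ)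
    (ha : ∀ x y, a x y = conj (a y x)) :
    ∃! R : H →L[ℂ] H, IsSelfAdjoint R ∧ ∀ x y, ⟪x, R y⟫_ℂ = a x y := by
  -- Riesz puts the operator in the first slot; the symmetry of `a` moves it to the second.
  have h1 : ∀ x y, ⟪x, InnerProductSpace.continuousLinearMapOfBilin a y⟫_ℂ = a x y := fun x y => by
    rw [← inner_conj_symm, InnerProductSpace.continuousLinearMapOfBilin_apply, ← ha]
  refine ⟨InnerProductSpace.continuousLinearMapOfBilin a, ⟨?_, h1⟩, fun R hR => ?_⟩
  · rw [ContinuousLinearMap.isSelfAdjoint_iff_isSymmetric]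
    intro x y
    exact (InnerProductSpace.continuousLinearMapOfBilin_apply a x y).trans (h1 x y).symm
  · ext y
    exact ext_inner_left ℂ fun x => (hR.2 x y).trans (h1 x y).symm

theorem renormForm_ext {a a' : RenormSpace G B g →L⋆[ℂ] RenormSpace G B g →L[ℂ] ℂ}
    (h : ∀ (ψ φ : S) (Ξ Θ : FockFin G.test),
      a (toRenorm G B g (ψ ⊗ₜ[ℂ] Ξ)) (toRenorm G B g (φ ⊗ₜ[ℂ] Θ)) =
        a' (toRenorm G B g (ψ ⊗ₜ[ℂ] Ξ)) (toRenorm G B g (φ ⊗ₜ[ℂ] Θ))) : a = a' := by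
  have h1 : ∀ Ψ Φ : S ⊗[ℂ] FockFin G.test, a (toRenorm G B g Ψ) (toRenorm G B g Φ) =
      a' (toRenorm G B g Ψ) (toRenorm G B g Φ) := by
    intro Ψ Φ
    induction Ψ, Φ using tensor_induction₂ with
    | tmul ψ φ Ξ Θ => exact h ψ φ Ξ Θ
    | add_left Ψ Ψ' Φ h1 h2 => simp only [map_add, add_apply, h1, h2]
    | add_right Ψ Φ Φ' h1 h2 => simp only [map_add, h1, h2]
  ext Ψ Φ
  induction Ψ, Φ using UniformSpace.Completion.induction_on₂ with
  | hp => exact isClosed_eq (by fun_prop) (by fun_prop)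
  | ih Ψ Φ => exact h1 Ψ Φ

/-- The renormalized spin-boson form on `B_{B,g}`. -/
theorem exists_renormForm (hB : IsStarNormal B) (hA : IsDecomposable (spectralPVM hB) A)
    (hAs : IsSelfAdjoint A) (g : AntiDual T) :
    ∃ a : RenormSpace G B g →L⋆[ℂ] RenormSpace G B g →L[ℂ] ℂ,
      (∀ (ψ φ : S) (Ξ Θ : FockFin G.test),
        a (toRenorm G B g (ψ ⊗ₜ[ℂ] Ξ)) (toRenorm G B g (φ ⊗ₜ[ℂ] Θ)) =
          doi hA (G.spinKernel g Ξ Θ) ψ φ) ∧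
      (∀ Ψ Φ, a Ψ Φ = conj (a Φ Ψ)) ∧ ∀ Ψ Φ, ‖a Ψ Φ‖ ≤ ‖A‖ * ‖Ψ‖ * ‖Φ‖ := by
  obtain ⟨x, hx⟩ := exists_approximates G g
  obtain ⟨a, ha, hs, hn⟩ := exists_completion_form (E := PreRenorm G B g) (limitSesq hB hA hx)
    (C := ‖A‖) (norm_limitForm_le hB hA hx) (limitForm_conj hB hA hx hAs)
  -- The form was built from one particular net, but its values on pure tensors are the integrals,
  -- so the net leaves no trace.
  exact ⟨a, fun ψ φ Ξ Θ => (ha _ _).trans (tendsto_nhds_unique (tendsto_limitForm hB hA hx _ _)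
    (tendsto_regularSpinForm_tmul hB hA hx ψ φ Ξ Θ)), hs, hn⟩

end LimitForm

end SpinBoson

end

open SpinBoson in
theorem mainTheorem7 {S T h : Type*}
    [NormedAddCommGroup S] [InnerProductSpace ℂ S] [CompleteSpace S]
    [AddCommGroup T] [Module ℂ T] [TopologicalSpace T] [IsTopologicalAddGroup T]
    [ContinuousSMul ℂ T]
    [NormedAddCommGroup h] [InnerProductSpace ℂ h] [CompleteSpace h]
    (G : GelfandTriple T h) (ω : Dispersion G)
    (A B : S →L[ℂ] S) (hA : IsSelfAdjoint A) (hB : IsStarNormal B)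
    (hdec : IsDecomposable (spectralPVM hB) A)
    (v g : AntiDual T) (hg : g = ω.config v) :
    (∀ (ψ φ : S) (Ξ Θ : FockFin G.test),
      (doiMeasure hdec ψ φ).Integrable (G.spinKernel g Ξ Θ)) ∧
    ∃ a : RenormSpace G B g →L⋆[ℂ] RenormSpace G B g →L[ℂ] ℂ,
      (∀ (ψ φ : S) (Ξ Θ : FockFin G.test),
        a (toRenorm G B g (ψ ⊗ₜ[ℂ] Ξ)) (toRenorm G B g (φ ⊗ₜ[ℂ] Θ)) =
          doi hdec (G.spinKernel g Ξ Θ) ψ φ) ∧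
      (∀ a' : RenormSpace G B g →L⋆[ℂ] RenormSpace G B g →L[ℂ] ℂ,
        (∀ (ψ φ : S) (Ξ Θ : FockFin G.test),
          a' (toRenorm G B g (ψ ⊗ₜ[ℂ] Ξ)) (toRenorm G B g (φ ⊗ₜ[ℂ] Θ)) =
            doi hdec (G.spinKernel g Ξ Θ) ψ φ) → a' = a) ∧
      (∀ Ψ Φ, a Ψ Φ = conj (a Φ Ψ)) ∧
      (∀ Ψ Φ, ‖a Ψ Φ‖ ≤ ‖A‖ * ‖Ψ‖ * ‖Φ‖) ∧
      (∀ {ι : Type*} (l : Filter ι) (vα : ι → AntiDual T) (gα : ι → h),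
        (∀ i, ω.config (vα i) = G.ofHilbert (gα i)) →
        (∀ f : T, Tendsto (fun i => vα i f) l (𝓝 (v f))) →
        (∀ x : h, G.ofHilbert x = g → Tendsto gα l (𝓝 x)) →
        ∀ Ψ Φ : S ⊗[ℂ] FockFin G.test,
          Tendsto (fun i => regularSpinForm G B A (gα i) Ψ Φ) l
            (𝓝 (a (toRenorm G B g Ψ) (toRenorm G B g Φ)))) ∧
      ∃! R : RenormSpace G B g →L[ℂ] RenormSpace G B g,
        IsSelfAdjoint R ∧ ∀ Ψ Φ, ⟪Ψ, R Φ⟫_ℂ = a Ψ Φ := by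
  obtain ⟨a, ha, hs, hn⟩ := exists_renormForm (G := G) hB hdec hA g
  refine ⟨integrable_spinKernel G hB hdec g, a, ha,
    fun a' ha' => renormForm_ext fun ψ φ Ξ Θ => (ha' ψ φ Ξ Θ).trans (ha ψ φ Ξ Θ).symm, hs, hn,
    fun {ι} l vα gα h1 h2 h3 Ψ Φ => ?_, existsUnique_isSelfAdjoint_inner_eq a hs⟩
  have hx : Approximates G l gα g := by
    refine ⟨fun f => ?_, h3⟩
    simp only [← h1, hg]
    -- Weak convergence of the `vα`, tested on `ω⁻¹ f`, is weak convergence of the configurations.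
    exact (h2 (ω.op.symm f)).neg
  refine tendsto_regularSpinForm_of_tmul (A := A)
    (a := fun Ψ Φ => a (toRenorm G B g Ψ) (toRenorm G B g Φ)) (fun ψ φ Ξ Θ => ?_)
    (fun Ψ Ψ' Φ => by simp only [map_add, add_apply])
    (fun Ψ Φ Φ' => by simp only [map_add]) Ψ Φ
  rw [ha]
  exact tendsto_regularSpinForm_tmul hB hdec hx ψ φ Ξ Θ
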